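/- **Setting.** Let $X=(X_n)_{n\ge 0}$ be a time-homogeneous Markov chain on $D\cup\{\partial\}$, where $D$ is a measurable space, absorbed at $\partial\notin D$ at time $\tau_\partial$. For $A\subset D$ measurable let $T_A=\inf\{n\ge 0: X_n\in A\}$. Functions defined on a subset of $D\cup\{\partial\}$ are extended by $0$. Let $S_nf(x)=\mathbb E_x(f(X_n)\mathbf 1_{n<\tau_\partial})$. Let $\{D_1,D_2\}$ be a measurable partition of $D$ with $\mathbb P_x(T_{D_1}=+\infty)=1$ for all $x\in D_2$. Let $P_n$ and $R_n$ be the sub-Markovian semigroups of $X$ restricted to $D_1$ and $D_2$, i.e. $P_n(x,\cdot)=\mathbb P_x(X_n\in\cdot\cap D_1)$ for $x\in D_1$ and $R_n(x,\cdot)=\mathbb P_x(X_n\in\cdot\cap D_2)$ for $x\in D_2$, and let $Q(x,\cdot)=\mathbb P_x(X_1\in\cdot\cap D_2)$ for $x\in D_1$. For a sub-Markovian semigroup $(S_n)$ on a measurable space $E$ and a non-negative measure $\mu$ on $E$, put $$\theta_S(\mu)=\inf\{\theta\ge 0:\ \liminf_n\theta^{-n}\mu S_n\mathbf 1=0\},\qquad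 \theta_{0,S}=\sup_{x\in E}\theta_S(\delta_x),$$ $$j_S(\mu)=\inf\{\ell\ge0:\ \liminf_n n^{-\ell}\theta_{0,S}^{-n}\mu S_n\mathbf 1=0\}\quad(\inf\emptyset=0),\qquad j_S(x)=j_S(\delta_x),\qquad j_{0,S}=\sup_{x\in E}j_S(x).$$ For measurable $W\ge 1$ let $L^\infty(W)$ be the set of measurable $f$ with $\|f\|_W:=\sup_x|f(x)|/W(x)<\infty$. *Assumption (A)* for $(S_n)$, with a countable set $I_S$, a measurable function $W_S:E\to[1,\infty)$, non-negative, not identically zero $\eta_{S,i}\in L^\infty(W_S)$, probability measures $\nu_{S,i}$ with $\nu_{S,i}(W_S)<\infty$ ($i\in I_S$), and a sequence $\alpha_{S,n}\to0$: $\theta_{0,S}\in(0,1]$, $j_S$ is integer valued on $E$, $S_nW_S<\infty$ for all $n$, $\sum_i\eta_{S,i}\,\nu_{S,i}(W_S)\in L^\infty(W_S)$, and for all $x\in E$, $n\ge1$ and $f\in L^\infty(W_S)$, $$\Big|\theta_{0,S}^{-n}n^{-j_S(x)}S_nf(x)-\sum_{i\in I_S}\eta_{S,i}(x)\nu_{S,i}(f)\Big|\le\alpha_{S,n}W_S(x)\|f\|_{W_S}.\tag{1}$$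 Set $\eta_S=\sum_i\eta_{S,i}$. The same notation is used with $P$ on $D_1$ and $R$ on $D_2$ in place of $S$, with the convention $\alpha_{P,0}=\alpha_{R,0}=1$. *(A1)*: $j_{0,P}<\infty$; $(P_n)$ satisfies (A); there are a measurable $W_R:D_2\to[1,\infty)$, $\gamma\in(0,\theta_{0,P})$ and $c_1>0$ with $\mathbb E_x(W_R(X_1))\le W_P(x)$ for $x\in D_1$ and $\mathbb E_y(W_R(X_n))\le c_1\gamma^nW_R(y)$ for $y\in D_2$, $n\ge0$. *(A2)*: $j_{0,R}<\infty$; $(R_n)$ satisfies (A); there are a measurable $W_P:D_1\to[1,\infty)$, $\gamma\in(0,\theta_{0,R})$ and $c_2>0$ with $\mathbb E_x(W_R(X_1))\le W_P(x)$ and $\mathbb E_x(W_P(X_n))\le c_2\gamma^nW_P(x)$ for $x\in D_1$, $n\ge0$. *(A3)*: $j_P\equiv0$, $j_{0,R}<\infty$, $\theta_{0,R}=\theta_{0,P}$; $(P_n)$ satisfies (A) with $\eta_P>0$ on $D_1$; $(R_n)$ satisfies (A); $\mathbb E_x(W_R(X_1))\le W_P(x)$ for $x\in D_1$; and there is an integer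 $\ell_*\ge0$ such that, for all $x\in D_1$ and $i\in I_P$, $\mathbb P_x(j_R(X_{T_{D_2}})\le\ell_*,\ T_{D_2}<\infty)=\mathbb P_x(T_{D_2}<\infty)$ and $\mathbb P_{\nu_{P,i}}(j_R(X_{T_{D_2}})=\ell_*,\ \eta_R(X_{T_{D_2}})>0,\ T_{D_2}<\infty)>0$. **Theorem.** If (A1), (A2) or (A3) holds, then $(S_n)$ satisfies (A) with $W_S=W_P+W_R$. More precisely, there is a constant $C>0$, independent of $x$ and $n$, such that (A) holds with the following parameters. (i) Under (A1): $\theta_{0,S}=\theta_{0,P}$; $j_S=j_P$ on $D_1$ and $j_S=0$ on $D_2$; $I_S=I_P$, and there are constants $p_i>0$ such that $\eta_{S,i}=p_i\,\eta_{P,i}$ and $$\nu_{S,i}=p_i^{-1}\Big(\nu_{P,i}+\sum_{k\ge0}\theta_{0,S}^{-k-1}\,\mathbb P_{\nu_{P,i}}(T_{D_2}=1,\ X_{k+1}\in\cdot)\Big);$$ $$\alpha_{S,n}=C\sum_{k=0}^n\Big(\frac{\gamma}{\theta_{0,P}}\Big)^k\Big((1+j_{0,P})\alpha_{P,n-k}+j_{0,P}\frac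 kn\Big).$$ (ii) Under (A2): $\theta_{0,S}=\theta_{0,R}$; $j_S(x)=\max_{n\ge0}j_R(\delta_xP_nQ)$ for $x\in D_1$ (the maximum being attained) and $j_S=j_R$ on $D_2$; $I_S=I_R$, $\nu_{S,i}=\nu_{R,i}$, $$\eta_{S,i}(x)=\mathbb E_x\Big(\theta_{0,R}^{-T_{D_2}}\,\eta_{R,i}(X_{T_{D_2}})\,\mathbf 1_{j_R(X_{T_{D_2}})=j_S(x)}\,\mathbf 1_{T_{D_2}<\infty}\Big);$$ $$\alpha_{S,n}=C\sum_{k=0}^n\Big(\alpha_{R,n-k}+j_{0,R}\frac kn\Big)\Big(\frac\gamma{\theta_{0,R}}\Big)^k.$$ (iii) Under (A3): $\theta_{0,S}=\theta_{0,R}=\theta_{0,P}$; $j_S=1+\ell_*$ on $D_1$ and $j_S=j_R$ on $D_2$; $I_S=I_R$, $\nu_{S,i}=\nu_{R,i}$, $$\eta_{S,i}(x)=\eta_{R,i}(x)+\frac{\theta_{0,P}^{-1}}{1+\ell_*}\sum_{k\in I_P}\eta_{P,k}(x)\,\mathbb E_{\nu_{P,k}}\big(\eta_{R,i}(X_1)\mathbf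 1_{j_R(X_1)=\ell_*}\big),\qquad x\in D.$$ With $$\rho_n=\frac Cn\Big(\ell_*+\sum_{k=0}^n\Big(\alpha_{P,k}+\alpha_{R,k}\frac{k^{\ell_*}}{n^{\ell_*}}\Big)\Big),$$ estimate (1) holds with $\rho_n$ in place of $\alpha_{S,n}$ for $x\in D_1$ and with $\alpha_{R,n}$ in place of $\alpha_{S,n}$ for $x\in D_2$; in particular (A) holds with $\alpha_{S,n}=\max(\rho_n,\alpha_{R,n})$. -/

import Mathlib

open MeasureTheory ProbabilityTheory Filter Topology
open scoped ENNReal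

noncomputable section

namespace TwoSets

/-! ### Absorbed Markov chains

The absorbing point `∂` is `Sum.inr ()`, so that `D ∪ {∂}` is `D ⊕ Unit`. -/

/-- `X` is, under the probability measures `Pr x` (`x ∈ D`), a time-homogeneous Markov chain on
`D ∪ {∂}` with transition kernel `κ`, started from `x` and absorbed at `∂`. -/
structure IsAbsorbedMarkovChain {D Ω : Type*} [MeasurableSpace D] [MeasurableSpace Ω]
    (κ : Kernel (D ⊕ Unit) (D ⊕ Unit)) (Pr : Kernel D Ω) (X : ℕ → Ω → D ⊕ Unit) : Prop where
  markov_kernel : IsMarkovKernel κ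
  prob : ∀ x, IsProbabilityMeasure (Pr x)
  measurable : ∀ n, Measurable (X n)
  absorbed : κ (Sum.inr ()) = Measure.dirac (Sum.inr ())
  start : ∀ x, (Pr x).map (X 0) = Measure.dirac (Sum.inl x)
  markov : ∀ (x : D) (n : ℕ) (B : Set (Fin (n + 1) → D ⊕ Unit)) (A : Set (D ⊕ Unit)),
    MeasurableSet B → MeasurableSet A →
    Pr x {ω | (fun i : Fin (n + 1) => X i ω) ∈ B ∧ X (n + 1) ω ∈ A} =
      ∫⁻ ω in {ω | (fun i : Fin (n + 1) => X i ω) ∈ B}, κ (X n ω) A ∂(Pr x)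

section Chain

variable {D Ω : Type*} [MeasurableSpace D] [MeasurableSpace Ω]

theorem measurableEmbedding_inl : MeasurableEmbedding (Sum.inl : D → D ⊕ Unit) :=
  ⟨Sum.inl_injective, measurable_inl, fun _ hs => measurableSet_inl_image.2 hs⟩

/-- The sub-Markovian semigroup `S_n(x, ·) = ℙ_x(X_n ∈ ·, n < τ_∂)`. -/
def semigroup (Pr : Kernel D Ω) (X : ℕ → Ω → D ⊕ Unit) (n : ℕ) : Kernel D D :=
  (Pr.map (X n)).comapRight measurableEmbedding_inl

/-- The trace of a kernel on `D`: starting points in `A`, targets in `B`. -/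
def restrictTo (A : Set D) {B : Set D} (hB : MeasurableSet B) (κ : Kernel D D) : Kernel A B :=
  (κ.comap (Subtype.val : A → D) measurable_subtype_coe).comapRight
    (MeasurableEmbedding.subtype_coe hB)

/-- The law `ℙ_ν` of the chain whose initial law is the measure `ν` on `A ⊆ D`. -/
def lawFrom (Pr : Kernel D Ω) {A : Set D} (ν : Measure A) : Measure Ω :=
  (ν.map Subtype.val).bind Pr

/-- The hitting time `T_A = inf {n ≥ 0, X_n ∈ A}`, equal to `⊤` if `A` is never hit. -/
def hitTime (X : ℕ → Ω → D ⊕ Unit) (A : Set D) (ω : Ω) : WithTop ℕ :=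
  hittingAfter X (Sum.inl '' A) 0 ω

/-- The position `X_{T_A}`; only meaningful on the event `T_A < ∞`. -/
def hitPos (X : ℕ → Ω → D ⊕ Unit) (A : Set D) (ω : Ω) : D ⊕ Unit :=
  X ((hitTime X A ω).untopD 0) ω

open scoped Classical in
/-- Extension by `0` to `D` of a function on `A ⊆ D`. -/
def ext {A : Set D} (f : A → ℝ) (x : D) : ℝ := if h : x ∈ A then f ⟨x, h⟩ else 0

/-- Extension by `0` to `D ∪ {∂}` of a function on `A ⊆ D`. -/
def extB {A : Set D} (f : A → ℝ) : D ⊕ Unit → ℝ := Sum.elim (ext f) (fun _ => 0)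

end Chain

/-! ### Exponential and polynomial convergence parameters -/

section Param

variable {E : Type*} [MeasurableSpace E]

/-- `θ_S(μ) = inf {θ ≥ 0, liminf θ⁻ⁿ μ S_n 1 = 0}`. In `ℝ≥0∞` one has `0⁻¹ = ∞` and `∞ * 0 = 0`. -/
def expParam (S : ℕ → Kernel E E) (μ : Measure E) : ℝ≥0∞ :=
  sInf {θ : ℝ≥0∞ | liminf (fun n : ℕ => θ⁻¹ ^ n * (μ.bind (S n)) Set.univ) atTop = 0}

/-- `θ_{0,S} = sup_x θ_S(δ_x)`. -/
def expParam₀ (S : ℕ → Kernel E E) : ℝ≥0∞ := ⨆ x, expParam S (Measure.dirac x)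

/-- `θ_{0,S}` as a real number; it never exceeds `1` for a sub-Markovian semigroup. -/
def theta₀ (S : ℕ → Kernel E E) : ℝ := (expParam₀ S).toReal

/-- `j_S(μ) = inf {ℓ ≥ 0, liminf n^{-ℓ} θ_{0,S}⁻ⁿ μ S_n 1 = 0}`, where `inf ∅ = 0`. -/
def polyParam (S : ℕ → Kernel E E) (μ : Measure E) : ℝ :=
  sInf {ℓ : ℝ | 0 ≤ ℓ ∧ liminf (fun n : ℕ =>
    (n : ℝ≥0∞) ^ (-ℓ) * (expParam₀ S)⁻¹ ^ n * (μ.bind (S n)) Set.univ) atTop = 0}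

/-- `j_S(x) = j_S(δ_x)`. -/
def jAt (S : ℕ → Kernel E E) (x : E) : ℝ := polyParam S (Measure.dirac x)

/-- `j_{0,S} = sup_x j_S(x) < ∞`. -/
def FiniteJ₀ (S : ℕ → Kernel E E) : Prop := BddAbove (Set.range (jAt S))

/-- `j_{0,S} = sup_x j_S(x)`, to be used when this supremum is finite. -/
def j₀ (S : ℕ → Kernel E E) : ℝ := ⨆ x, jAt S x

/-! ### Assumption (A) -/

/-- `f ∈ L^∞(W)`. -/
def MemLW (W f : E → ℝ) : Prop :=
  Measurable f ∧ BddAbove (Set.range fun x => |f x| / W x)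

/-- The norm `‖f‖_W = ‖f / W‖_∞`. -/
def normW (W f : E → ℝ) : ℝ := ⨆ x, |f x| / W x

/-- At the starting point `x`, the convergence estimate with error `a n`: for all `n ≥ 1` and all
`f ∈ L^∞(W)`, the distance from `θ_{0,S}⁻ⁿ n^{-j_S(x)} 𝔼_x(f(X_n) 1_{n < τ_∂})` to
`∑ i, η_i(x) ν_i(f)` is at most `a n * W x * ‖f‖_W`. -/
def ConvergesAt (S : ℕ → Kernel E E) {I : Type*} (W : E → ℝ) (η : I → E → ℝ)
    (ν : I → Measure E) (a : ℕ → ℝ) (x : E) : Prop :=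
  ∀ f : E → ℝ, MemLW W f → ∀ n : ℕ, 1 ≤ n →
    |(theta₀ S)⁻¹ ^ n * (n : ℝ) ^ (-jAt S x) * (∫ y, f y ∂(S n x))
        - ∑' i, η i x * ∫ y, f y ∂(ν i)| ≤ a n * W x * normW W f

/-- Assumption (A) for the semigroup `S`, with index set `I`, weight `W`, functions `η i`,
probability measures `ν i` and convergence rate `a`. The expectations of functions of `L^∞(W)` are
required to be genuine ones (`integrable_semigroup`). -/
structure AssumptionA (S : ℕ → Kernel E E) {I : Type*} (W : E → ℝ) (η : I → E → ℝ)
    (ν : I → Measure E) (a : ℕ → ℝ) : Prop where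
  theta_pos : 0 < expParam₀ S
  theta_le_one : expParam₀ S ≤ 1
  j_int : ∀ x, ∃ k : ℕ, jAt S x = k
  measurable_W : Measurable W
  one_le_W : ∀ x, 1 ≤ W x
  countable : Countable I
  prob : ∀ i, IsProbabilityMeasure (ν i)
  integrable_W : ∀ i, Integrable W (ν i)
  mem_eta : ∀ i, MemLW W (η i)
  eta_nonneg : ∀ i x, 0 ≤ η i x
  eta_ne_zero : ∀ i, ∃ x, η i x ≠ 0
  summable_eta : ∀ x, Summable fun i => η i x * ∫ y, W y ∂(ν i)
  mem_sum : MemLW W fun x => ∑' i, η i x * ∫ y, W y ∂(ν i)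
  integrable_semigroup : ∀ n x, Integrable W (S n x)
  tendsto_rate : Tendsto a atTop (𝓝 0)
  converges : ∀ x, ConvergesAt S W η ν a x

end Param

/-! ### The three situations

Here `P` and `R` are the semigroups of the chain restricted to `D₁` and to `D₂`, and `Q` is the
transition kernel from `D₁` to `D₂`. -/

section Cases

variable {E F : Type*} [MeasurableSpace E] [MeasurableSpace F]

/-- `𝔼_x(W_R(X_1)) ≤ W_P(x)` for all `x ∈ D₁`. -/
def JumpBound (Q : Kernel E F) (WP : E → ℝ) (WR : F → ℝ) : Prop :=
  ∀ x, ∫⁻ y, ENNReal.ofReal (WR y) ∂(Q x) ≤ ENNReal.ofReal (WP x)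

/-- `𝔼_x(W(X_n)) ≤ c γⁿ W(x)` for all `x` and all `n ≥ 0`, for the semigroup `S`. -/
def GeomBound (S : ℕ → Kernel E E) (W : E → ℝ) (c γ : ℝ) : Prop :=
  ∀ x (n : ℕ), ∫⁻ y, ENNReal.ofReal (W y) ∂(S n x) ≤ ENNReal.ofReal (c * γ ^ n * W x)

/-- Assumption (A1): `D₁` dominates. -/
structure AssumptionA1 (P : ℕ → Kernel E E) (Q : Kernel E F) (R : ℕ → Kernel F F)
    {I : Type*} (WP : E → ℝ) (ηP : I → E → ℝ) (νP : I → Measure E) (αP : ℕ → ℝ)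
    (WR : F → ℝ) (γ c : ℝ) : Prop where
  finite_j : FiniteJ₀ P
  assumptionA : AssumptionA P WP ηP νP αP
  measurable_WR : Measurable WR
  one_le_WR : ∀ y, 1 ≤ WR y
  gamma_pos : 0 < γ
  gamma_lt : γ < theta₀ P
  c_pos : 0 < c
  jump : JumpBound Q WP WR
  geom : GeomBound R WR c γ

/-- Assumption (A2): `D₂` dominates. -/
structure AssumptionA2 (P : ℕ → Kernel E E) (Q : Kernel E F) (R : ℕ → Kernel F F)
    {I : Type*} (WR : F → ℝ) (ηR : I → F → ℝ) (νR : I → Measure F) (αR : ℕ → ℝ)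
    (WP : E → ℝ) (γ c : ℝ) : Prop where
  finite_j : FiniteJ₀ R
  assumptionA : AssumptionA R WR ηR νR αR
  measurable_WP : Measurable WP
  one_le_WP : ∀ x, 1 ≤ WP x
  gamma_pos : 0 < γ
  gamma_lt : γ < theta₀ R
  c_pos : 0 < c
  jump : JumpBound Q WP WR
  geom : GeomBound P WP c γ

/-- Assumption (A3): equal exponential parameters. -/
structure AssumptionA3 {D Ω : Type*} [MeasurableSpace D] [MeasurableSpace Ω]
    (Pr : Kernel D Ω) (X : ℕ → Ω → D ⊕ Unit) {D₁ D₂ : Set D}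
    (P : ℕ → Kernel D₁ D₁) (Q : Kernel D₁ D₂) (R : ℕ → Kernel D₂ D₂)
    {I J : Type*} (WP : D₁ → ℝ) (ηP : I → D₁ → ℝ) (νP : I → Measure D₁) (αP : ℕ → ℝ)
    (WR : D₂ → ℝ) (ηR : J → D₂ → ℝ) (νR : J → Measure D₂) (αR : ℕ → ℝ) (ℓ : ℕ) : Prop where
  j_P : ∀ x, jAt P x = 0
  finite_j : FiniteJ₀ R
  theta_eq : expParam₀ R = expParam₀ P
  assumptionA_P : AssumptionA P WP ηP νP αP
  eta_P_pos : ∀ x, 0 < ∑' k, ηP k x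
  assumptionA_R : AssumptionA R WR ηR νR αR
  jump : JumpBound Q WP WR
  /-- `ℙ_x(j_R(X_{T_{D₂}}) ≤ ℓ and T_{D₂} < ∞) = ℙ_x(T_{D₂} < ∞)` for all `x ∈ D₁`. -/
  entry_le : ∀ x : D₁,
    Pr x {ω | extB (jAt R) (hitPos X D₂ ω) ≤ ℓ ∧ hitTime X D₂ ω < ⊤} =
      Pr x {ω | hitTime X D₂ ω < ⊤}
  /-- `ℙ_ν(j_R(X_{T_{D₂}}) = ℓ and η_R(X_{T_{D₂}}) > 0 and T_{D₂} < ∞) > 0` for `ν = ν_{P,k}`. -/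
  entry_eq : ∀ k, 0 < lawFrom Pr (νP k)
    {ω | extB (jAt R) (hitPos X D₂ ω) = ℓ ∧ 0 < extB (fun y => ∑' i, ηR i y) (hitPos X D₂ ω) ∧
      hitTime X D₂ ω < ⊤}

end Cases

/-! ### The explicit parameters of the whole chain -/

section Explicit

variable {D Ω : Type*} [MeasurableSpace D] [MeasurableSpace Ω] {D₁ D₂ : Set D}

/-- The measure `ν + ∑_{k ≥ 0} θ^{-k-1} ℙ_ν(T_{D₂} = 1, X_{k+1} ∈ ·)` on `D`. -/
def measA1 (Pr : Kernel D Ω) (X : ℕ → Ω → D ⊕ Unit) (D₂ : Set D) (θ : ℝ) (ν : Measure D₁) :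
    Measure D :=
  ν.map Subtype.val + Measure.sum fun k : ℕ => ENNReal.ofReal (θ⁻¹ ^ (k + 1)) •
    ((((lawFrom Pr ν).restrict {ω | hitTime X D₂ ω = 1}).map (X (k + 1))).comap Sum.inl)

/-- `C ∑_{k=0}^n (γ/θ)^k ((1 + j₀) α_{n-k} + j₀ k/n)`. -/
def rateA1 (C γ θ j : ℝ) (α : ℕ → ℝ) (n : ℕ) : ℝ :=
  C * ∑ k ∈ Finset.range (n + 1), (γ / θ) ^ k * ((1 + j) * α (n - k) + j * ((k : ℝ) / n))

open scoped Classical in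
/-- `𝔼_x(θ^{-T} η(X_T) 1_{j_R(X_T) = j}; T < ∞)` with `T = T_{D₂}`. -/
def etaA2 (Pr : Kernel D Ω) (X : ℕ → Ω → D ⊕ Unit) (θ : ℝ) (jR η : D₂ → ℝ) (j : ℝ) (x : D) : ℝ :=
  ∫ ω, (if hitTime X D₂ ω < ⊤ then
    θ⁻¹ ^ ((hitTime X D₂ ω).untopD 0) *
      extB (fun y : D₂ => if jR y = j then η y else 0) (hitPos X D₂ ω) else 0) ∂(Pr x)

/-- `C ∑_{k=0}^n (α_{n-k} + j₀ k/n) (γ/θ)^k`. -/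
def rateA2 (C γ θ j : ℝ) (α : ℕ → ℝ) (n : ℕ) : ℝ :=
  C * ∑ k ∈ Finset.range (n + 1), (α (n - k) + j * ((k : ℝ) / n)) * (γ / θ) ^ k

open scoped Classical in
/-- `η(x) + θ⁻¹/(1+ℓ) ∑_k η_{P,k}(x) 𝔼_{ν_{P,k}}(η(X_1) 1_{j_R(X_1) = ℓ})`. -/
def etaA3 (Pr : Kernel D Ω) (X : ℕ → Ω → D ⊕ Unit) {I : Type*} (θ : ℝ) (ℓ : ℕ)
    (ηP : I → D₁ → ℝ) (νP : I → Measure D₁) (jR η : D₂ → ℝ) (x : D) : ℝ :=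
  ext η x + θ⁻¹ / (1 + ℓ) * ∑' k, ext (ηP k) x *
    ∫ ω, extB (fun y : D₂ => if jR y = ℓ then η y else 0) (X 1 ω) ∂(lawFrom Pr (νP k))

/-- `(C/n) (ℓ + ∑_{k=0}^n (α_{P,k} + α_{R,k} k^ℓ/n^ℓ))`. -/
def rateA3 (C : ℝ) (ℓ : ℕ) (αP αR : ℕ → ℝ) (n : ℕ) : ℝ :=
  C / n * (ℓ + ∑ k ∈ Finset.range (n + 1), (αP k + αR k * ((k : ℝ) ^ ℓ / (n : ℝ) ^ ℓ)))

end Explicit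

end TwoSets

end

open TwoSets

/-!
# Convergence of absorbed Markov chains with two blocks and one-way jumps

The chain never returns from `D₂` to `D₁`, so that a path from `x ∈ D₁` which is alive in `D₂` at
time `n` has jumped exactly once. This gives, for `x ∈ D₁`,
`S_n(x, ·) = P_n(x, ·) + ∑_{k < n} (P_k Q R_{n-1-k})(x, ·)`, while `S_n = R_n` on `D₂`
(`IsAbsorbedMarkovChain.isTriangular`). The theorem is a statement on the asymptotics of this
convolution; it depends on which of the two blocks decays more slowly.

Assumption (A) says that `θ⁻ⁿ n^{-j(x)} S_n f(x)` converges to `Λ f(x)`, where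
`Λ(x, ·) = ∑ i, η i x • ν i` is a kernel (`limitMeasure`, `ConvergesToKernel`). In this form, the
convolution only involves compositions of kernels. The passage to it and back is
`AssumptionA.exists_convergesToKernel` and `assumptionA_of_limitMeasure`. The estimate behind all
three cases is `ConvergesToKernel.scaled_estimate`: the terms of the convolution have to be
normalised by `n^ℓ` for a common `ℓ`, although they are observed at an earlier time `m` and start
from points `y` with various `j(y) ≤ ℓ`. Only the points with `j(y) = ℓ` contribute to the limit
(`levelKernel`), with the weight `(m/n)^ℓ`.

* If `D₁` dominates, the time `k` spent in `D₂` is damped by `(γ/θ)^k`, and the limit is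
  `Λ_P + ∑ k, θ^{-k-1} Λ_P Q R_k` (`first_estimate_left`, `first_case`). Points of `D₂` have
  limit `0`.
* If `D₂` dominates, the time spent in `D₁` is damped, and the limit is the integral of `Λ_R` over
  the entrance position in `D₂`, restricted to the highest level of `j_R` that is reached
  (`second_estimate_left`, `second_case`). Fatou's lemma shows that this level is the polynomial
  order of some entrance law `δ_x P_k Q`, so that the maximum is attained (`ae_jAt_le_of_liminf`,
  `exists_level`).
* If both blocks decay like `θⁿ`, no term of the convolution is damped. Each of the `n` terms is
  close to `θ⁻¹ (m/n)^ℓ Λ_P Q Λ_R`, with `m` the time spent in `D₂`; the mean of `(m/n)^ℓ` tends to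
  `1/(1+ℓ)` (`abs_sum_div_pow_sub_le`), which yields the constant in `η` and the additional factor
  `n` (`third_estimate_left`, `third_case`). The limit does not vanish: the measures `Λ_P(x, ·)` are
  quasi-stationary (`ConvergesToKernel.integral_limit_bind`), so that if
  `Λ_P Q(x, ·)` did not charge the entrance points of level `ℓ`, neither would any `Λ_P P_m Q(x, ·)`
  (`ConvergesToKernel.limit_bind_eq_zero`).

In each case the convergence determines the parameters of `S`. An upper bound on the masses gives
`expParam_le_of_bound` and `polyParam_le_of_bound`; the lower bounds come from the mass of `S`
dominating the one of a block, or from the positivity of the limit.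

The explicit measures and functions are integrals over paths. They are expressed in terms of the
kernels through the joint law of the entrance time and position in `D₂`
(`IsAbsorbedMarkovChain.measure_entrance`, `measA1_eq`, `IsAbsorbedMarkovChain.etaA2_left`,
`IsAbsorbedMarkovChain.etaA3_left`).
-/

namespace TwoSets

/-! ### Elementary estimates on powers, geometric convolutions and Cesàro means -/

theorem one_sub_div_pow_le {m n : ℕ} (hn : 1 ≤ n) (ℓ : ℕ) :
    1 - ((m : ℝ) / n) ^ ℓ ≤ ℓ * (((n : ℝ) - m) / n) := by
  have hn' : (0 : ℝ) < n := by exact_mod_cast hn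
  have h := one_add_mul_sub_le_pow (a := (m : ℝ) / n)
    (le_trans (by norm_num) (div_nonneg m.cast_nonneg hn'.le)) ℓ
  have e : ((n : ℝ) - m) / n = 1 - m / n := by field_simp
  rw [e]
  linarith

theorem div_pow_le_one {m n : ℕ} (hmn : m ≤ n) (ℓ : ℕ) : ((m : ℝ) / n) ^ ℓ ≤ 1 :=
  pow_le_one₀ (by positivity) (div_le_one_of_le₀ (by exact_mod_cast hmn) (by positivity))

theorem pow_succ_sub_pow_succ_bounds {a : ℝ} (ha : 0 ≤ a) (ℓ : ℕ) :
    (ℓ + 1) * a ^ ℓ ≤ (a + 1) ^ (ℓ + 1) - a ^ (ℓ + 1) ∧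
      (a + 1) ^ (ℓ + 1) - a ^ (ℓ + 1) ≤ (ℓ + 1) * (a + 1) ^ ℓ := by
  induction ℓ with
  | zero => simp
  | succ ℓ ih =>
    obtain ⟨h1, h2⟩ := ih
    have hp : a ^ (ℓ + 1) ≤ (a + 1) ^ (ℓ + 1) := pow_le_pow_left₀ ha (by linarith) _
    have e1 : (a + 1) ^ (ℓ + 1 + 1) - a ^ (ℓ + 1 + 1)
        = a * ((a + 1) ^ (ℓ + 1) - a ^ (ℓ + 1)) + (a + 1) ^ (ℓ + 1) := by ring
    have e2 : (a + 1) ^ (ℓ + 1 + 1) - a ^ (ℓ + 1 + 1)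
        = (a + 1) * ((a + 1) ^ (ℓ + 1) - a ^ (ℓ + 1)) + a ^ (ℓ + 1) := by ring
    have m1 := mul_le_mul_of_nonneg_left h1 ha
    have m2 := mul_le_mul_of_nonneg_left h2 (by linarith : (0 : ℝ) ≤ a + 1)
    push_cast
    constructor
    · rw [e1]
      calc ((ℓ : ℝ) + 1 + 1) * a ^ (ℓ + 1) = a * ((ℓ + 1) * a ^ ℓ) + a ^ (ℓ + 1) := by ring
        _ ≤ _ := by linarith
    · rw [e2]
      calc _ ≤ (a + 1) * ((ℓ + 1) * (a + 1) ^ ℓ) + (a + 1) ^ (ℓ + 1) := by linarith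
        _ = _ := by ring

/-- Comparison of `∑_{m<n} m^ℓ` with `∫_0^n t^ℓ dt`. The error vanishes for `ℓ = 0`. -/
theorem abs_sum_div_pow_sub_le {n : ℕ} (hn : 1 ≤ n) (ℓ : ℕ) :
    |(∑ m ∈ Finset.range n, ((m : ℝ) / n) ^ ℓ) / n - 1 / (1 + ℓ)| ≤ ℓ / n := by
  have hn' : (0 : ℝ) < n := by exact_mod_cast hn
  rcases Nat.eq_zero_or_pos ℓ with rfl | hℓ
  · simp [hn'.ne']
  have hℓ' : (1 : ℝ) ≤ ℓ := by exact_mod_cast hℓ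
  have up : ((ℓ : ℝ) + 1) * ∑ m ∈ Finset.range n, (m : ℝ) ^ ℓ ≤ (n : ℝ) ^ (ℓ + 1) := by
    have := Finset.sum_range_sub (fun m : ℕ => (m : ℝ) ^ (ℓ + 1)) n
    rw [Finset.mul_sum]
    have h0 : ((0 : ℕ) : ℝ) ^ (ℓ + 1) = 0 := by simp
    rw [h0, sub_zero] at this
    rw [← this]
    refine Finset.sum_le_sum fun m _ => ?_
    push_cast
    exact (pow_succ_sub_pow_succ_bounds m.cast_nonneg ℓ).1
  have lo : (n : ℝ) ^ (ℓ + 1) ≤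
      ((ℓ : ℝ) + 1) * (∑ m ∈ Finset.range n, (m : ℝ) ^ ℓ + (n : ℝ) ^ ℓ) := by
    have e : ∑ m ∈ Finset.range n, (m : ℝ) ^ ℓ + (n : ℝ) ^ ℓ
        = ∑ m ∈ Finset.range n, ((m : ℝ) + 1) ^ ℓ := by
      rw [← Finset.sum_range_succ (fun m : ℕ => (m : ℝ) ^ ℓ), Finset.sum_range_succ']
      simp [hℓ.ne']
    have := Finset.sum_range_sub (fun m : ℕ => (m : ℝ) ^ (ℓ + 1)) n
    have h0 : ((0 : ℕ) : ℝ) ^ (ℓ + 1) = 0 := by simp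
    rw [h0, sub_zero] at this
    rw [e, Finset.mul_sum, ← this]
    refine Finset.sum_le_sum fun m _ => ?_
    push_cast
    exact (pow_succ_sub_pow_succ_bounds m.cast_nonneg ℓ).2
  set s := ∑ m ∈ Finset.range n, (m : ℝ) ^ ℓ
  have es : (∑ m ∈ Finset.range n, ((m : ℝ) / n) ^ ℓ) / n = s / (n : ℝ) ^ (ℓ + 1) := by
    simp_rw [div_pow, ← Finset.sum_div, s, div_div, pow_succ]
  have hp : (0 : ℝ) < (n : ℝ) ^ (ℓ + 1) := by positivity
  have hl : (0 : ℝ) < 1 + ℓ := by linarith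
  have h1 : s / (n : ℝ) ^ (ℓ + 1) ≤ 1 / (1 + ℓ) := by
    rw [div_le_div_iff₀ hp hl]; linarith
  have h2 : 1 / (1 + (ℓ : ℝ)) ≤ s / (n : ℝ) ^ (ℓ + 1) + 1 / n := by
    have e : s / (n : ℝ) ^ (ℓ + 1) + 1 / n = (s + (n : ℝ) ^ ℓ) / (n : ℝ) ^ (ℓ + 1) := by
      field_simp
      ring
    rw [e, div_le_div_iff₀ hl hp]; linarith
  have h3 : 1 / (n : ℝ) ≤ ℓ / n := by gcongr
  rw [es, abs_le]
  constructor <;> linarith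

/-- Comparison of a series with partial sums whose terms converge at rate `α`, at distance `k` from
the end of the sum being damped by the geometric factor `r ^ k`. -/
theorem abs_add_sum_sub_tsum_le {r J K : ℝ} (hr0 : 0 < r) (hr1 : r < 1) (hJ : 0 ≤ J) (hK : 0 ≤ K)
    {α : ℕ → ℝ} (hα0 : α 0 = 1) (hα : ∀ n, 0 ≤ α n) {n : ℕ}
    {u U : ℝ} {v w : ℕ → ℝ} (huU : |u - U| ≤ K * (α n + r ^ n))
    (hvw : ∀ k < n, |v k - w k| ≤
      K * r ^ (k + 1) * (α (n - (k + 1)) + J * (((k + 1 : ℕ) : ℝ) / n)))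
    (hw : ∀ k, |w k| ≤ K * r ^ (k + 1)) :
    |(u + ∑ k ∈ Finset.range n, v k) - (U + ∑' k, w k)| ≤
      K * (3 + 1 / (1 - r)) *
        ∑ k ∈ Finset.range (n + 1), r ^ k * (α (n - k) + J * ((k : ℝ) / n)) := by
  have hg : Summable fun k : ℕ => K * r ^ (k + 1) :=
    ((summable_geometric_of_lt_one hr0.le hr1).comp_injective (add_left_injective 1)).mul_left K
  have hws : Summable w := Summable.of_norm_bounded hg hw
  have hsplit := hws.sum_add_tsum_nat_add n
  have hr1' : 0 < 1 - r := by linarith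
  have htail : |∑' k, w (k + n)| ≤ K * (r ^ n / (1 - r)) := by
    have hgn : HasSum (fun k : ℕ => K * r ^ n * r * r ^ k) (K * r ^ n * r * (1 - r)⁻¹) :=
      (hasSum_geometric_of_lt_one hr0.le hr1).mul_left _
    have := tsum_of_norm_bounded (f := fun k => w (k + n)) hgn (fun k => by
      rw [Real.norm_eq_abs]
      refine (hw _).trans (le_of_eq ?_)
      ring)
    rw [Real.norm_eq_abs] at this
    refine this.trans ?_
    have h0 : 0 ≤ K * r ^ n * (1 - r)⁻¹ := by positivity
    calc K * r ^ n * r * (1 - r)⁻¹ = (K * r ^ n * (1 - r)⁻¹) * r := by ring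
      _ ≤ (K * r ^ n * (1 - r)⁻¹) * 1 := by gcongr
      _ = _ := by ring
  set F : ℕ → ℝ := fun k => r ^ k * (α (n - k) + J * ((k : ℝ) / n)) with hF
  have hF0 : ∀ k, 0 ≤ F k := fun k =>
    mul_nonneg (by positivity) (add_nonneg (hα _) (by positivity))
  set T := ∑ k ∈ Finset.range (n + 1), F k with hT
  have hTn : α n ≤ T := by
    have := Finset.single_le_sum (f := F) (fun k _ => hF0 k)
      (Finset.mem_range.2 (Nat.succ_pos n))
    simpa [hF] using this
  -- the last term of `T` contains `α 0 = 1`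
  have hTr : r ^ n ≤ T := by
    have h := Finset.single_le_sum (f := F) (fun k _ => hF0 k)
      (Finset.mem_range.2 (Nat.lt_succ_self n))
    refine le_trans ?_ h
    simp only [hF, Nat.sub_self, hα0]
    have : 0 ≤ J * ((n : ℝ) / n) := by positivity
    nlinarith [pow_pos hr0 n]
  have hTs : ∑ k ∈ Finset.range n, F (k + 1) ≤ T := by
    rw [hT, Finset.sum_range_succ']
    linarith [hF0 0]
  have hsum : |∑ k ∈ Finset.range n, (v k - w k)| ≤ K * T := by
    refine (Finset.abs_sum_le_sum_abs _ _).trans ?_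
    refine le_trans ?_ (mul_le_mul_of_nonneg_left hTs hK)
    rw [Finset.mul_sum]
    refine Finset.sum_le_sum fun k hk => ?_
    refine (hvw k (Finset.mem_range.1 hk)).trans (le_of_eq ?_)
    simp only [hF]
    ring
  have e : (u + ∑ k ∈ Finset.range n, v k) - (U + ∑' k, w k)
      = (u - U) + ∑ k ∈ Finset.range n, (v k - w k) - ∑' k, w (k + n) := by
    rw [← hsplit, Finset.sum_sub_distrib]; ring
  rw [e]
  have h1 := abs_sub ((u - U) + ∑ k ∈ Finset.range n, (v k - w k)) (∑' k, w (k + n))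
  have h2 := abs_add_le (u - U) (∑ k ∈ Finset.range n, (v k - w k))
  have h3 : K * (α n + r ^ n) ≤ K * (T + T) := by gcongr
  have h4 : K * (r ^ n / (1 - r)) ≤ K * (T / (1 - r)) := by gcongr
  have e2 : K * (3 + 1 / (1 - r)) * T = K * (T + T) + K * T + K * (T / (1 - r)) := by
    field_simp; ring
  rw [e2]
  linarith

theorem tendsto_sum_geometric_mul {r J b : ℝ} (hr0 : 0 < r) (hr1 : r < 1) {α : ℕ → ℝ}
    (hα : Tendsto α atTop (𝓝 0)) :
    Tendsto (fun n : ℕ => ∑ k ∈ Finset.range (n + 1), r ^ k * (b * α (n - k) + J * ((k : ℝ) / n)))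
      atTop (𝓝 0) := by
  obtain ⟨M, hM⟩ : ∃ M, ∀ n, |α n| ≤ M := by
    obtain ⟨M, hM⟩ := (Metric.isBounded_range_of_tendsto α hα).exists_norm_le
    exact ⟨M, fun n => hM _ ⟨n, rfl⟩⟩
  have key : Tendsto (fun n : ℕ => ∑' k : ℕ, (if k ∈ Finset.range (n + 1) then
      r ^ k * (b * α (n - k) + J * ((k : ℝ) / n)) else 0)) atTop (𝓝 (∑' _ : ℕ, (0 : ℝ))) := by
    refine tendsto_tsum_of_dominated_convergence (bound := fun k => r ^ k * (|b| * M + |J|))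
      ((summable_geometric_of_lt_one hr0.le hr1).mul_right _) (fun k => ?_)
      (Eventually.of_forall fun n k => ?_)
    · have h1 : Tendsto (fun n : ℕ => r ^ k * (b * α (n - k) + J * ((k : ℝ) / n))) atTop
          (𝓝 (r ^ k * (b * 0 + J * 0))) := by
        refine Tendsto.const_mul _ (Tendsto.add (Tendsto.const_mul _ ?_) (Tendsto.const_mul _ ?_))
        · exact hα.comp (tendsto_sub_atTop_nat k)
        · exact tendsto_const_div_atTop_nhds_zero_nat _
      have h2 : r ^ k * (b * 0 + J * 0) = 0 := by ring
      rw [h2] at h1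
      refine h1.congr' ?_
      filter_upwards [eventually_ge_atTop k] with n hn
      rw [if_pos (Finset.mem_range.2 (Nat.lt_succ_of_le hn))]
    · split_ifs with h
      · have hk : (k : ℝ) / n ≤ 1 := div_le_one_of_le₀
          (by exact_mod_cast Nat.lt_succ_iff.1 (Finset.mem_range.1 h)) (by positivity)
        rw [Real.norm_eq_abs, abs_mul, abs_of_pos (pow_pos hr0 k)]
        refine mul_le_mul_of_nonneg_left ?_ (pow_pos hr0 k).le
        refine (abs_add_le _ _).trans (add_le_add ?_ ?_)
        · rw [abs_mul]; exact mul_le_mul_of_nonneg_left (hM _) (abs_nonneg _)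
        · rw [abs_mul, abs_of_nonneg (by positivity : 0 ≤ (k : ℝ) / n)]
          exact mul_le_of_le_one_right (abs_nonneg _) hk
      · have : 0 ≤ M := (abs_nonneg _).trans (hM 0)
        rw [norm_zero]; positivity
  rw [tsum_zero] at key
  refine key.congr fun n => ?_
  rw [tsum_eq_sum (s := Finset.range (n + 1)) (fun k hk => if_neg hk)]
  exact Finset.sum_congr rfl fun k hk => if_pos hk

theorem tendsto_rateA1 {C γ θ j : ℝ} {α : ℕ → ℝ} (h0 : 0 < γ / θ) (h1 : γ / θ < 1)
    (hα : Tendsto α atTop (𝓝 0)) : Tendsto (rateA1 C γ θ j α) atTop (𝓝 0) := by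
  have := (tendsto_sum_geometric_mul (J := j) (b := 1 + j) h0 h1 hα).const_mul C
  rwa [mul_zero] at this

theorem tendsto_rateA2 {C γ θ j : ℝ} {α : ℕ → ℝ} (h0 : 0 < γ / θ) (h1 : γ / θ < 1)
    (hα : Tendsto α atTop (𝓝 0)) : Tendsto (rateA2 C γ θ j α) atTop (𝓝 0) := by
  have := (tendsto_sum_geometric_mul (J := j) (b := 1) h0 h1 hα).const_mul C
  rw [mul_zero] at this
  refine this.congr fun n => ?_
  simp only [rateA2, one_mul]
  congr 1
  exact Finset.sum_congr rfl fun k _ => mul_comm _ _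

theorem tendsto_rateA3 {C : ℝ} {ℓ : ℕ} {αP αR : ℕ → ℝ} (hP : Tendsto αP atTop (𝓝 0))
    (hR : Tendsto αR atTop (𝓝 0)) (hR0 : ∀ n, 0 ≤ αR n) :
    Tendsto (rateA3 C ℓ αP αR) atTop (𝓝 0) := by
  have hshift : Tendsto (fun n : ℕ => ((n : ℝ) + 1) / n) atTop (𝓝 1) := by
    have h : Tendsto (fun n : ℕ => 1 + 1 / (n : ℝ)) atTop (𝓝 (1 + 0)) :=
      tendsto_const_nhds.add tendsto_one_div_atTop_nhds_zero_nat
    rw [add_zero] at h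
    refine h.congr' ?_
    filter_upwards [eventually_ge_atTop 1] with n hn
    have : (0 : ℝ) < n := by exact_mod_cast hn
    field_simp
  have mean : ∀ {a : ℕ → ℝ}, Tendsto a atTop (𝓝 0) →
      Tendsto (fun n : ℕ => (∑ k ∈ Finset.range (n + 1), a k) / n) atTop (𝓝 0) := by
    intro a ha
    have h := (ha.cesaro.comp (tendsto_add_atTop_nat 1)).mul hshift
    rw [zero_mul] at h
    refine h.congr fun n => ?_
    simp only [Function.comp, Nat.cast_add, Nat.cast_one]
    have : (n : ℝ) + 1 ≠ 0 := by positivity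
    field_simp
  have hRl : Tendsto (fun n : ℕ => (∑ k ∈ Finset.range (n + 1),
      αR k * ((k : ℝ) ^ ℓ / (n : ℝ) ^ ℓ)) / n) atTop (𝓝 0) := by
    refine squeeze_zero (fun n => ?_) (fun n => ?_) (mean hR)
    · exact div_nonneg (Finset.sum_nonneg fun k _ => mul_nonneg (hR0 k) (by positivity))
        n.cast_nonneg
    · gcongr with k hk
      rw [← div_pow]
      exact mul_le_of_le_one_right (hR0 k)
        (div_pow_le_one (Nat.lt_succ_iff.1 (Finset.mem_range.1 hk)) ℓ)
  have h := (((tendsto_const_div_atTop_nhds_zero_nat (ℓ : ℝ)).add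
    ((mean hP).add hRl)).const_mul C)
  simp only [add_zero, mul_zero] at h
  refine h.congr fun n => ?_
  simp only [rateA3, Finset.sum_add_distrib]
  ring

/-! ### Exponential and polynomial parameters -/

section Param

variable {E : Type*} [MeasurableSpace E]

/-- The rescaled masses `n^{-ℓ} t⁻ⁿ μ S_n 1` whose lower limit enters the definition of `j_S(μ)`. -/
noncomputable def scaledMass (S : ℕ → Kernel E E) (t : ℝ≥0∞) (μ : Measure E) (ℓ : ℝ) (n : ℕ) :
    ℝ≥0∞ :=
  (n : ℝ≥0∞) ^ (-ℓ) * t⁻¹ ^ n * (μ.bind (S n)) Set.univ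

theorem dirac_bind_kernel {F : Type*} [MeasurableSpace F] (κ : Kernel E F) (x : E) :
    (Measure.dirac x).bind κ = κ x :=
  Measure.dirac_bind κ.measurable x

theorem natCast_rpow_mul_inv_pow {t : ℝ} (ht : 0 < t) {n : ℕ} (hn : 1 ≤ n) (ℓ : ℝ) :
    (n : ℝ≥0∞) ^ (-ℓ) * (ENNReal.ofReal t)⁻¹ ^ n =
      ENNReal.ofReal ((n : ℝ) ^ (-ℓ) * t⁻¹ ^ n) := by
  have hn' : (0 : ℝ) < n := by exact_mod_cast hn
  rw [ENNReal.ofReal_mul (by positivity), ← ENNReal.ofReal_rpow_of_pos hn', ENNReal.ofReal_natCast,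
    ENNReal.ofReal_pow (by positivity), ENNReal.ofReal_inv_of_pos ht]

theorem scaledMass_mono {F : Type*} [MeasurableSpace F] {S : ℕ → Kernel E E} {T : ℕ → Kernel F F}
    {t : ℝ≥0∞} {μ : Measure E} {ν : Measure F} {ℓ : ℝ} {n : ℕ}
    (h : (μ.bind (S n)) Set.univ ≤ (ν.bind (T n)) Set.univ) :
    scaledMass S t μ ℓ n ≤ scaledMass T t ν ℓ n :=
  mul_le_mul_right h _

theorem liminf_eq_zero_of_tendsto_zero {u : ℕ → ℝ≥0∞} (h : Tendsto u atTop (𝓝 0)) :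
    liminf u atTop = 0 := h.liminf_eq

theorem liminf_eq_zero_of_le {u v : ℕ → ℝ≥0∞} (h : ∀ᶠ n in atTop, u n ≤ v n)
    (hv : liminf v atTop = 0) : liminf u atTop = 0 :=
  le_antisymm (hv ▸ liminf_le_liminf h) bot_le

theorem expParam_mono {F : Type*} [MeasurableSpace F] {S : ℕ → Kernel E E} {T : ℕ → Kernel F F}
    {μ : Measure E} {ν : Measure F}
    (h : ∀ n, (μ.bind (S n)) Set.univ ≤ (ν.bind (T n)) Set.univ) :
    expParam S μ ≤ expParam T ν := by
  refine sInf_le_sInf fun θ hθ => ?_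
  exact liminf_eq_zero_of_le (Eventually.of_forall fun n => mul_le_mul_right (h n) _) hθ

theorem expParam_le_of_bound {S : ℕ → Kernel E E} {μ : Measure E} {t C : ℝ} {j : ℕ} (ht : 0 < t)
    (hb : ∀ n, 1 ≤ n → (μ.bind (S n)) Set.univ ≤ ENNReal.ofReal (C * (n : ℝ) ^ j * t ^ n)) :
    expParam S μ ≤ ENNReal.ofReal t := by
  refine le_of_forall_gt_imp_ge_of_dense fun θ hθ => sInf_le ?_
  simp only [Set.mem_ofPred_eq]
  rcases eq_or_ne θ ⊤ with rfl | hθt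
  · refine liminf_eq_zero_of_tendsto_zero (tendsto_const_nhds.congr' ?_)
    filter_upwards [eventually_ge_atTop 1] with n hn
    rw [ENNReal.inv_top, zero_pow (by omega), zero_mul]
  obtain ⟨s, hs0, rfl⟩ : ∃ s : ℝ, 0 ≤ s ∧ θ = ENNReal.ofReal s :=
    ⟨θ.toReal, ENNReal.toReal_nonneg, (ENNReal.ofReal_toReal hθt).symm⟩
  have hts : t < s := by
    by_contra! h
    exact absurd hθ (not_lt.2 (ENNReal.ofReal_le_ofReal h))
  have hs : 0 < s := ht.trans hts
  have hlim : Tendsto (fun n : ℕ => C * ((n : ℝ) ^ j * (t / s) ^ n)) atTop (𝓝 0) := by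
    have := (tendsto_pow_const_mul_const_pow_of_lt_one j (r := t / s) (by positivity)
      ((div_lt_one hs).2 hts)).const_mul C
    rwa [mul_zero] at this
  have hlim' := ENNReal.tendsto_ofReal hlim
  rw [ENNReal.ofReal_zero] at hlim'
  refine liminf_eq_zero_of_le ?_ (liminf_eq_zero_of_tendsto_zero hlim')
  filter_upwards [eventually_ge_atTop 1] with n hn
  refine (mul_le_mul_right (hb n hn) _).trans (le_of_eq ?_)
  rw [← ENNReal.ofReal_inv_of_pos hs, ← ENNReal.ofReal_pow (by positivity),
    ← ENNReal.ofReal_mul (by positivity)]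
  congr 1
  rw [div_pow, inv_pow]
  ring

theorem bddBelow_polySet (S : ℕ → Kernel E E) (t : ℝ≥0∞) (μ : Measure E) :
    BddBelow {ℓ : ℝ | 0 ≤ ℓ ∧ liminf (scaledMass S t μ ℓ) atTop = 0} :=
  ⟨0, fun _ h => h.1⟩

theorem polyParam_nonneg (S : ℕ → Kernel E E) (μ : Measure E) : 0 ≤ polyParam S μ :=
  Real.sInf_nonneg fun _ h => h.1

theorem polyParam_le_of_liminf {S : ℕ → Kernel E E} {μ : Measure E} {ℓ : ℝ} (h0 : 0 ≤ ℓ)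
    (h : liminf (scaledMass S (expParam₀ S) μ ℓ) atTop = 0) : polyParam S μ ≤ ℓ :=
  csInf_le (bddBelow_polySet _ _ _) ⟨h0, h⟩

theorem liminf_scaledMass_ne_zero {S : ℕ → Kernel E E} {μ : Measure E} {ℓ : ℝ} (h0 : 0 ≤ ℓ)
    (h : ℓ < polyParam S μ) : liminf (scaledMass S (expParam₀ S) μ ℓ) atTop ≠ 0 := fun hl =>
  absurd (polyParam_le_of_liminf h0 hl) (not_le.2 h)

theorem liminf_scaledMass_eq_zero_of_bound {S : ℕ → Kernel E E} {μ : Measure E} {t C : ℝ} {j : ℕ}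
    (ht : 0 < t)
    (hb : ∀ n, 1 ≤ n → (μ.bind (S n)) Set.univ ≤ ENNReal.ofReal (C * (n : ℝ) ^ j * t ^ n))
    {ℓ : ℝ} (hℓ : (j : ℝ) < ℓ) :
    liminf (scaledMass S (ENNReal.ofReal t) μ ℓ) atTop = 0 := by
  have hlim : Tendsto (fun n : ℕ => C * (n : ℝ) ^ (-(ℓ - j))) atTop (𝓝 0) := by
    have := ((tendsto_rpow_neg_atTop (sub_pos.2 hℓ)).comp
      tendsto_natCast_atTop_atTop).const_mul C
    rwa [mul_zero] at this
  have hlim' := ENNReal.tendsto_ofReal hlim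
  rw [ENNReal.ofReal_zero] at hlim'
  refine liminf_eq_zero_of_le ?_ (liminf_eq_zero_of_tendsto_zero hlim')
  filter_upwards [eventually_ge_atTop 1] with n hn
  have hn' : (0 : ℝ) < n := by exact_mod_cast hn
  refine (mul_le_mul_right (hb n hn) _).trans (le_of_eq ?_)
  rw [natCast_rpow_mul_inv_pow ht hn, ← ENNReal.ofReal_mul (by positivity)]
  congr 1
  rw [neg_sub, Real.rpow_sub hn', Real.rpow_neg hn'.le, Real.rpow_natCast, inv_pow]
  field_simp

theorem polyParam_le_of_bound {S : ℕ → Kernel E E} {μ : Measure E} {t C : ℝ} {j : ℕ}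
    (ht : 0 < t) (hS : expParam₀ S = ENNReal.ofReal t)
    (hb : ∀ n, 1 ≤ n → (μ.bind (S n)) Set.univ ≤ ENNReal.ofReal (C * (n : ℝ) ^ j * t ^ n)) :
    polyParam S μ ≤ j := by
  refine le_of_forall_gt_imp_ge_of_dense fun ℓ hℓ => ?_
  refine polyParam_le_of_liminf (j.cast_nonneg.trans hℓ.le) ?_
  rw [hS]
  exact liminf_scaledMass_eq_zero_of_bound ht hb hℓ

/-- The upper bound on the masses is needed for the lower bound on `j_S(μ)` too, because of the
convention `inf ∅ = 0`. -/
theorem le_polyParam {S : ℕ → Kernel E E} {μ : Measure E} {t C : ℝ} {j : ℕ}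
    (ht : 0 < t) (hS : expParam₀ S = ENNReal.ofReal t)
    (hb : ∀ n, 1 ≤ n → (μ.bind (S n)) Set.univ ≤ ENNReal.ofReal (C * (n : ℝ) ^ j * t ^ n))
    {a : ℝ}
    (hl : ∀ ℓ : ℝ, 0 ≤ ℓ → ℓ < a → liminf (scaledMass S (expParam₀ S) μ ℓ) atTop ≠ 0) :
    a ≤ polyParam S μ := by
  refine le_csInf ⟨j + 1, by positivity, ?_⟩ fun ℓ h => ?_
  · have := liminf_scaledMass_eq_zero_of_bound ht hb (lt_add_one (j : ℝ))
    rwa [← hS] at this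
  · by_contra! hlt
    exact hl ℓ h.1 hlt h.2

/-- Fatou's lemma: `j_S ≤ j_S(μ)` almost everywhere for `μ`. -/
theorem ae_jAt_le_of_liminf {S : ℕ → Kernel E E} {μ : Measure E} {ℓ : ℝ} (h0 : 0 ≤ ℓ)
    (h : liminf (scaledMass S (expParam₀ S) μ ℓ) atTop = 0) : ∀ᵐ y ∂μ, jAt S y ≤ ℓ := by
  set u : ℕ → E → ℝ≥0∞ := fun n y => (n : ℝ≥0∞) ^ (-ℓ) * (expParam₀ S)⁻¹ ^ n * S n y Set.univ
  have hum : ∀ n, Measurable (u n) := fun n =>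
    ((S n).measurable_coe MeasurableSet.univ).const_mul _
  have hint : ∀ n, ∫⁻ y, u n y ∂μ = scaledMass S (expParam₀ S) μ ℓ n := fun n => by
    rw [lintegral_const_mul _ ((S n).measurable_coe MeasurableSet.univ), scaledMass,
      Measure.bind_apply MeasurableSet.univ (S n).aemeasurable]
  have hF : ∫⁻ y, liminf (fun n => u n y) atTop ∂μ = 0 := by
    refine le_antisymm ?_ bot_le
    refine (lintegral_liminf_le hum).trans (le_of_eq ?_)
    simp_rw [hint]
    exact h
  rw [lintegral_eq_zero_iff (Measurable.liminf hum)] at hF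
  filter_upwards [hF] with y hy
  refine polyParam_le_of_liminf h0 (Eq.trans ?_ hy)
  congr 1
  funext n
  simp only [scaledMass, u, dirac_bind_kernel]

/-- If all the values of `j_S` are attained by an explicit bound on the masses, `j_S` is
measurable. -/
theorem measurable_jAt {S : ℕ → Kernel E E} {t : ℝ} (ht : 0 < t)
    (hS : expParam₀ S = ENNReal.ofReal t) {j : E → ℕ} (hj : ∀ x, jAt S x = j x)
    (hb : ∀ x, ∃ C : ℝ, ∀ n, 1 ≤ n → S n x Set.univ ≤ ENNReal.ofReal (C * (n : ℝ) ^ j x * t ^ n)) :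
    Measurable j := by
  -- the exponent `k + 1/2` separates the values up to `k` from those above
  have hset : ∀ k : ℕ, {x | j x ≤ k} = {x | liminf (fun n : ℕ =>
      (n : ℝ≥0∞) ^ (-((k : ℝ) + 1 / 2)) * (expParam₀ S)⁻¹ ^ n * S n x Set.univ) atTop = 0} := by
    intro k
    have e : ∀ x, (fun n : ℕ => (n : ℝ≥0∞) ^ (-((k : ℝ) + 1 / 2)) * (expParam₀ S)⁻¹ ^ n *
        S n x Set.univ) = scaledMass S (expParam₀ S) (Measure.dirac x) (k + 1 / 2) := fun x => by
      funext n
      rw [scaledMass, dirac_bind_kernel]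
    ext x
    simp only [Set.mem_ofPred_eq, e]
    constructor
    · intro h
      obtain ⟨C, hC⟩ := hb x
      rw [hS]
      refine liminf_scaledMass_eq_zero_of_bound (j := j x) (C := C) ht (fun n hn => ?_) ?_
      · rw [dirac_bind_kernel]; exact hC n hn
      · have : (j x : ℝ) ≤ k := by exact_mod_cast h
        linarith
    · intro h
      have h1 : jAt S x ≤ k + 1 / 2 := polyParam_le_of_liminf (by positivity) h
      rw [hj] at h1
      have h2 : (j x : ℝ) < ((k + 1 : ℕ) : ℝ) := by push_cast; linarith
      exact Nat.lt_succ_iff.1 (by exact_mod_cast h2)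
  refine measurable_of_Iic fun k => ?_
  have : j ⁻¹' Set.Iic k = {x | j x ≤ k} := rfl
  rw [this, hset]
  refine measurableSet_eq_fun (Measurable.liminf fun n => ?_) measurable_const
  exact ((S n).measurable_coe MeasurableSet.univ).const_mul _

end Param

/-! ### Assumption (A) in terms of a limit kernel -/

section Limit

variable {E : Type*} [MeasurableSpace E] {I : Type*}

/-- The measure `∑ i, η_i(x) ν_i`, against which the limit in Assumption (A) is an integral. -/
noncomputable def limitMeasure (η : I → E → ℝ) (ν : I → Measure E) (x : E) : Measure E :=
  Measure.sum fun i => ENNReal.ofReal (η i x) • ν i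

theorem lintegral_limitMeasure (η : I → E → ℝ) (ν : I → Measure E) (x : E) (g : E → ℝ≥0∞) :
    ∫⁻ y, g y ∂(limitMeasure η ν x) = ∑' i, ENNReal.ofReal (η i x) * ∫⁻ y, g y ∂(ν i) := by
  simp [limitMeasure, lintegral_sum_measure, lintegral_smul_measure]

theorem hasSum_integral_limitMeasure {η : I → E → ℝ} {ν : I → Measure E} {x : E}
    (hη : ∀ i, 0 ≤ η i x) {f : E → ℝ} (hf : Integrable f (limitMeasure η ν x)) :
    HasSum (fun i => η i x * ∫ y, f y ∂(ν i)) (∫ y, f y ∂(limitMeasure η ν x)) := by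
  have := hasSum_integral_measure hf
  refine this.congr_fun fun i => ?_
  rw [integral_smul_measure, ENNReal.toReal_ofReal (hη i), smul_eq_mul]

theorem measurable_limitMeasure [Countable I] {η : I → E → ℝ} {ν : I → Measure E}
    (hη : ∀ i, Measurable (η i)) : Measurable (limitMeasure η ν) := by
  refine Measure.measurable_of_measurable_coe _ fun s hs => ?_
  have : (fun x => limitMeasure η ν x s) = fun x => ∑' i, ENNReal.ofReal (η i x) * ν i s := by
    funext x
    simp [limitMeasure, Measure.sum_apply _ hs]
  rw [this]
  exact Measurable.tsum fun i => (hη i).ennreal_ofReal.mul_const _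

theorem integrable_of_lintegral_le {μ : Measure E} {W f : E → ℝ} {b N : ℝ} (hf : Measurable f)
    (hN : 0 ≤ N) (hfW : ∀ y, |f y| ≤ N * W y)
    (hb : ∫⁻ y, ENNReal.ofReal (W y) ∂μ ≤ ENNReal.ofReal b) : Integrable f μ := by
  refine ⟨hf.aestronglyMeasurable, ?_⟩
  refine lt_of_le_of_lt (lintegral_mono (g := fun y => ENNReal.ofReal N * ENNReal.ofReal (W y))
    fun y => ?_) ?_
  · dsimp only
    rw [← ENNReal.ofReal_mul hN, Real.enorm_eq_ofReal_abs]
    exact ENNReal.ofReal_le_ofReal (hfW y)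
  · rw [lintegral_const_mul' _ _ ENNReal.ofReal_ne_top]
    exact ENNReal.mul_lt_top ENNReal.ofReal_lt_top (hb.trans_lt ENNReal.ofReal_lt_top)

theorem abs_integral_le_of_lintegral_le {μ : Measure E} {W f : E → ℝ} {b N : ℝ}
    (hN : 0 ≤ N) (hb0 : 0 ≤ b) (hfW : ∀ᵐ y ∂μ, |f y| ≤ N * W y)
    (hb : ∫⁻ y, ENNReal.ofReal (W y) ∂μ ≤ ENNReal.ofReal b) : |∫ y, f y ∂μ| ≤ N * b := by
  have h1 : ∫⁻ y, ENNReal.ofReal |f y| ∂μ ≤ ENNReal.ofReal (N * b) := by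
    refine (lintegral_mono_ae (g := fun y => ENNReal.ofReal N * ENNReal.ofReal (W y)) ?_).trans ?_
    · filter_upwards [hfW] with y hy
      rw [← ENNReal.ofReal_mul hN]
      exact ENNReal.ofReal_le_ofReal hy
    · rw [lintegral_const_mul' _ _ ENNReal.ofReal_ne_top, ENNReal.ofReal_mul hN]
      gcongr
  have h2 : ENNReal.ofReal |∫ y, f y ∂μ| ≤ ENNReal.ofReal (N * b) := by
    refine le_trans ?_ h1
    rw [← Real.enorm_eq_ofReal_abs]
    refine (enorm_integral_le_lintegral_enorm f).trans (le_of_eq ?_)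
    simp_rw [Real.enorm_eq_ofReal_abs]
  exact (ENNReal.ofReal_le_ofReal_iff (by positivity)).1 h2

theorem abs_le_normW_mul {W f : E → ℝ} (hW : ∀ x, 1 ≤ W x) (hf : MemLW W f) (y : E) :
    |f y| ≤ normW W f * W y := by
  have h := le_ciSup hf.2 y
  rwa [div_le_iff₀ (by linarith [hW y])] at h

omit [MeasurableSpace E] in
theorem normW_nonneg {W : E → ℝ} (hW : ∀ x, 1 ≤ W x) (f : E → ℝ) : 0 ≤ normW W f :=
  Real.iSup_nonneg fun x => div_nonneg (abs_nonneg _) (by linarith [hW x])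

theorem memLW_of_abs_le {W f : E → ℝ} {N : ℝ} (hW : ∀ x, 1 ≤ W x) (hf : Measurable f)
    (h : ∀ y, |f y| ≤ N * W y) : MemLW W f := by
  refine ⟨hf, N, ?_⟩
  rintro _ ⟨x, rfl⟩
  exact (div_le_iff₀ (by linarith [hW x])).2 (h x)

omit [MeasurableSpace E] in
theorem normW_le {W f : E → ℝ} {N : ℝ} [Nonempty E] (hW : ∀ x, 1 ≤ W x)
    (h : ∀ y, |f y| ≤ N * W y) : normW W f ≤ N :=
  ciSup_le fun x => (div_le_iff₀ (by linarith [hW x])).2 (h x)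

/-- `θ⁻ⁿ n^{-j(x)} S_n f(x)` converges to `Λ f(x)` at rate `a n`, in the sense of Assumption (A).
The norm of `f` is replaced by any `N` with `|f| ≤ N W`. -/
structure ConvergesToKernel (S : ℕ → Kernel E E) (W : E → ℝ) (Λ : Kernel E E) (j : E → ℕ)
    (a : ℕ → ℝ) (θ B : ℝ) : Prop where
  theta_pos : 0 < θ
  measurable_W : Measurable W
  one_le_W : ∀ x, 1 ≤ W x
  bound_nonneg : 0 ≤ B
  lintegral_limit_le : ∀ x, ∫⁻ y, ENNReal.ofReal (W y) ∂(Λ x) ≤ ENNReal.ofReal (B * W x)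
  integrable_W : ∀ n x, Integrable W (S n x)
  rate_zero : a 0 = 1
  rate_nonneg : ∀ n, 0 ≤ a n
  estimate : ∀ (x : E) (n : ℕ) (f : E → ℝ) (N : ℝ), 1 ≤ n → Measurable f →
    (∀ y, |f y| ≤ N * W y) →
    |θ⁻¹ ^ n * ((n : ℝ) ^ j x)⁻¹ * (∫ y, f y ∂(S n x)) - ∫ y, f y ∂(Λ x)| ≤ a n * W x * N

theorem natCast_rpow_neg_natCast (n k : ℕ) : (n : ℝ) ^ (-(k : ℝ)) = ((n : ℝ) ^ k)⁻¹ := by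
  rw [Real.rpow_neg n.cast_nonneg, Real.rpow_natCast]

namespace AssumptionA

variable {S : ℕ → Kernel E E} {W : E → ℝ} {η : I → E → ℝ} {ν : I → Measure E} {a : ℕ → ℝ}

theorem nonempty (h : AssumptionA S W η ν a) : Nonempty E := by
  by_contra hE
  rw [not_nonempty_iff] at hE
  have := h.theta_pos
  simp [expParam₀] at this

theorem expParam₀_eq (h : AssumptionA S W η ν a) : expParam₀ S = ENNReal.ofReal (theta₀ S) :=
  (ENNReal.ofReal_toReal (ne_top_of_le_ne_top ENNReal.one_ne_top h.theta_le_one)).symm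

theorem theta₀_pos (h : AssumptionA S W η ν a) : 0 < theta₀ S :=
  ENNReal.toReal_pos h.theta_pos.ne' (ne_top_of_le_ne_top ENNReal.one_ne_top h.theta_le_one)

theorem theta₀_le_one (h : AssumptionA S W η ν a) : theta₀ S ≤ 1 :=
  ENNReal.toReal_le_of_le_ofReal zero_le_one (by simpa using h.theta_le_one)

theorem exists_lintegral_le (h : AssumptionA S W η ν a) : ∃ B : ℝ, 0 ≤ B ∧ ∀ x,
    ∫⁻ y, ENNReal.ofReal (W y) ∂(limitMeasure η ν x) ≤ ENNReal.ofReal (B * W x) := by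
  refine ⟨_, normW_nonneg h.one_le_W (fun x => ∑' i, η i x * ∫ y, W y ∂(ν i)), fun x => ?_⟩
  refine le_trans (le_of_eq ?_) (ENNReal.ofReal_le_ofReal
    ((le_abs_self _).trans (abs_le_normW_mul h.one_le_W h.mem_sum x)))
  have hW0 : ∀ y, 0 ≤ W y := fun y => zero_le_one.trans (h.one_le_W y)
  rw [lintegral_limitMeasure, ENNReal.ofReal_tsum_of_nonneg
    (fun i => mul_nonneg (h.eta_nonneg i x) (integral_nonneg hW0)) (h.summable_eta x)]
  congr 1
  funext i
  rw [ENNReal.ofReal_mul (h.eta_nonneg i x),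
    ofReal_integral_eq_lintegral_ofReal (h.integrable_W i) (Eventually.of_forall hW0)]

theorem exists_convergesToKernel (h : AssumptionA S W η ν a) (ha : a 0 = 1) :
    ∃ (Λ : Kernel E E) (j : E → ℕ) (B : ℝ), (∀ x, Λ x = limitMeasure η ν x) ∧
      (∀ x, jAt S x = j x) ∧ ConvergesToKernel S W Λ j a (theta₀ S) B := by
  have := h.countable
  have hne := h.nonempty
  choose j hj using h.j_int
  obtain ⟨B, hB0, hB⟩ := h.exists_lintegral_le
  have hW0 : ∀ y, 0 ≤ W y := fun y => zero_le_one.trans (h.one_le_W y)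
  have hrate : ∀ n, 0 ≤ a n := fun n => by
    rcases Nat.eq_zero_or_pos n with rfl | hn
    · rw [ha]; exact zero_le_one
    have x := hne.some
    have hWW : ∀ y, |W y| ≤ 1 * W y := fun y => by rw [abs_of_nonneg (hW0 y), one_mul]
    have h1 := (abs_nonneg _).trans (h.converges x W (memLW_of_abs_le h.one_le_W
      h.measurable_W hWW) n hn)
    have h2 : normW W W = 1 := by
      have : ∀ x, |W x| / W x = 1 := fun x => by
        rw [abs_of_nonneg (hW0 x)]; exact div_self (by linarith [h.one_le_W x])
      simp [normW, this]
    rw [h2, mul_one] at h1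
    exact nonneg_of_mul_nonneg_left h1 (by linarith [h.one_le_W x])
  refine ⟨⟨limitMeasure η ν, measurable_limitMeasure fun i => (h.mem_eta i).1⟩, j, B,
    fun x => rfl, hj, ?_⟩
  refine ⟨h.theta₀_pos, h.measurable_W, h.one_le_W, hB0, hB, h.integrable_semigroup, ha,
    hrate, fun x n f N hn hf hfN => ?_⟩
  have hN : 0 ≤ N := by
    have := (abs_nonneg _).trans (hfN x)
    exact nonneg_of_mul_nonneg_left this (by linarith [h.one_le_W x])
  have hint : Integrable f (limitMeasure η ν x) := integrable_of_lintegral_le hf hN hfN (hB x)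
  have h1 := h.converges x f (memLW_of_abs_le h.one_le_W hf hfN) n hn
  rw [(hasSum_integral_limitMeasure (fun i => h.eta_nonneg i x) hint).tsum_eq, hj,
    natCast_rpow_neg_natCast] at h1
  refine h1.trans ?_
  exact mul_le_mul_of_nonneg_left (normW_le h.one_le_W hfN)
    (mul_nonneg (hrate n) (hW0 x))

end AssumptionA

/-- An estimate in terms of the limit measure gives the estimate of Assumption (A). -/
theorem convergesAt_of_limitMeasure {S : ℕ → Kernel E E} {W : E → ℝ} {η : I → E → ℝ}
    {ν : I → Measure E} {a : ℕ → ℝ} {b : ℝ} {x : E} (hW : ∀ x, 1 ≤ W x) (hη : ∀ i, 0 ≤ η i x)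
    (hb : ∫⁻ y, ENNReal.ofReal (W y) ∂(limitMeasure η ν x) ≤ ENNReal.ofReal b) {j : ℕ}
    (hj : jAt S x = j)
    (h : ∀ (n : ℕ) (f : E → ℝ) (N : ℝ), 1 ≤ n → Measurable f → 0 ≤ N → (∀ y, |f y| ≤ N * W y) →
      |(theta₀ S)⁻¹ ^ n * ((n : ℝ) ^ j)⁻¹ * (∫ y, f y ∂(S n x))
        - ∫ y, f y ∂(limitMeasure η ν x)| ≤ a n * W x * N) :
    ConvergesAt S W η ν a x := by
  intro f hf n hn
  have hN := normW_nonneg hW f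
  have hfN := abs_le_normW_mul hW hf
  rw [(hasSum_integral_limitMeasure hη (integrable_of_lintegral_le hf.1 hN hfN hb)).tsum_eq, hj,
    natCast_rpow_neg_natCast]
  exact h n f _ hn hf.1 hN hfN

/-- Assumption (A) from its estimate, once the limit measures are bounded by the weight. -/
theorem assumptionA_of_limitMeasure {S : ℕ → Kernel E E} {W : E → ℝ} {η : I → E → ℝ}
    {ν : I → Measure E} {a : ℕ → ℝ} {θ B : ℝ} (hθ : expParam₀ S = ENNReal.ofReal θ) (hθ0 : 0 < θ)
    (hθ1 : θ ≤ 1) (hj : ∀ x, ∃ k : ℕ, jAt S x = k) (hWm : Measurable W) (hW : ∀ x, 1 ≤ W x)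
    (hI : Countable I) (hν : ∀ i, IsProbabilityMeasure (ν i)) (hηm : ∀ i, Measurable (η i))
    (hη : ∀ i x, 0 ≤ η i x) (hη0 : ∀ i, ∃ x, η i x ≠ 0)
    (hB : ∀ x, ∫⁻ y, ENNReal.ofReal (W y) ∂(limitMeasure η ν x) ≤ ENNReal.ofReal (B * W x))
    (hS : ∀ n x, Integrable W (S n x)) (ha : Tendsto a atTop (𝓝 0))
    (hconv : ∀ x, ConvergesAt S W η ν a x) : AssumptionA S W η ν a := by
  have hW0 : ∀ y, 0 ≤ W y := fun y => zero_le_one.trans (hW y)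
  have hWW : ∀ y, |W y| ≤ 1 * W y := fun y => by rw [abs_of_nonneg (hW0 y), one_mul]
  have hsum : ∀ x, HasSum (fun i => η i x * ∫ y, W y ∂(ν i)) (∫ y, W y ∂(limitMeasure η ν x)) :=
    fun x => hasSum_integral_limitMeasure (fun i => hη i x)
      (integrable_of_lintegral_le hWm zero_le_one hWW (hB x))
  have hint : ∀ i, Integrable W (ν i) := fun i => by
    obtain ⟨x, hx⟩ := hη0 i
    have h1 := (integrable_of_lintegral_le hWm zero_le_one hWW (hB x)).mono_measure
      (Measure.le_sum (fun i => ENNReal.ofReal (η i x) • ν i) i)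
    rwa [integrable_smul_measure (by simpa using (hη i x).lt_of_ne' hx)
      ENNReal.ofReal_ne_top] at h1
  have hle : ∀ x, |∑' i, η i x * ∫ y, W y ∂(ν i)| ≤ |B| * W x := fun x => by
    rw [(hsum x).tsum_eq]
    refine (abs_integral_le_of_lintegral_le (N := 1) (W := W) (b := |B| * W x) zero_le_one
      (mul_nonneg (abs_nonneg _) (hW0 x)) (Eventually.of_forall hWW)
      ((hB x).trans (ENNReal.ofReal_le_ofReal
        (mul_le_mul_of_nonneg_right (le_abs_self B) (hW0 x))))).trans (by rw [one_mul])
  have hone : ∀ i, 1 ≤ ∫ y, W y ∂(ν i) := fun i => by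
    have := integral_mono (μ := ν i) (integrable_const (1 : ℝ)) (hint i) hW
    simpa using this
  refine ⟨?_, ?_, hj, hWm, hW, hI, hν, hint, fun i => ?_, hη, hη0, fun x => (hsum x).summable,
    ?_, hS, ha, hconv⟩
  · rw [hθ]; exact ENNReal.ofReal_pos.2 hθ0
  · rw [hθ]; exact ENNReal.ofReal_le_one.2 hθ1
  · refine memLW_of_abs_le (N := |B|) hW (hηm i) fun x => ?_
    rw [abs_of_nonneg (hη i x)]
    calc η i x ≤ η i x * ∫ y, W y ∂(ν i) := le_mul_of_one_le_right (hη i x) (hone i)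
      _ ≤ ∑' i, η i x * ∫ y, W y ∂(ν i) := (hsum x).summable.le_tsum i
          fun k _ => mul_nonneg (hη k x) (integral_nonneg hW0)
      _ ≤ _ := (le_abs_self _).trans (hle x)
  · refine memLW_of_abs_le (N := |B|) hW ?_ hle
    have e : (fun x => ∑' i, η i x * ∫ y, W y ∂(ν i)) = fun x =>
        (∑' i, ENNReal.ofReal (η i x * ∫ y, W y ∂(ν i))).toReal := by
      funext x
      rw [← ENNReal.ofReal_tsum_of_nonneg
        (fun i => mul_nonneg (hη i x) (integral_nonneg hW0)) (hsum x).summable,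
        ENNReal.toReal_ofReal (tsum_nonneg fun i => mul_nonneg (hη i x) (integral_nonneg hW0))]
    rw [e]
    exact (Measurable.tsum fun i => ((hηm i).mul_const _).ennreal_ofReal).ennreal_toReal

end Limit

/-! ### Estimates at a shifted time and mixtures -/

section Shift

variable {E F G : Type*} [MeasurableSpace E] [MeasurableSpace F] [MeasurableSpace G]

theorem integral_bind_kernel {μ : Measure E} {κ : Kernel E F} {f : F → ℝ}
    (hf : Integrable f (μ.bind κ)) :
    ∫ y, f y ∂(μ.bind κ) = ∫ x, ∫ y, f y ∂(κ x) ∂μ := by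
  rw [Measure.comp_eq_comp_const_apply] at hf ⊢
  rw [Kernel.integral_comp hf, Kernel.const_apply]

theorem integrable_integral_of_bind {μ : Measure E} {κ : Kernel E F} {f : F → ℝ}
    (hf : Integrable f (μ.bind κ)) : Integrable (fun x => ∫ y, f y ∂(κ x)) μ := by
  rw [Measure.comp_eq_comp_const_apply] at hf
  simpa using hf.integral_comp

theorem lintegral_bind_ofReal_le {μ : Measure E} {κ : Kernel E F} {W : F → ℝ} {W' : E → ℝ}
    {c b : ℝ} (hc : 0 ≤ c) (hW : Measurable W)
    (hκ : ∀ x, ∫⁻ y, ENNReal.ofReal (W y) ∂(κ x) ≤ ENNReal.ofReal (c * W' x))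
    (hμ : ∫⁻ x, ENNReal.ofReal (W' x) ∂μ ≤ ENNReal.ofReal b) :
    ∫⁻ y, ENNReal.ofReal (W y) ∂(μ.bind κ) ≤ ENNReal.ofReal (c * b) := by
  rw [Measure.lintegral_bind κ.aemeasurable hW.ennreal_ofReal.aemeasurable]
  refine (lintegral_mono hκ).trans ?_
  simp_rw [ENNReal.ofReal_mul hc]
  rw [lintegral_const_mul' _ _ ENNReal.ofReal_ne_top]
  gcongr

/-- A pointwise comparison of two kernels, integrated with respect to the starting point. -/
theorem abs_integral_bind_sub_le {μ : Measure E} {κ lam : Kernel E F} {f : F → ℝ} {W : E → ℝ}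
    {c c' ε b : ℝ} (hε : 0 ≤ ε) (hb0 : 0 ≤ b)
    (hb : ∫⁻ x, ENNReal.ofReal (W x) ∂μ ≤ ENNReal.ofReal b)
    (hκ : Integrable f (μ.bind κ)) (hlam : Integrable f (μ.bind lam))
    (h : ∀ᵐ x ∂μ, |c * ∫ y, f y ∂(κ x) - c' * ∫ y, f y ∂(lam x)| ≤ ε * W x) :
    |c * ∫ y, f y ∂(μ.bind κ) - c' * ∫ y, f y ∂(μ.bind lam)| ≤ ε * b := by
  rw [integral_bind_kernel hκ, integral_bind_kernel hlam, ← integral_const_mul,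
    ← integral_const_mul, ← integral_sub ((integrable_integral_of_bind hκ).const_mul _)
      ((integrable_integral_of_bind hlam).const_mul _)]
  exact abs_integral_le_of_lintegral_le hε hb0 h hb

open scoped Classical in
/-- The restriction of the kernel `Λ` to the starting points `y` with `j y = ℓ`. -/
noncomputable def levelKernel (Λ : Kernel E F) (j : E → ℕ) (hj : Measurable j) (ℓ : ℕ) :
    Kernel E F :=
  Kernel.piecewise (hj (measurableSet_singleton ℓ)) Λ 0

open scoped Classical in
theorem levelKernel_of_eq {Λ : Kernel E F} {j : E → ℕ} (hj : Measurable j) {ℓ : ℕ} {x : E}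
    (h : j x = ℓ) : levelKernel Λ j hj ℓ x = Λ x := by
  rw [levelKernel, Kernel.piecewise_apply, if_pos]
  exact h

open scoped Classical in
theorem levelKernel_of_ne {Λ : Kernel E F} {j : E → ℕ} (hj : Measurable j) {ℓ : ℕ} {x : E}
    (h : j x ≠ ℓ) : levelKernel Λ j hj ℓ x = 0 := by
  rw [levelKernel, Kernel.piecewise_apply, if_neg]
  · rfl
  · exact h

theorem integral_levelKernel {Λ : Kernel E F} {j : E → ℕ} (hj : Measurable j) (ℓ : ℕ) (x : E)
    (f : F → ℝ) :
    ∫ y, f y ∂(levelKernel Λ j hj ℓ x) = if j x = ℓ then ∫ y, f y ∂(Λ x) else 0 := by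
  split_ifs with h
  · rw [levelKernel_of_eq hj h]
  · rw [levelKernel_of_ne hj h, integral_zero_measure]

theorem lintegral_levelKernel_le {Λ : Kernel E F} {j : E → ℕ} (hj : Measurable j) (ℓ : ℕ) (x : E)
    (g : F → ℝ≥0∞) : ∫⁻ y, g y ∂(levelKernel Λ j hj ℓ x) ≤ ∫⁻ y, g y ∂(Λ x) := by
  by_cases h : j x = ℓ
  · rw [levelKernel_of_eq hj h]
  · rw [levelKernel_of_ne hj h, lintegral_zero_measure]; exact bot_le

/-- A bound on the masses of `S_n(x, ·)` extracted from a convergence estimate. -/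
theorem exists_mass_bound {S : ℕ → Kernel E E} {x : E} {θ L : ℝ} {j : ℕ} {r : ℕ → ℝ}
    (hθ : 0 < θ) (hfin : ∀ n, IsFiniteMeasure (S n x)) (hr : Tendsto r atTop (𝓝 0))
    (h : ∀ n : ℕ, 1 ≤ n → |θ⁻¹ ^ n * ((n : ℝ) ^ j)⁻¹ * (∫ _, (1 : ℝ) ∂(S n x)) - L| ≤ r n) :
    ∃ C : ℝ, ∀ n : ℕ, 1 ≤ n → S n x Set.univ ≤ ENNReal.ofReal (C * (n : ℝ) ^ j * θ ^ n) := by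
  obtain ⟨M, hM⟩ := (Metric.isBounded_range_of_tendsto r hr).exists_norm_le
  refine ⟨M + |L|, fun n hn => ?_⟩
  have hn' : (0 : ℝ) < n := by exact_mod_cast hn
  have h1 : (S n x).real Set.univ ≤ (M + |L|) * (n : ℝ) ^ j * θ ^ n := by
    have h2 := h n hn
    have h3 : r n ≤ M := (le_abs_self _).trans (hM _ ⟨n, rfl⟩)
    simp only [integral_const, smul_eq_mul, mul_one] at h2
    have h4 : θ⁻¹ ^ n * ((n : ℝ) ^ j)⁻¹ * (S n x).real Set.univ ≤ M + |L| := by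
      have := (abs_le.1 (h2.trans h3)).2
      linarith [le_abs_self L]
    have e : (S n x).real Set.univ
        = (θ⁻¹ ^ n * ((n : ℝ) ^ j)⁻¹ * (S n x).real Set.univ) * ((n : ℝ) ^ j * θ ^ n) := by
      rw [inv_pow]; field_simp
    rw [e, mul_assoc (M + |L|)]
    exact mul_le_mul_of_nonneg_right h4 (by positivity)
  rw [← ENNReal.ofReal_toReal (measure_ne_top (S n x) Set.univ)]
  exact ENNReal.ofReal_le_ofReal h1

namespace ConvergesToKernel

variable {S : ℕ → Kernel E E} {W : E → ℝ} {Λ : Kernel E E} {j : E → ℕ} {a : ℕ → ℝ} {θ B : ℝ}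

theorem W_pos (h : ConvergesToKernel S W Λ j a θ B) (x : E) : 0 < W x :=
  zero_lt_one.trans_le (h.one_le_W x)

theorem norm_nonneg (h : ConvergesToKernel S W Λ j a θ B) {x : E} {f : E → ℝ} {N : ℝ}
    (hfN : ∀ y, |f y| ≤ N * W y) : 0 ≤ N :=
  nonneg_of_mul_nonneg_left ((abs_nonneg _).trans (hfN x)) (h.W_pos x)

theorem abs_limit_le (h : ConvergesToKernel S W Λ j a θ B) {x : E} {f : E → ℝ} {N : ℝ}
    (hfN : ∀ y, |f y| ≤ N * W y) : |∫ y, f y ∂(Λ x)| ≤ B * (W x * N) := by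
  refine (abs_integral_le_of_lintegral_le (h.norm_nonneg (x := x) hfN)
    (mul_nonneg h.bound_nonneg (h.W_pos x).le) (Eventually.of_forall hfN)
    (h.lintegral_limit_le x)).trans (le_of_eq (by ring))

theorem lintegral_eq_ofReal_integral (h : ConvergesToKernel S W Λ j a θ B) (n : ℕ) (x : E) :
    ∫⁻ y, ENNReal.ofReal (W y) ∂(S n x) = ENNReal.ofReal (∫ y, W y ∂(S n x)) :=
  (ofReal_integral_eq_lintegral_ofReal (h.integrable_W n x)
    (Eventually.of_forall fun y => (h.W_pos y).le)).symm

/-- The estimate at time `m ≤ n`, rescaled by `n^{-ℓ}` with `ℓ ≥ j(x)` instead of `m^{-j(x)}`: the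
limit is only seen by the starting points with `j(x) = ℓ`. -/
theorem scaled_estimate (h : ConvergesToKernel S W Λ j a θ B) {x : E} {m n ℓ : ℕ} {f : E → ℝ}
    {N : ℝ} (h0 : S 0 x = Measure.dirac x) (hn : 1 ≤ n) (hmn : m ≤ n) (hj : j x ≤ ℓ)
    (hf : Measurable f) (hfN : ∀ y, |f y| ≤ N * W y) :
    |θ⁻¹ ^ m * ((n : ℝ) ^ ℓ)⁻¹ * (∫ y, f y ∂(S m x))
        - ((m : ℝ) / n) ^ ℓ * (if j x = ℓ then ∫ y, f y ∂(Λ x) else 0)|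
      ≤ (1 + B) * (a m * ((m : ℝ) / n) ^ ℓ + ℓ / n) * (W x * N) := by
  have hn' : (0 : ℝ) < n := by exact_mod_cast hn
  have hn1 : (1 : ℝ) ≤ n := by exact_mod_cast hn
  have hN : 0 ≤ N := h.norm_nonneg (x := x) hfN
  set w := W x * N with hw
  have hw0 : 0 ≤ w := mul_nonneg (h.W_pos x).le hN
  have hB := h.bound_nonneg
  have hL := h.abs_limit_le (x := x) hfN
  rw [← hw] at hL
  set L := ∫ y, f y ∂(Λ x)
  rcases Nat.eq_zero_or_pos m with rfl | hm
  -- at time `0` there is no estimate to use: `a 0 = 1` covers `ℓ = 0`, and `ℓ / n` covers `ℓ ≥ 1`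
  · have hfx : |f x| ≤ w := (hfN x).trans (le_of_eq (by rw [hw]; ring))
    rw [h0, integral_dirac' _ _ hf.stronglyMeasurable, h.rate_zero]
    rcases Nat.eq_zero_or_pos ℓ with rfl | hℓ
    · rw [if_pos (Nat.le_zero.1 hj)]
      simp only [pow_zero, inv_one, one_mul, Nat.cast_zero, zero_div, add_zero, mul_one]
      have := abs_sub (f x) L
      linarith
    · have e : (((0 : ℕ) : ℝ) / n) ^ ℓ = 0 := by
        rw [Nat.cast_zero, zero_div, zero_pow hℓ.ne']
      rw [e]
      simp only [pow_zero, one_mul, zero_mul, sub_zero, mul_zero, zero_add]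
      rw [abs_mul, abs_of_nonneg (by positivity : 0 ≤ ((n : ℝ) ^ ℓ)⁻¹)]
      have h1 : ((n : ℝ) ^ ℓ)⁻¹ ≤ ℓ / n := by
        have h2 : (n : ℝ) ≤ (n : ℝ) ^ ℓ := le_self_pow₀ hn1 hℓ.ne'
        have h3 : (1 : ℝ) ≤ ℓ := by exact_mod_cast hℓ
        calc ((n : ℝ) ^ ℓ)⁻¹ ≤ (n : ℝ)⁻¹ := inv_anti₀ hn' h2
          _ = 1 / n := (one_div _).symm
          _ ≤ ℓ / n := by gcongr
      have h4 : (0 : ℝ) ≤ ℓ / n := by positivity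
      calc ((n : ℝ) ^ ℓ)⁻¹ * |f x| ≤ (ℓ / n) * w := by gcongr
        _ ≤ (1 + B) * (ℓ / n) * w := by
          refine mul_le_mul_of_nonneg_right ?_ hw0
          nlinarith
  · have hm' : (0 : ℝ) < m := by exact_mod_cast hm
    have hest := h.estimate x m f N hm hf hfN
    have ham := h.rate_nonneg m
    rw [mul_assoc (a m), ← hw] at hest
    set A := θ⁻¹ ^ m * ((m : ℝ) ^ j x)⁻¹ * (∫ y, f y ∂(S m x)) with hA
    have hq0 : 0 ≤ ((m : ℝ) / n) ^ ℓ := by positivity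
    have hℓn : (0 : ℝ) ≤ ℓ / n := by positivity
    have eA : θ⁻¹ ^ m * ((n : ℝ) ^ ℓ)⁻¹ * (∫ y, f y ∂(S m x)) = (m : ℝ) ^ j x / (n : ℝ) ^ ℓ * A := by
      rw [hA]; field_simp
    rw [eA]
    rcases hj.eq_or_lt with hj | hj
    · rw [if_pos hj, hj, ← div_pow, ← mul_sub, abs_mul, abs_of_nonneg hq0]
      calc ((m : ℝ) / n) ^ ℓ * |A - L| ≤ ((m : ℝ) / n) ^ ℓ * (a m * w) := by gcongr
        _ = (a m * ((m : ℝ) / n) ^ ℓ) * w := by ring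
        _ ≤ (1 + B) * (a m * ((m : ℝ) / n) ^ ℓ + ℓ / n) * w := by
          refine mul_le_mul_of_nonneg_right ?_ hw0
          have : 0 ≤ a m * ((m : ℝ) / n) ^ ℓ := by positivity
          nlinarith
    · rw [if_neg hj.ne, mul_zero, sub_zero, abs_mul,
        abs_of_nonneg (by positivity : 0 ≤ (m : ℝ) ^ j x / (n : ℝ) ^ ℓ)]
      have hAle : |A| ≤ a m * w + B * w := by
        have := abs_sub_abs_le_abs_sub A L
        linarith
      -- `j x < ℓ` leaves a spare factor, at most `1 / n ≤ ℓ / n`, for the limit part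
      have hm1 : (1 : ℝ) ≤ m := by exact_mod_cast hm
      have c1 : (m : ℝ) ^ j x / (n : ℝ) ^ ℓ ≤ ((m : ℝ) / n) ^ ℓ := by
        rw [div_pow]
        gcongr
      have c2 : (m : ℝ) ^ j x / (n : ℝ) ^ ℓ ≤ ℓ / n := by
        have h3 : (1 : ℝ) ≤ ℓ := by exact_mod_cast (Nat.zero_le _).trans_lt hj
        have h4 : (m : ℝ) ^ j x * n ≤ (n : ℝ) ^ ℓ := by
          calc (m : ℝ) ^ j x * n ≤ (n : ℝ) ^ j x * n := by gcongr
            _ = (n : ℝ) ^ (j x + 1) := (pow_succ _ _).symm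
            _ ≤ (n : ℝ) ^ ℓ := pow_le_pow_right₀ hn1 hj
        rw [div_le_div_iff₀ (by positivity) hn']
        calc (m : ℝ) ^ j x * n ≤ 1 * (n : ℝ) ^ ℓ := by rw [one_mul]; exact h4
          _ ≤ _ := by gcongr
      have d1 : (m : ℝ) ^ j x / (n : ℝ) ^ ℓ * (a m * w) ≤ ((m : ℝ) / n) ^ ℓ * (a m * w) := by
        gcongr
      have d2 : (m : ℝ) ^ j x / (n : ℝ) ^ ℓ * (B * w) ≤ ℓ / n * (B * w) := by gcongr
      have d3 : (m : ℝ) ^ j x / (n : ℝ) ^ ℓ * |A|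
          ≤ (m : ℝ) ^ j x / (n : ℝ) ^ ℓ * (a m * w + B * w) := by gcongr
      have d4 : 0 ≤ B * (a m * ((m : ℝ) / n) ^ ℓ) * w := by positivity
      have d5 : 0 ≤ ℓ / n * w := by positivity
      linarith

/-- A variant of `scaled_estimate` for `m < n` in which the factor `(m/n)^ℓ` has been removed. -/
theorem scaled_estimate_of_lt (h : ConvergesToKernel S W Λ j a θ B) {x : E} {m n ℓ : ℕ}
    {f : E → ℝ} {N : ℝ} (h0 : S 0 x = Measure.dirac x) (hmn : m < n) (hj : j x ≤ ℓ)
    (hf : Measurable f) (hfN : ∀ y, |f y| ≤ N * W y) :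
    |θ⁻¹ ^ m * ((n : ℝ) ^ ℓ)⁻¹ * (∫ y, f y ∂(S m x))
        - (if j x = ℓ then ∫ y, f y ∂(Λ x) else 0)|
      ≤ (1 + 2 * B) * (a m + ℓ * (((n : ℝ) - m) / n)) * (W x * N) := by
  have hn : 1 ≤ n := by omega
  have hn' : (0 : ℝ) < n := by exact_mod_cast hn
  have h1 := h.scaled_estimate h0 hn hmn.le hj hf hfN
  have hN : 0 ≤ N := h.norm_nonneg (x := x) hfN
  have hw0 : 0 ≤ W x * N := mul_nonneg (h.W_pos x).le hN
  have hB := h.bound_nonneg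
  have ham := h.rate_nonneg m
  have hL : |if j x = ℓ then ∫ y, f y ∂(Λ x) else 0| ≤ B * (W x * N) := by
    split_ifs
    · exact h.abs_limit_le hfN
    · rw [abs_zero]; positivity
  set L := if j x = ℓ then ∫ y, f y ∂(Λ x) else 0
  set A := θ⁻¹ ^ m * ((n : ℝ) ^ ℓ)⁻¹ * (∫ y, f y ∂(S m x))
  set w := W x * N
  have hq1 := div_pow_le_one hmn.le ℓ
  have hq2 := one_sub_div_pow_le (m := m) hn ℓ
  set q := ((m : ℝ) / n) ^ ℓ
  have h2 : |q * L - L| ≤ ℓ * (((n : ℝ) - m) / n) * (B * w) := by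
    have e : q * L - L = -((1 - q) * L) := by ring
    rw [e, abs_neg, abs_mul, abs_of_nonneg (by linarith)]
    exact mul_le_mul hq2 hL (abs_nonneg _) (by linarith)
  have h3 : (ℓ : ℝ) / n ≤ ℓ * (((n : ℝ) - m) / n) := by
    rw [div_eq_mul_one_div]
    gcongr
    have : (m : ℝ) + 1 ≤ n := by exact_mod_cast hmn
    linarith
  have h4 : (1 + B) * (a m * q + ℓ / n) * w
      ≤ (1 + B) * (a m + ℓ * (((n : ℝ) - m) / n)) * w := by
    gcongr
    exact mul_le_of_le_one_right ham hq1
  have h5 : 0 ≤ B * a m * w := by positivity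
  have h6 := abs_sub_le A (q * L) L
  linarith

/-- The case `ℓ = j(x)` of `scaled_estimate_of_lt`. -/
theorem scaled_estimate_self (h : ConvergesToKernel S W Λ j a θ B) {x : E} {m n : ℕ}
    {f : E → ℝ} {N : ℝ} (h0 : S 0 x = Measure.dirac x) (hmn : m < n)
    (hf : Measurable f) (hfN : ∀ y, |f y| ≤ N * W y) :
    |θ⁻¹ ^ m * ((n : ℝ) ^ j x)⁻¹ * (∫ y, f y ∂(S m x)) - ∫ y, f y ∂(Λ x)|
      ≤ (1 + 2 * B) * (a m + j x * (((n : ℝ) - m) / n)) * (W x * N) := by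
  have := h.scaled_estimate_of_lt h0 hmn le_rfl hf hfN
  rwa [if_pos rfl] at this

end ConvergesToKernel

end Shift

/-! ### One-step decomposition of the absorbed chain -/

section Chain

variable {D Ω : Type*} [MeasurableSpace D] [MeasurableSpace Ω]
  {κ : Kernel (D ⊕ Unit) (D ⊕ Unit)} {Pr : Kernel D Ω} {X : ℕ → Ω → D ⊕ Unit}

/-- The law on `D` of `X_n` under `ℙ_x`, restricted to the event `T`. -/
noncomputable def partialLaw (Pr : Kernel D Ω) (X : ℕ → Ω → D ⊕ Unit) (n : ℕ) (x : D)
    (T : Set Ω) : Measure D :=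
  (((Pr x).restrict T).map (X n)).comap Sum.inl

namespace IsAbsorbedMarkovChain

theorem partialLaw_apply (hX : IsAbsorbedMarkovChain κ Pr X) (n : ℕ) (x : D) (T : Set Ω)
    {A : Set D} (hA : MeasurableSet A) :
    partialLaw Pr X n x T A = Pr x (X n ⁻¹' (Sum.inl '' A) ∩ T) := by
  have hA' : MeasurableSet (Sum.inl '' A : Set (D ⊕ Unit)) := measurableSet_inl_image.2 hA
  rw [partialLaw, measurableEmbedding_inl.comap_apply, Measure.map_apply (hX.measurable n) hA',
    Measure.restrict_apply (hX.measurable n hA')]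

theorem semigroup_eq_partialLaw (hX : IsAbsorbedMarkovChain κ Pr X) (n : ℕ) (x : D) :
    semigroup Pr X n x = partialLaw Pr X n x Set.univ := by
  rw [semigroup, Kernel.comapRight_apply, Kernel.map_apply _ (hX.measurable n), partialLaw,
    Measure.restrict_univ]

theorem semigroup_apply (hX : IsAbsorbedMarkovChain κ Pr X) (n : ℕ) (x : D)
    {A : Set D} (hA : MeasurableSet A) :
    semigroup Pr X n x A = Pr x (X n ⁻¹' (Sum.inl '' A)) := by
  rw [hX.semigroup_eq_partialLaw, hX.partialLaw_apply n x _ hA, Set.inter_univ]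

theorem semigroup_zero (hX : IsAbsorbedMarkovChain κ Pr X) (x : D) :
    semigroup Pr X 0 x = Measure.dirac x := by
  ext A hA
  rw [semigroup, Kernel.comapRight_apply, Kernel.map_apply _ (hX.measurable 0), hX.start,
    measurableEmbedding_inl.comap_apply,
    Measure.dirac_apply' _ (measurableSet_inl_image.2 hA), Measure.dirac_apply' _ hA]
  by_cases h : x ∈ A <;> simp [h]

theorem semigroup_one_apply (hX : IsAbsorbedMarkovChain κ Pr X) (y : D)
    {A : Set D} (hA : MeasurableSet A) :
    semigroup Pr X 1 y A = κ (Sum.inl y) (Sum.inl '' A) := by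
  have hA' : MeasurableSet (Sum.inl '' A : Set (D ⊕ Unit)) := measurableSet_inl_image.2 hA
  have h := hX.markov y 0 Set.univ _ MeasurableSet.univ hA'
  rw [hX.semigroup_apply 1 y hA]
  simp only [Set.mem_univ, true_and, Set.ofPred_true, Measure.restrict_univ, zero_add] at h
  refine Eq.trans ?_ (h.trans ?_)
  · rfl
  · rw [← lintegral_map (κ.measurable_coe hA') (hX.measurable 0), hX.start,
      lintegral_dirac' _ (κ.measurable_coe hA')]

/-- The Markov property, on an event determined by the path up to time `n`. -/
theorem partialLaw_succ (hX : IsAbsorbedMarkovChain κ Pr X) (n : ℕ) (x : D)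
    {B : Set (Fin (n + 1) → D ⊕ Unit)} (hB : MeasurableSet B) :
    partialLaw Pr X (n + 1) x {ω | (fun i : Fin (n + 1) => X i ω) ∈ B} =
      (partialLaw Pr X n x {ω | (fun i : Fin (n + 1) => X i ω) ∈ B}).bind (semigroup Pr X 1) := by
  ext A hA
  have hA' : MeasurableSet (Sum.inl '' A : Set (D ⊕ Unit)) := measurableSet_inl_image.2 hA
  rw [hX.partialLaw_apply _ _ _ hA, Measure.bind_apply hA (Kernel.aemeasurable _)]
  simp_rw [hX.semigroup_one_apply _ hA]
  rw [partialLaw, ← measurableEmbedding_inl.lintegral_map (fun z => κ z (Sum.inl '' A)),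
    measurableEmbedding_inl.map_comap]
  have hout : ∀ z : D ⊕ Unit, z ∉ Set.range (Sum.inl : D → D ⊕ Unit) → κ z (Sum.inl '' A) = 0 := by
    rintro (z | z) hz
    · exact absurd ⟨z, rfl⟩ hz
    · rw [show Sum.inr z = (Sum.inr () : D ⊕ Unit) from rfl, hX.absorbed,
        Measure.dirac_apply' _ hA']
      simp
  rw [setLIntegral_eq_of_support_subset, lintegral_map (κ.measurable_coe hA') (hX.measurable n),
    ← hX.markov x n B _ hB hA']
  · congr 1
    ext ω
    exact and_comm
  · intro z hz
    by_contra h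
    exact hz (hout z h)

theorem semigroup_succ (hX : IsAbsorbedMarkovChain κ Pr X) (n : ℕ) (x : D) :
    semigroup Pr X (n + 1) x = (semigroup Pr X n x).bind (semigroup Pr X 1) := by
  rw [hX.semigroup_eq_partialLaw, hX.semigroup_eq_partialLaw]
  simpa using hX.partialLaw_succ n x MeasurableSet.univ

/-- The Markov property on an event determined by one coordinate. -/
theorem partialLaw_succ_preimage (hX : IsAbsorbedMarkovChain κ Pr X) {i n : ℕ} (hi : i ≤ n) (x : D)
    {C : Set (D ⊕ Unit)} (hC : MeasurableSet C) :
    partialLaw Pr X (n + 1) x (X i ⁻¹' C) =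
      (partialLaw Pr X n x (X i ⁻¹' C)).bind (semigroup Pr X 1) :=
  hX.partialLaw_succ n x (B := {p | p ⟨i, Nat.lt_succ_of_le hi⟩ ∈ C})
    ((measurable_pi_apply _) hC)

theorem isFiniteMeasure_semigroup (hX : IsAbsorbedMarkovChain κ Pr X) (n : ℕ) (x : D) :
    IsFiniteMeasure (semigroup Pr X n x) := by
  have := hX.prob x
  refine ⟨?_⟩
  rw [hX.semigroup_apply n x MeasurableSet.univ]
  exact measure_lt_top _ _

end IsAbsorbedMarkovChain

omit [MeasurableSpace D] [MeasurableSpace Ω] in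
theorem hitTime_eq_coe_iff {A : Set D} {ω : Ω} {n : ℕ} :
    hitTime X A ω = n ↔ X n ω ∈ Sum.inl '' A ∧ ∀ i < n, X i ω ∉ Sum.inl '' A := by
  by_cases hex : ∃ j, 0 ≤ j ∧ X j ω ∈ Sum.inl '' A
  · have e : hitTime X A ω = ((sInf {i : ℕ | 0 ≤ i ∧ X i ω ∈ Sum.inl '' A} : ℕ) : WithTop ℕ) :=
      if_pos hex
    rw [e]
    constructor
    · intro h
      have hn : sInf {i : ℕ | 0 ≤ i ∧ X i ω ∈ Sum.inl '' A} = n := WithTop.coe_injective h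
      refine ⟨?_, fun i hi => ?_⟩
      · rw [← hn]; exact (Nat.sInf_mem hex).2
      · rw [← hn] at hi; exact fun h => Nat.notMem_of_lt_sInf hi ⟨i.zero_le, h⟩
    · rintro ⟨h1, h2⟩
      refine congrArg _ (le_antisymm (Nat.sInf_le ⟨n.zero_le, h1⟩) ?_)
      by_contra! hlt
      exact h2 _ hlt (Nat.sInf_mem hex).2
  · have e : hitTime X A ω = ⊤ := if_neg hex
    rw [e]
    constructor
    · intro h
      exact absurd h.symm (WithTop.coe_ne_top (a := n))
    · rintro ⟨h1, -⟩
      exact absurd ⟨n, n.zero_le, h1⟩ hex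

omit [MeasurableSpace D] [MeasurableSpace Ω] in
theorem hitTime_eq_top_iff {A : Set D} {ω : Ω} :
    hitTime X A ω = ⊤ ↔ ∀ n, X n ω ∉ Sum.inl '' A := by
  by_cases hex : ∃ j, 0 ≤ j ∧ X j ω ∈ Sum.inl '' A
  · have e : hitTime X A ω = ((sInf {i : ℕ | 0 ≤ i ∧ X i ω ∈ Sum.inl '' A} : ℕ) : WithTop ℕ) :=
      if_pos hex
    rw [e]
    obtain ⟨j, -, hj⟩ := hex
    exact ⟨fun h => absurd h WithTop.coe_ne_top, fun h => absurd hj (h j)⟩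
  · have e : hitTime X A ω = ⊤ := if_neg hex
    exact ⟨fun _ n hn => hex ⟨n, n.zero_le, hn⟩, fun _ => e⟩

theorem measurableSet_hitTime_eq (hX : IsAbsorbedMarkovChain κ Pr X) {A : Set D}
    (hA : MeasurableSet A) (n : ℕ) : MeasurableSet {ω | hitTime X A ω = n} := by
  have e : {ω | hitTime X A ω = n} =
      X n ⁻¹' (Sum.inl '' A) ∩ ⋂ i, ⋂ (_ : i < n), (X i ⁻¹' (Sum.inl '' A))ᶜ := by
    ext ω
    simp [hitTime_eq_coe_iff]
  have hm : ∀ i, MeasurableSet (X i ⁻¹' (Sum.inl '' A)) := fun i =>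
    hX.measurable i (measurableSet_inl_image.2 hA)
  rw [e]
  exact (hm n).inter (MeasurableSet.iInter fun i => MeasurableSet.iInter fun _ => (hm i).compl)

theorem restrictTo_apply {A : Set D} {B : Set D} (hB : MeasurableSet B) (τ : Kernel D D) (x : A) :
    restrictTo A hB τ x = (τ x).comap Subtype.val := by
  rw [restrictTo, Kernel.comapRight_apply, Kernel.comap_apply]

theorem map_val_restrictTo {A : Set D} {B : Set D} (hB : MeasurableSet B) (τ : Kernel D D)
    (x : A) : (restrictTo A hB τ x).map Subtype.val = (τ x).restrict B := by
  rw [restrictTo_apply, map_comap_subtype_coe hB]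

theorem map_val_injective {A : Set D} (hA : MeasurableSet A) {μ ν : Measure A}
    (h : μ.map Subtype.val = ν.map Subtype.val) : μ = ν := by
  have := congrArg (Measure.comap (Subtype.val : A → D)) h
  rwa [(MeasurableEmbedding.subtype_coe hA).comap_map,
    (MeasurableEmbedding.subtype_coe hA).comap_map] at this

theorem bind_kernel_succ {E : Type*} [MeasurableSpace E] {T : ℕ → Kernel E E}
    (hs : ∀ n x, T (n + 1) x = (T n x).bind (T 1)) (n : ℕ) (m : Measure E) :
    m.bind (T (n + 1)) = (m.bind (T n)).bind (T 1) := by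
  have : (T (n + 1) : E → Measure E) = fun x => (T n x).bind (T 1) := funext (hs n)
  rw [this, Measure.bind_bind (T n).aemeasurable (T 1).aemeasurable]

theorem kernel_add {E : Type*} [MeasurableSpace E] {T : ℕ → Kernel E E}
    (h0 : ∀ x, T 0 x = Measure.dirac x) (hs : ∀ n x, T (n + 1) x = (T n x).bind (T 1))
    (n m : ℕ) (x : E) : T (n + m) x = (T n x).bind (T m) := by
  induction m with
  | zero =>
    have : (T 0 : E → Measure E) = Measure.dirac := funext h0
    rw [add_zero, this, Measure.bind_dirac]
  | succ m ih =>
    rw [← add_assoc, hs, ih, bind_kernel_succ hs m]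

/-- The semigroup `S` on `D = D₁ ∪ D₂` never goes from `D₂` to `D₁`: `P` and `R` are its diagonal
blocks, and the block from `D₁` to `D₂` is given by a decomposition at the jump time. -/
structure IsTriangular {D₁ D₂ : Set D} (S : ℕ → Kernel D D) (P : ℕ → Kernel D₁ D₁)
    (Q : Kernel D₁ D₂) (R : ℕ → Kernel D₂ D₂) : Prop where
  finite : ∀ n x, IsFiniteMeasure (S n x)
  P_zero : ∀ x, P 0 x = Measure.dirac x
  P_add : ∀ n m x, P (n + m) x = (P n x).bind (P m)
  R_zero : ∀ y, R 0 y = Measure.dirac y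
  left : ∀ n (x : D₁), S n x = (P n x).map Subtype.val +
    (∑ k ∈ Finset.range n, ((P k x).bind Q).bind (R (n - 1 - k))).map Subtype.val
  right : ∀ n (y : D₂), S n y = (R n y).map Subtype.val

theorem sum_bind_kernel {E F : Type*} [MeasurableSpace E] [MeasurableSpace F] (κ : Kernel E F)
    {ι : Type*} (s : Finset ι) (μ : ι → Measure E) :
    (∑ i ∈ s, μ i).bind κ = ∑ i ∈ s, (μ i).bind κ := by
  classical
  induction s using Finset.induction_on with
  | empty => simp
  | insert i s hi ih => rw [Finset.sum_insert hi, Finset.sum_insert hi, Measure.comp_add, ih]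

theorem map_val_bind {D₂ : Set D} {E : Type*} [MeasurableSpace E] (m : Measure D₂)
    (τ : Kernel D E) : (m.map Subtype.val).bind τ = m.bind (fun y : D₂ => τ y) := by
  ext A hA
  have hm : AEMeasurable (fun y : D₂ => τ y) m :=
    (τ.measurable.comp measurable_subtype_coe).aemeasurable
  rw [Measure.bind_apply hA τ.aemeasurable, Measure.bind_apply hA hm,
    lintegral_map (τ.measurable_coe hA) measurable_subtype_coe]

theorem bind_map_val {D₂ : Set D} {E : Type*} [MeasurableSpace E] (m : Measure E)
    (τ : Kernel E D₂) :
    (m.bind τ).map Subtype.val = m.bind (fun y => (τ y).map Subtype.val) := by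
  rw [Measure.map_comp _ _ measurable_subtype_coe]
  congr 1
  funext y
  rw [Kernel.map_apply _ measurable_subtype_coe]

/-- As the chain cannot return from `D₂` to `D₁`, a path from `x ∈ D₁` that is alive at time `n` has
either stayed in `D₁`, or jumped to `D₂` at a single time `k + 1 ≤ n` and stayed in `D₂` since. -/
theorem IsAbsorbedMarkovChain.isTriangular (hX : IsAbsorbedMarkovChain κ Pr X)
    {D₁ D₂ : Set D} (hD₁ : MeasurableSet D₁) (hD₂ : MeasurableSet D₂) (hD : IsCompl D₁ D₂)
    (hno : ∀ x ∈ D₂, ∀ᵐ ω ∂(Pr x), hitTime X D₁ ω = ⊤) :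
    IsTriangular (semigroup Pr X) (fun n => restrictTo D₁ hD₁ (semigroup Pr X n))
      (restrictTo D₁ hD₂ (semigroup Pr X 1)) (fun n => restrictTo D₂ hD₂ (semigroup Pr X n)) := by
  set S := semigroup Pr X with hS
  have hSsucc : ∀ n x, S (n + 1) x = (S n x).bind (S 1) := hX.semigroup_succ
  have hDc : D₁ᶜ = D₂ := hD.compl_eq
  have hsplit : ∀ n x, S n x = (S n x).restrict D₁ + (S n x).restrict D₂ := fun n x => by
    rw [← hDc, Measure.restrict_add_restrict_compl hD₁]
  have hfin := hX.isFiniteMeasure_semigroup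
  have hnull : ∀ n, ∀ x ∈ D₂, (S n x).restrict D₁ = 0 := fun n x hx => by
    rw [Measure.restrict_eq_zero, hX.semigroup_apply n x hD₁]
    refine measure_eq_zero_iff_ae_notMem.2 ?_
    filter_upwards [hno x hx] with ω hω
    exact hitTime_eq_top_iff.1 hω n
  have hright : ∀ n (y : D₂), S n y = (restrictTo D₂ hD₂ (S n) y).map Subtype.val := fun n y => by
    rw [map_val_restrictTo]
    conv_lhs => rw [hsplit, hnull n y y.2, zero_add]
  have hdirac : ∀ {A : Set D} (hA : MeasurableSet A) (x : A),
      restrictTo A hA (S 0) x = Measure.dirac x := fun {A} hA x => by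
    refine map_val_injective hA ?_
    rw [map_val_restrictTo, hX.semigroup_zero, Measure.map_dirac' measurable_subtype_coe,
      Measure.restrict_eq_self_of_ae_mem]
    exact (ae_dirac_iff hA).2 x.2
  have hPsucc : ∀ n x, restrictTo D₁ hD₁ (S (n + 1)) x
      = (restrictTo D₁ hD₁ (S n) x).bind (restrictTo D₁ hD₁ (S 1)) := fun n x => by
    refine map_val_injective hD₁ ?_
    ext A hA
    rw [map_val_restrictTo, bind_map_val, Measure.restrict_apply hA, hSsucc,
      Measure.bind_apply (hA.inter hD₁) (Kernel.aemeasurable _)]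
    have e : ∀ z : D₁, (restrictTo D₁ hD₁ (S 1) z).map Subtype.val A = S 1 z (A ∩ D₁) := fun z => by
      rw [map_val_restrictTo, Measure.restrict_apply hA]
    rw [Measure.bind_apply hA]
    · simp_rw [e]
      rw [← lintegral_map ((S 1).measurable_coe (hA.inter hD₁)) measurable_subtype_coe,
        map_val_restrictTo]
      conv_lhs => rw [hsplit, lintegral_add_measure]
      rw [setLIntegral_congr_fun (f := fun y => S 1 y (A ∩ D₁)) (g := fun _ => 0) hD₂]
      · simp
      · intro y hy
        have := hnull 1 y hy
        rw [Measure.restrict_eq_zero] at this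
        exact measure_mono_null Set.inter_subset_right this
    · refine Measurable.aemeasurable ?_
      exact (Measure.measurable_map _ measurable_subtype_coe).comp (Kernel.measurable _)
  have hRsucc : ∀ n y, restrictTo D₂ hD₂ (S (n + 1)) y
      = (restrictTo D₂ hD₂ (S n) y).bind (restrictTo D₂ hD₂ (S 1)) := fun n y => by
    refine map_val_injective hD₂ ?_
    rw [← hright, bind_map_val]
    simp_rw [← hright 1]
    rw [← map_val_bind, ← hright, hSsucc]
  have hQbind : ∀ m : Measure D₁, ((m.map Subtype.val).bind (S 1)).restrict D₂ =
      (m.bind (restrictTo D₁ hD₂ (S 1))).map Subtype.val := fun m => by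
    ext A hA
    rw [Measure.restrict_apply hA, map_val_bind, Measure.map_apply measurable_subtype_coe hA]
    have hm : AEMeasurable (fun y : D₁ => S 1 y) m :=
      ((S 1).measurable.comp measurable_subtype_coe).aemeasurable
    rw [Measure.bind_apply (hA.inter hD₂) hm,
      Measure.bind_apply (measurable_subtype_coe hA) (Kernel.aemeasurable _)]
    refine lintegral_congr fun y => ?_
    rw [← Measure.map_apply measurable_subtype_coe hA, map_val_restrictTo,
      Measure.restrict_apply hA]
  have hRbind : ∀ m : Measure D₂, ((m.map Subtype.val).bind (S 1)).restrict D₂ =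
      (m.bind (restrictTo D₂ hD₂ (S 1))).map Subtype.val := fun m => by
    rw [bind_map_val, map_val_bind]
    simp_rw [← hright 1]
    refine Measure.restrict_eq_self_of_ae_mem ?_
    have : (fun y : D₂ => S 1 y) = fun y => (restrictTo D₂ hD₂ (S 1) y).map Subtype.val :=
      funext (hright 1)
    rw [this, ← bind_map_val]
    exact (ae_map_iff measurable_subtype_coe.aemeasurable hD₂).2
      (Eventually.of_forall fun y => y.2)
  have hstep : ∀ (m : Measure D₁) (U : Measure D₂),
      ((m.map Subtype.val + U.map Subtype.val).bind (S 1)).restrict D₂ =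
        (U.bind (restrictTo D₂ hD₂ (S 1)) + m.bind (restrictTo D₁ hD₂ (S 1))).map Subtype.val :=
    fun m U => by
      rw [Measure.comp_add, Measure.restrict_add, hQbind, hRbind,
        Measure.map_add _ _ measurable_subtype_coe, add_comm]
  have hPadd := kernel_add (T := fun n => restrictTo D₁ hD₁ (S n)) (hdirac hD₁) hPsucc
  refine ⟨hfin, hdirac hD₁, hPadd, hdirac hD₂, fun n x => ?_, hright⟩
  induction n with
  | zero =>
    rw [hdirac hD₁, Measure.map_dirac' measurable_subtype_coe, hX.semigroup_zero]
    simp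
  | succ n ih =>
    have e1 : (S (n + 1) x).restrict D₁ = (restrictTo D₁ hD₁ (S (n + 1)) x).map Subtype.val :=
      (map_val_restrictTo _ _ _).symm
    rw [hsplit (n + 1), e1]
    congr 1
    have e2 : ∀ k ∈ Finset.range n, (((restrictTo D₁ hD₁ (S k) x).bind
        (restrictTo D₁ hD₂ (S 1))).bind (restrictTo D₂ hD₂ (S (n + 1 - 1 - k)))) =
        (((restrictTo D₁ hD₁ (S k) x).bind
        (restrictTo D₁ hD₂ (S 1))).bind (restrictTo D₂ hD₂ (S (n - 1 - k)))).bind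
          (restrictTo D₂ hD₂ (S 1)) := fun k hk => by
      have : n + 1 - 1 - k = (n - 1 - k) + 1 := by
        have := Finset.mem_range.1 hk
        omega
      rw [this]
      exact bind_kernel_succ (T := fun n => restrictTo D₂ hD₂ (S n)) hRsucc _ _
    have e3 : (((restrictTo D₁ hD₁ (S n) x).bind
        (restrictTo D₁ hD₂ (S 1))).bind (restrictTo D₂ hD₂ (S (n + 1 - 1 - n)))) =
        (restrictTo D₁ hD₁ (S n) x).bind (restrictTo D₁ hD₂ (S 1)) := by
      have h0 : n + 1 - 1 - n = 0 := by omega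
      have h1 : (restrictTo D₂ hD₂ (S 0) : D₂ → Measure D₂) = Measure.dirac :=
        funext (hdirac hD₂)
      rw [h0, h1, Measure.bind_dirac]
    rw [Finset.sum_range_succ, Finset.sum_congr rfl e2, e3, ← sum_bind_kernel, hSsucc, ih, hstep,
      add_comm (Measure.bind _ _)]

end Chain

/-! ### The law of the entrance time and position in `D₂` -/

section Entrance

variable {D Ω : Type*} [MeasurableSpace D] [MeasurableSpace Ω]
  {κ : Kernel (D ⊕ Unit) (D ⊕ Unit)} {Pr : Kernel D Ω} {X : ℕ → Ω → D ⊕ Unit}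

theorem measurableEmbedding_inl_val {A : Set D} (hA : MeasurableSet A) :
    MeasurableEmbedding (fun y : A => (Sum.inl (y : D) : D ⊕ Unit)) :=
  measurableEmbedding_inl.comp (MeasurableEmbedding.subtype_coe hA)

theorem bind_bind_apply {E F G : Type*} [MeasurableSpace E] [MeasurableSpace F]
    [MeasurableSpace G] (μ : Measure E) (κ : Kernel E F) (τ : Kernel F G) {A : Set G}
    (hA : MeasurableSet A) : ((μ.bind κ).bind τ) A = ∫⁻ x, ((κ x).bind τ) A ∂μ := by
  have hm : Measurable fun x => (κ x).bind τ := (Measure.measurable_bind' τ.measurable).comp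
    κ.measurable
  rw [Measure.bind_bind κ.aemeasurable τ.aemeasurable, Measure.bind_apply hA hm.aemeasurable]

theorem restrictTo_apply' {A B : Set D} (hB : MeasurableSet B) (τ : Kernel D D) (x : A)
    {s : Set B} : restrictTo A hB τ x s = τ x (Subtype.val '' s) := by
  rw [restrictTo_apply, (MeasurableEmbedding.subtype_coe hB).comap_apply]

namespace IsAbsorbedMarkovChain

theorem partialLaw_preimage (hX : IsAbsorbedMarkovChain κ Pr X) (n : ℕ) (x : D)
    {C : Set (D ⊕ Unit)} (hC : MeasurableSet C) :
    partialLaw Pr X n x (X n ⁻¹' C) = (semigroup Pr X n x).restrict (Sum.inl ⁻¹' C) := by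
  ext A hA
  rw [hX.partialLaw_apply n x _ hA, Measure.restrict_apply hA,
    hX.semigroup_apply n x (hA.inter (measurable_inl hC)), ← Set.preimage_inter]
  congr 2
  ext z
  simp only [Set.mem_inter_iff, Set.mem_image, Set.mem_preimage]
  constructor
  · rintro ⟨⟨y, hy, rfl⟩, hz⟩
    exact ⟨y, ⟨hy, hz⟩, rfl⟩
  · rintro ⟨y, ⟨hy, hz⟩, rfl⟩
    exact ⟨⟨y, hy, rfl⟩, hz⟩

theorem measure_two_step (hX : IsAbsorbedMarkovChain κ Pr X) (n : ℕ) (x : D)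
    {C : Set (D ⊕ Unit)} (hC : MeasurableSet C) {A : Set D} (hA : MeasurableSet A) :
    Pr x (X (n + 1) ⁻¹' (Sum.inl '' A) ∩ X n ⁻¹' C) =
      ∫⁻ y in Sum.inl ⁻¹' C, semigroup Pr X 1 y A ∂(semigroup Pr X n x) := by
  rw [← hX.partialLaw_apply _ _ _ hA, hX.partialLaw_succ_preimage le_rfl x hC,
    hX.partialLaw_preimage n x hC, Measure.bind_apply hA (Kernel.aemeasurable _)]

theorem ae_start (hX : IsAbsorbedMarkovChain κ Pr X) (x : D) {A : Set D} (hA : MeasurableSet A) :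
    ∀ᵐ ω ∂(Pr x), X 0 ω ∈ (Sum.inl '' A : Set (D ⊕ Unit)) ↔ x ∈ A := by
  have hA' : MeasurableSet (Sum.inl '' A : Set (D ⊕ Unit)) := measurableSet_inl_image.2 hA
  have hm : MeasurableSet {z : D ⊕ Unit | z ∈ (Sum.inl '' A : Set (D ⊕ Unit)) ↔ x ∈ A} := by
    by_cases h : x ∈ A
    · simp only [h, iff_true]
      exact hA'
    · simp only [h, iff_false]
      exact hA'.compl
  have h : ∀ᵐ z ∂((Pr x).map (X 0)), z ∈ (Sum.inl '' A : Set (D ⊕ Unit)) ↔ x ∈ A := by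
    rw [hX.start, ae_dirac_iff hm]
    simp
  exact ae_of_ae_map (hX.measurable 0).aemeasurable h

variable {D₁ D₂ : Set D}

theorem semigroup_apply_eq_zero (hX : IsAbsorbedMarkovChain κ Pr X) (hD₁ : MeasurableSet D₁)
    (hno : ∀ x ∈ D₂, ∀ᵐ ω ∂(Pr x), hitTime X D₁ ω = ⊤) (n : ℕ) {x : D} (hx : x ∈ D₂) :
    semigroup Pr X n x D₁ = 0 := by
  rw [hX.semigroup_apply n x hD₁]
  refine measure_eq_zero_iff_ae_notMem.2 ?_
  filter_upwards [hno x hx] with ω hω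
  exact hitTime_eq_top_iff.1 hω n

/-- The hypothesis only concerns paths started in `D₂`; by the Markov property, it forbids a return
to `D₁` from outside `D₁` along almost every path. -/
theorem ae_not_return (hX : IsAbsorbedMarkovChain κ Pr X) (hD₁ : MeasurableSet D₁)
    (hD : IsCompl D₁ D₂) (hno : ∀ x ∈ D₂, ∀ᵐ ω ∂(Pr x), hitTime X D₁ ω = ⊤) (x : D) :
    ∀ᵐ ω ∂(Pr x), ∀ n, X n ω ∉ Sum.inl '' D₁ → X (n + 1) ω ∉ Sum.inl '' D₁ := by
  refine ae_all_iff.2 fun n => ?_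
  have h := hX.measure_two_step n x (measurableSet_inl_image.2 hD₁).compl hD₁
  have hpre : (Sum.inl ⁻¹' (Sum.inl '' D₁ : Set (D ⊕ Unit))ᶜ : Set D) = D₂ := by
    rw [Set.preimage_compl, Set.preimage_image_eq _ Sum.inl_injective, hD.compl_eq]
  have hD₂ : MeasurableSet D₂ := hD.compl_eq ▸ hD₁.compl
  rw [hpre, setLIntegral_congr_fun (g := fun _ => 0) hD₂
    (fun y hy => hX.semigroup_apply_eq_zero hD₁ hno 1 hy), lintegral_zero] at h
  filter_upwards [measure_eq_zero_iff_ae_notMem.1 h] with ω hω h1 h2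
  exact hω ⟨h2, h1⟩

theorem ae_absorbed (hX : IsAbsorbedMarkovChain κ Pr X) (x : D) :
    ∀ᵐ ω ∂(Pr x), ∀ n, X n ω ∉ Sum.inl '' (Set.univ : Set D) →
      X (n + 1) ω ∉ Sum.inl '' (Set.univ : Set D) := by
  refine ae_all_iff.2 fun n => ?_
  have h := hX.measure_two_step n x (measurableSet_inl_image.2 MeasurableSet.univ).compl
    MeasurableSet.univ
  have hpre : (Sum.inl ⁻¹' (Sum.inl '' (Set.univ : Set D) : Set (D ⊕ Unit))ᶜ : Set D) = ∅ := by
    rw [Set.preimage_compl, Set.preimage_image_eq _ Sum.inl_injective, Set.compl_univ]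
  rw [hpre, Measure.restrict_empty, lintegral_zero_measure] at h
  filter_upwards [measure_eq_zero_iff_ae_notMem.1 h] with ω hω h1 h2
  exact hω ⟨h2, h1⟩

/-- Starting from `D₁`, the chain enters `D₂` at time `k + 1` exactly if it is in `D₁` at time `k`
and in `D₂` at time `k + 1`; hence the law of the entrance position on this event is
`δ_x P_k Q`. -/
theorem measure_entrance (hX : IsAbsorbedMarkovChain κ Pr X) (hD₁ : MeasurableSet D₁)
    (hD₂ : MeasurableSet D₂) (hD : IsCompl D₁ D₂)
    (hno : ∀ x ∈ D₂, ∀ᵐ ω ∂(Pr x), hitTime X D₁ ω = ⊤) (k : ℕ) (x : D₁) {A : Set D₂}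
    (hA : MeasurableSet A) :
    Pr x ({ω | hitTime X D₂ ω = (k + 1 : ℕ)} ∩ X (k + 1) ⁻¹' ((fun y : D₂ => Sum.inl (y : D)) '' A))
      = ((restrictTo D₁ hD₁ (semigroup Pr X k) x).bind
          (restrictTo D₁ hD₂ (semigroup Pr X 1))) A := by
  set A' : Set D := Subtype.val '' A with hA'
  have hA'm : MeasurableSet A' := hD₂.subtype_image hA
  have hA'D : A' ⊆ D₂ := Subtype.coe_image_subset _ _
  have himg : ((fun y : D₂ => (Sum.inl (y : D) : D ⊕ Unit)) '' A) = Sum.inl '' A' := by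
    rw [hA', Set.image_image]
  have hpre : (Sum.inl ⁻¹' (Sum.inl '' D₁ : Set (D ⊕ Unit)) : Set D) = D₁ :=
    Set.preimage_image_eq _ Sum.inl_injective
  have h1 := hX.measure_two_step k x (measurableSet_inl_image.2 hD₁) hA'm
  have h2 : Pr x ({ω | hitTime X D₂ ω = (k + 1 : ℕ)} ∩ X (k + 1) ⁻¹' (Sum.inl '' A')) =
      Pr x (X (k + 1) ⁻¹' (Sum.inl '' A') ∩ X k ⁻¹' (Sum.inl '' D₁)) := by
    refine measure_congr ?_
    filter_upwards [hX.ae_not_return hD₁ hD hno x, hX.ae_absorbed x] with ω hret habs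
    refine propext ?_
    change (hitTime X D₂ ω = (k + 1 : ℕ) ∧ X (k + 1) ω ∈ Sum.inl '' A') ↔
      (X (k + 1) ω ∈ Sum.inl '' A' ∧ X k ω ∈ Sum.inl '' D₁)
    rw [hitTime_eq_coe_iff]
    constructor
    · rintro ⟨⟨h1, h2⟩, h3⟩
      refine ⟨h3, ?_⟩
      by_contra hk
      have hk2 := h2 k (Nat.lt_succ_self k)
      refine habs k ?_ (Set.image_mono (Set.subset_univ _) h1)
      rintro ⟨y, -, hy⟩
      rcases (hD.sup_eq_top.ge (Set.mem_univ y) : y ∈ D₁ ∪ D₂) with h | h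
      · exact hk ⟨y, h, hy⟩
      · exact hk2 ⟨y, h, hy⟩
    · rintro ⟨h3, hk⟩
      refine ⟨⟨Set.image_mono hA'D h3, fun i hi => ?_⟩, h3⟩
      have hmem : ∀ d, d ≤ k → X (k - d) ω ∈ Sum.inl '' D₁ := by
        intro d
        induction d with
        | zero => intro _; exact hk
        | succ d ih =>
          intro hd
          by_contra h
          have := hret _ h
          rw [show k - (d + 1) + 1 = k - d by omega] at this
          exact this (ih (by omega))
      have := hmem (k - i) (by omega)
      rw [show k - (k - i) = i by omega] at this
      obtain ⟨y, hy, hyX⟩ := this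
      rintro ⟨z, hz, hzX⟩
      have : y = z := Sum.inl_injective (hyX.trans hzX.symm)
      exact Set.disjoint_left.1 hD.disjoint hy (this ▸ hz)
  rw [himg, h2, h1, hpre, ← map_val_restrictTo hD₁,
    lintegral_map ((semigroup Pr X 1).measurable_coe hA'm) measurable_subtype_coe,
    Measure.bind_apply hA (Kernel.aemeasurable _)]
  simp_rw [restrictTo_apply' hD₂]
  rfl

theorem map_entrance (hX : IsAbsorbedMarkovChain κ Pr X) (hD₁ : MeasurableSet D₁)
    (hD₂ : MeasurableSet D₂) (hD : IsCompl D₁ D₂)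
    (hno : ∀ x ∈ D₂, ∀ᵐ ω ∂(Pr x), hitTime X D₁ ω = ⊤) (k : ℕ) (x : D₁) :
    (((Pr x).restrict {ω | hitTime X D₂ ω = (k + 1 : ℕ)}).map (X (k + 1))).comap
        (fun y : D₂ => Sum.inl (y : D))
      = (restrictTo D₁ hD₁ (semigroup Pr X k) x).bind
          (restrictTo D₁ hD₂ (semigroup Pr X 1)) := by
  ext A hA
  have he := measurableEmbedding_inl_val hD₂
  have hA' := he.measurableSet_image.2 hA
  rw [he.comap_apply, Measure.map_apply (hX.measurable _) hA',
    Measure.restrict_apply (hX.measurable _ hA'), Set.inter_comm,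
    hX.measure_entrance hD₁ hD₂ hD hno k x hA]

theorem measure_hitTime_zero (hX : IsAbsorbedMarkovChain κ Pr X)
    (hD₂ : MeasurableSet D₂) (hD : IsCompl D₁ D₂) (x : D₁) :
    Pr x {ω | hitTime X D₂ ω = (0 : ℕ)} = 0 := by
  refine measure_eq_zero_iff_ae_notMem.2 ?_
  filter_upwards [hX.ae_start x hD₂] with ω hω h
  exact Set.disjoint_left.1 hD.disjoint x.2 (hω.1 (hitTime_eq_coe_iff.1 h).1)

end IsAbsorbedMarkovChain

omit [MeasurableSpace D] in
theorem ext_coe {A : Set D} (f : A → ℝ) (y : A) : ext f (y : D) = f y := by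
  rw [ext, dif_pos y.2]

omit [MeasurableSpace D] in
theorem ext_of_notMem {A : Set D} (f : A → ℝ) {x : D} (hx : x ∉ A) : ext f x = 0 := by
  rw [ext, dif_neg hx]

omit [MeasurableSpace D] in
theorem extB_inl_coe {A : Set D} (f : A → ℝ) (y : A) : extB f (Sum.inl (y : D)) = f y :=
  ext_coe f y

omit [MeasurableSpace D] in
theorem extB_of_notMem {A : Set D} (f : A → ℝ) {z : D ⊕ Unit}
    (hz : z ∉ Set.range (fun y : A => (Sum.inl (y : D) : D ⊕ Unit))) : extB f z = 0 := by
  rcases z with z | z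
  · exact ext_of_notMem f fun h => hz ⟨⟨z, h⟩, rfl⟩
  · rfl

omit [MeasurableSpace D] in
theorem extB_nonneg {A : Set D} {f : A → ℝ} (hf : ∀ y, 0 ≤ f y) (z : D ⊕ Unit) : 0 ≤ extB f z := by
  by_cases h : z ∈ Set.range (fun y : A => (Sum.inl (y : D) : D ⊕ Unit))
  · obtain ⟨y, rfl⟩ := h
    rw [extB_inl_coe]; exact hf y
  · rw [extB_of_notMem f h]

theorem lintegral_extB {A : Set D} (hA : MeasurableSet A) (m : Measure (D ⊕ Unit)) (g : A → ℝ) :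
    ∫⁻ z, ENNReal.ofReal (extB g z) ∂m =
      ∫⁻ y, ENNReal.ofReal (g y) ∂(m.comap (fun y : A => Sum.inl (y : D))) := by
  have he := measurableEmbedding_inl_val hA
  have h1 : ∫⁻ y, ENNReal.ofReal (g y) ∂(m.comap (fun y : A => Sum.inl (y : D))) =
      ∫⁻ y, ENNReal.ofReal (extB g (Sum.inl (y : D)))
        ∂(m.comap (fun y : A => Sum.inl (y : D))) := by
    simp_rw [extB_inl_coe]
  rw [h1, ← he.lintegral_map (fun z => ENNReal.ofReal (extB g z)), he.map_comap,
    setLIntegral_eq_of_support_subset]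
  intro z hz
  by_contra h
  exact hz (by simp [extB_of_notMem g h])

theorem measurable_ext {A : Set D} (hA : MeasurableSet A) {g : A → ℝ} (hg : Measurable g) :
    Measurable (ext g) := by
  classical
  exact Measurable.dite (s := A) hg measurable_const hA

theorem measurable_extB {A : Set D} (hA : MeasurableSet A) {g : A → ℝ} (hg : Measurable g) :
    Measurable (extB g) :=
  (measurable_ext hA hg).sumElim measurable_const

variable {D₁ D₂ : Set D}

/-- The entrance integral `𝔼_x(θ^{-T} g(X_T); T < ∞)`, as a series over the entrance time. -/
theorem lintegral_entrance (hX : IsAbsorbedMarkovChain κ Pr X) (hD₁ : MeasurableSet D₁)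
    (hD₂ : MeasurableSet D₂) (hD : IsCompl D₁ D₂)
    (hno : ∀ x ∈ D₂, ∀ᵐ ω ∂(Pr x), hitTime X D₁ ω = ⊤) {θ : ℝ} (hθ : 0 < θ) {g : D₂ → ℝ}
    (hg : Measurable g) (hg0 : ∀ y, 0 ≤ g y) (x : D₁)
    (hfin : ∑' k : ℕ, ENNReal.ofReal (θ⁻¹ ^ (k + 1)) * ∫⁻ y, ENNReal.ofReal (g y)
        ∂((restrictTo D₁ hD₁ (semigroup Pr X k) x).bind
          (restrictTo D₁ hD₂ (semigroup Pr X 1))) ≠ ⊤)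
    [DecidablePred fun ω => hitTime X D₂ ω < ⊤] :
    ENNReal.ofReal (∫ ω, (if hitTime X D₂ ω < ⊤ then θ⁻¹ ^ ((hitTime X D₂ ω).untopD 0) *
        extB g (hitPos X D₂ ω) else 0) ∂(Pr x)) =
      ∑' k : ℕ, ENNReal.ofReal (θ⁻¹ ^ (k + 1)) * ∫⁻ y, ENNReal.ofReal (g y)
        ∂((restrictTo D₁ hD₁ (semigroup Pr X k) x).bind
          (restrictTo D₁ hD₂ (semigroup Pr X 1))) := by
  set G : Ω → ℝ := fun ω => if hitTime X D₂ ω < ⊤ then θ⁻¹ ^ ((hitTime X D₂ ω).untopD 0) *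
    extB g (hitPos X D₂ ω) else 0 with hG
  have hgB := measurable_extB hD₂ hg
  have hgB0 := extB_nonneg hg0
  have hG0 : ∀ ω, 0 ≤ G ω := fun ω => by
    simp only [hG]
    split_ifs
    · exact mul_nonneg (by positivity) (hgB0 _)
    · exact le_rfl
  have hTm := measurableSet_hitTime_eq hX hD₂
  set F : ℕ → Ω → ℝ≥0∞ := fun k => {ω | hitTime X D₂ ω = (k : ℕ)}.indicator
    fun ω => ENNReal.ofReal (θ⁻¹ ^ k) * ENNReal.ofReal (extB g (X k ω)) with hF
  have hFm : ∀ k, Measurable (F k) := fun k =>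
    Measurable.indicator ((hgB.comp (hX.measurable k)).ennreal_ofReal.const_mul _) (hTm k)
  have hGF : ∀ ω, ENNReal.ofReal (G ω) = ∑' k, F k ω := fun ω => by
    by_cases h : hitTime X D₂ ω = ⊤
    · have h1 : G ω = 0 := by simp [hG, h]
      have h2 : ∀ k, F k ω = 0 := fun k => Set.indicator_of_notMem (by
        intro (hk : hitTime X D₂ ω = (k : ℕ))
        exact WithTop.coe_ne_top (hk.symm.trans h)) _
      simp [h1, h2]
    · obtain ⟨n, hn⟩ := WithTop.ne_top_iff_exists.1 h
      have hn' : hitTime X D₂ ω = (n : ℕ) := hn.symm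
      rw [tsum_eq_single n]
      · have h1 : G ω = θ⁻¹ ^ n * extB g (X n ω) := by
          have hlt : hitTime X D₂ ω < ⊤ := hn'.trans_lt (WithTop.coe_lt_top n)
          have hun : (hitTime X D₂ ω).untopD 0 = n := by rw [hn']; rfl
          simp only [hG]
          rw [if_pos hlt, hitPos, hun]
        have h2 : F n ω = ENNReal.ofReal (θ⁻¹ ^ n) * ENNReal.ofReal (extB g (X n ω)) :=
          Set.indicator_of_mem (s := {ω | hitTime X D₂ ω = (n : ℕ)}) hn' _
        rw [h1, h2, ENNReal.ofReal_mul (by positivity)]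
      · intro k hk
        refine Set.indicator_of_notMem ?_ _
        intro (h' : hitTime X D₂ ω = (k : ℕ))
        exact hk (WithTop.coe_injective (h'.symm.trans hn'))
  have hGm : AEStronglyMeasurable G (Pr x) := by
    have : G = fun ω => (∑' k, F k ω).toReal := by
      funext ω
      rw [← hGF, ENNReal.toReal_ofReal (hG0 ω)]
    rw [this]
    exact (Measurable.tsum hFm).ennreal_toReal.aestronglyMeasurable
  have hint : ∀ k, ∫⁻ ω, F k ω ∂(Pr x) = ENNReal.ofReal (θ⁻¹ ^ k) *
      ∫⁻ z, ENNReal.ofReal (extB g z)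
        ∂(((Pr x).restrict {ω | hitTime X D₂ ω = (k : ℕ)}).map (X k)) := fun k => by
    have hm : Measurable fun ω => ENNReal.ofReal (extB g (X k ω)) :=
      (hgB.comp (hX.measurable k)).ennreal_ofReal
    rw [lintegral_indicator (hTm k), lintegral_const_mul _ hm,
      lintegral_map hgB.ennreal_ofReal (hX.measurable k)]
  have hlin : ∫⁻ ω, ENNReal.ofReal (G ω) ∂(Pr x) =
      ∑' k : ℕ, ENNReal.ofReal (θ⁻¹ ^ (k + 1)) * ∫⁻ y, ENNReal.ofReal (g y)
        ∂((restrictTo D₁ hD₁ (semigroup Pr X k) x).bind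
          (restrictTo D₁ hD₂ (semigroup Pr X 1))) := by
    simp_rw [hGF]
    rw [lintegral_tsum fun k => (hFm k).aemeasurable, tsum_eq_zero_add' ENNReal.summable]
    have h0 : ∫⁻ ω, F 0 ω ∂(Pr x) = 0 := by
      rw [hint, Measure.restrict_eq_zero.2 (hX.measure_hitTime_zero hD₂ hD x)]
      simp
    rw [h0, zero_add]
    congr 1
    funext k
    rw [hint, lintegral_extB hD₂, hX.map_entrance hD₁ hD₂ hD hno]
  rw [← hlin] at hfin ⊢
  rw [integral_eq_lintegral_of_nonneg_ae (Eventually.of_forall hG0) hGm,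
    ENNReal.ofReal_toReal hfin]

theorem integral_entrance_right (hX : IsAbsorbedMarkovChain κ Pr X)
    (hD₂ : MeasurableSet D₂) {θ : ℝ} {g : D₂ → ℝ} (hg : Measurable g) (y : D₂)
    [DecidablePred fun ω => hitTime X D₂ ω < ⊤] :
    ∫ ω, (if hitTime X D₂ ω < ⊤ then θ⁻¹ ^ ((hitTime X D₂ ω).untopD 0) *
        extB g (hitPos X D₂ ω) else 0) ∂(Pr y) = g y := by
  have h : ∀ᵐ ω ∂(Pr y), (if hitTime X D₂ ω < ⊤ then θ⁻¹ ^ ((hitTime X D₂ ω).untopD 0) *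
        extB g (hitPos X D₂ ω) else 0) = extB g (X 0 ω) := by
    filter_upwards [hX.ae_start y hD₂] with ω hω
    have h0 : hitTime X D₂ ω = (0 : ℕ) :=
      hitTime_eq_coe_iff.2 ⟨hω.2 y.2, fun i hi => absurd hi (Nat.not_lt_zero i)⟩
    have h1 : hitTime X D₂ ω < ⊤ := h0 ▸ WithTop.coe_lt_top 0
    have h2 : (hitTime X D₂ ω).untopD 0 = 0 := by rw [h0]; rfl
    rw [if_pos h1, hitPos, h2, pow_zero, one_mul]
  have hgB := measurable_extB hD₂ hg
  rw [integral_congr_ae h, ← integral_map (hX.measurable 0).aemeasurable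
    hgB.aestronglyMeasurable, hX.start, integral_dirac' _ _ hgB.stronglyMeasurable, extB_inl_coe]

/-- Under `ℙ_x` with `x ∈ D₁`, the event `T_{D₂} = 1` is almost surely `X_1 ∈ D₂`. -/
theorem partialLaw_hitTime_one (hX : IsAbsorbedMarkovChain κ Pr X) (hD₁ : MeasurableSet D₁)
    (hD₂ : MeasurableSet D₂) (hD : IsCompl D₁ D₂)
    (hno : ∀ x ∈ D₂, ∀ᵐ ω ∂(Pr x), hitTime X D₁ ω = ⊤) (k : ℕ) (x : D₁) :
    partialLaw Pr X (k + 1) x {ω | hitTime X D₂ ω = 1} =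
      (((restrictTo D₁ hD₂ (semigroup Pr X 1) x).bind
        (restrictTo D₂ hD₂ (semigroup Pr X k)))).map Subtype.val := by
  have htri := hX.isTriangular hD₁ hD₂ hD hno
  have hC : MeasurableSet (Sum.inl '' D₂ : Set (D ⊕ Unit)) := measurableSet_inl_image.2 hD₂
  have h1 : partialLaw Pr X (k + 1) x {ω | hitTime X D₂ ω = 1} =
      partialLaw Pr X (k + 1) x (X 1 ⁻¹' (Sum.inl '' D₂)) := by
    ext A hA
    rw [hX.partialLaw_apply _ _ _ hA, hX.partialLaw_apply _ _ _ hA]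
    refine measure_congr ?_
    filter_upwards [hX.ae_start x hD₂] with ω hω
    refine propext (and_congr Iff.rfl ?_)
    change hitTime X D₂ ω = ((1 : ℕ) : WithTop ℕ) ↔ _
    rw [hitTime_eq_coe_iff]
    refine ⟨fun h => h.1, fun h => ⟨h, fun i hi => ?_⟩⟩
    rw [Nat.lt_one_iff.1 hi, hω]
    exact Set.disjoint_left.1 hD.disjoint x.2
  rw [h1]
  have h2 : ∀ k, partialLaw Pr X (k + 1) x (X 1 ⁻¹' (Sum.inl '' D₂)) =
      ((semigroup Pr X 1 x).restrict D₂).bind (semigroup Pr X k) := by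
    intro k
    induction k with
    | zero =>
      have h0 : (semigroup Pr X 0 : D → Measure D) = Measure.dirac := funext hX.semigroup_zero
      rw [hX.partialLaw_preimage 1 x hC, Set.preimage_image_eq _ Sum.inl_injective, h0,
        Measure.bind_dirac]
    | succ k ih =>
      rw [hX.partialLaw_succ_preimage (by omega) x hC, ih]
      exact (bind_kernel_succ hX.semigroup_succ _ _).symm
  rw [h2, ← map_val_restrictTo hD₂, map_val_bind, bind_map_val]
  congr 1
  funext y
  exact htri.right k y

theorem lawFrom_apply (ν : Measure D₁) {A : Set Ω} (hA : MeasurableSet A) :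
    lawFrom Pr ν A = ∫⁻ x, Pr (x : D) A ∂ν := by
  rw [lawFrom, Measure.bind_apply hA Pr.aemeasurable,
    lintegral_map (Pr.measurable_coe hA) measurable_subtype_coe]

/-- The measure defined by a law of paths on `T_{D₂} = 1` is the one built from the kernels. -/
theorem measA1_eq (hX : IsAbsorbedMarkovChain κ Pr X) (hD₁ : MeasurableSet D₁)
    (hD₂ : MeasurableSet D₂) (hD : IsCompl D₁ D₂)
    (hno : ∀ x ∈ D₂, ∀ᵐ ω ∂(Pr x), hitTime X D₁ ω = ⊤) (θ : ℝ) (ν : Measure D₁) :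
    measA1 Pr X D₂ θ ν = ν.map Subtype.val + Measure.sum fun k : ℕ =>
      ENNReal.ofReal (θ⁻¹ ^ (k + 1)) • ((ν.bind (restrictTo D₁ hD₂ (semigroup Pr X 1))).bind
        (restrictTo D₂ hD₂ (semigroup Pr X k))).map Subtype.val := by
  rw [measA1]
  congr 2
  funext k
  congr 1
  ext A hA
  have hA' : MeasurableSet (Sum.inl '' A : Set (D ⊕ Unit)) := measurableSet_inl_image.2 hA
  have hT : MeasurableSet {ω | hitTime X D₂ ω = 1} := measurableSet_hitTime_eq hX hD₂ 1
  rw [measurableEmbedding_inl.comap_apply, Measure.map_apply (hX.measurable _) hA',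
    Measure.restrict_apply (hX.measurable _ hA'),
    lawFrom_apply _ ((hX.measurable _ hA').inter hT),
    Measure.map_apply measurable_subtype_coe hA,
    bind_bind_apply _ _ _ (measurable_subtype_coe hA)]
  refine lintegral_congr fun x => ?_
  rw [← hX.partialLaw_apply _ _ _ hA, partialLaw_hitTime_one hX hD₁ hD₂ hD hno,
    Measure.map_apply measurable_subtype_coe hA]

theorem integral_lawFrom_one (hX : IsAbsorbedMarkovChain κ Pr X)
    (hD₂ : MeasurableSet D₂) (ν : Measure D₁) {g : D₂ → ℝ} (hg : Measurable g) :
    ∫ ω, extB g (X 1 ω) ∂(lawFrom Pr ν) =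
      ∫ y, g y ∂(ν.bind (restrictTo D₁ hD₂ (semigroup Pr X 1))) := by
  have he := measurableEmbedding_inl_val hD₂
  have hcomap : ((lawFrom Pr ν).map (X 1)).comap (fun y : D₂ => Sum.inl (y : D)) =
      ν.bind (restrictTo D₁ hD₂ (semigroup Pr X 1)) := by
    ext A hA
    have hA' := he.measurableSet_image.2 hA
    have hAv : MeasurableSet (Subtype.val '' A : Set D) := hD₂.subtype_image hA
    rw [he.comap_apply, Measure.map_apply (hX.measurable _) hA',
      lawFrom_apply _ (hX.measurable _ hA'), Measure.bind_apply hA (Kernel.aemeasurable _)]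
    refine lintegral_congr fun x => ?_
    rw [restrictTo_apply' hD₂, hX.semigroup_apply _ _ hAv, Set.image_image]
  have hgB := measurable_extB hD₂ hg
  rw [← hcomap, ← integral_map (hX.measurable 1).aemeasurable hgB.aestronglyMeasurable]
  have h1 : ∫ y, g y ∂(((lawFrom Pr ν).map (X 1)).comap (fun y : D₂ => Sum.inl (y : D))) =
      ∫ y : D₂, extB g (Sum.inl (y : D))
        ∂(((lawFrom Pr ν).map (X 1)).comap (fun y : D₂ => Sum.inl (y : D))) := by
    simp_rw [extB_inl_coe]
  rw [h1, ← he.integral_map (fun z => extB g z), he.map_comap,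
    setIntegral_eq_integral_of_forall_compl_eq_zero]
  exact fun z hz => extB_of_notMem g hz

/-- An almost sure bound at the entrance position holds for the entrance law at each time. -/
theorem ae_entrance_le (hX : IsAbsorbedMarkovChain κ Pr X) (hD₁ : MeasurableSet D₁)
    (hD₂ : MeasurableSet D₂) (hD : IsCompl D₁ D₂)
    (hno : ∀ x ∈ D₂, ∀ᵐ ω ∂(Pr x), hitTime X D₁ ω = ⊤) {g : D₂ → ℝ} (hg : Measurable g)
    {b : ℝ} (x : D₁)
    (h : Pr x {ω | extB g (hitPos X D₂ ω) ≤ b ∧ hitTime X D₂ ω < ⊤} =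
      Pr x {ω | hitTime X D₂ ω < ⊤}) (k : ℕ) :
    ∀ᵐ y ∂((restrictTo D₁ hD₁ (semigroup Pr X k) x).bind
        (restrictTo D₁ hD₂ (semigroup Pr X 1))), g y ≤ b := by
  have := hX.prob x
  have hA : MeasurableSet {y | b < g y} := measurableSet_lt measurable_const hg
  have hset : {y | ¬ g y ≤ b} = {y | b < g y} := by ext; simp
  rw [ae_iff, hset, ← hX.measure_entrance hD₁ hD₂ hD hno k x hA]
  set N := {ω | hitTime X D₂ ω = (k + 1 : ℕ)} ∩
    X (k + 1) ⁻¹' ((fun y : D₂ => (Sum.inl (y : D) : D ⊕ Unit)) '' {y | b < g y})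
  have hNm : MeasurableSet N := (measurableSet_hitTime_eq hX hD₂ (k + 1)).inter
    (hX.measurable _ ((measurableEmbedding_inl_val hD₂).measurableSet_image.2 hA))
  have hsub : {ω | extB g (hitPos X D₂ ω) ≤ b ∧ hitTime X D₂ ω < ⊤} ⊆
      {ω | hitTime X D₂ ω < ⊤} \ N := by
    rintro ω ⟨h1, h2⟩
    refine ⟨h2, ?_⟩
    rintro ⟨h3 : hitTime X D₂ ω = (k + 1 : ℕ), y, hy, hyX⟩
    have h4 : hitPos X D₂ ω = X (k + 1) ω := by rw [hitPos, h3]; rfl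
    rw [h4, ← hyX, extB_inl_coe] at h1
    exact absurd h1 (not_le.2 hy)
  have hNsub : N ⊆ {ω | hitTime X D₂ ω < ⊤} := by
    rintro ω ⟨h3 : hitTime X D₂ ω = (k + 1 : ℕ), -⟩
    exact lt_of_eq_of_lt h3 (WithTop.coe_lt_top (k + 1))
  have h1 := measure_mono (μ := Pr x) hsub
  rw [h, measure_sdiff hNsub hNm.nullMeasurableSet (measure_ne_top _ _)] at h1
  have h2 := measure_mono (μ := Pr x) hNsub
  have hfin := measure_ne_top (Pr x) {ω | hitTime X D₂ ω < ⊤}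
  by_contra hN
  have h3 : 0 < Pr x {ω | hitTime X D₂ ω < ⊤} := lt_of_lt_of_le (pos_iff_ne_zero.2 hN) h2
  exact absurd h1 (not_le.2 (ENNReal.sub_lt_self hfin h3.ne' hN))

/-- Entering `D₂` through `A` with positive probability means doing so at some time with positive
probability. Time `0` is excluded, because `ν` lives on `D₁`. -/
theorem exists_entrance_pos (hX : IsAbsorbedMarkovChain κ Pr X) (hD₁ : MeasurableSet D₁)
    (hD₂ : MeasurableSet D₂) (hD : IsCompl D₁ D₂)
    (hno : ∀ x ∈ D₂, ∀ᵐ ω ∂(Pr x), hitTime X D₁ ω = ⊤) {A : Set D₂} (hA : MeasurableSet A)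
    (ν : Measure D₁) {T : Set Ω}
    (hT : ∀ ω ∈ T, hitTime X D₂ ω < ⊤ ∧
      hitPos X D₂ ω ∈ (fun y : D₂ => (Sum.inl (y : D) : D ⊕ Unit)) '' A)
    (h : 0 < lawFrom Pr ν T) :
    ∃ k, ((ν.bind (restrictTo D₁ hD₁ (semigroup Pr X k))).bind
        (restrictTo D₁ hD₂ (semigroup Pr X 1))) A ≠ 0 := by
  by_contra! hz
  have hAm := (measurableEmbedding_inl_val hD₂).measurableSet_image.2 hA
  set N : ℕ → Set Ω := fun k => {ω | hitTime X D₂ ω = (k : ℕ)} ∩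
    X k ⁻¹' ((fun y : D₂ => (Sum.inl (y : D) : D ⊕ Unit)) '' A) with hN
  have hNm : ∀ k, MeasurableSet (N k) := fun k =>
    (measurableSet_hitTime_eq hX hD₂ k).inter (hX.measurable _ hAm)
  have hsub : T ⊆ ⋃ k, N k := fun ω hω => by
    obtain ⟨h1, h2⟩ := hT ω hω
    obtain ⟨n, hn⟩ := WithTop.ne_top_iff_exists.1 h1.ne
    have hn' : hitTime X D₂ ω = (n : ℕ) := hn.symm
    have h4 : hitPos X D₂ ω = X n ω := by rw [hitPos, hn']; rfl
    exact Set.mem_iUnion.2 ⟨n, hn', by rw [Set.mem_preimage, ← h4]; exact h2⟩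
  have hnull : ∀ k, lawFrom Pr ν (N k) = 0 := fun k => by
    rw [lawFrom_apply _ (hNm k)]
    rcases k with _ | k
    · rw [lintegral_congr (g := fun _ => 0), lintegral_zero]
      intro x
      exact measure_mono_null Set.inter_subset_left (hX.measure_hitTime_zero hD₂ hD x)
    · rw [← hz k, bind_bind_apply _ _ _ hA]
      exact lintegral_congr fun x => hX.measure_entrance hD₁ hD₂ hD hno k x hA
  exact absurd (measure_mono_null hsub (measure_iUnion_null hnull)) h.ne'

end Entrance

/-! ### Gluing the two blocks -/

section Glue

variable {D : Type*} [MeasurableSpace D] {D₁ D₂ : Set D}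

omit [MeasurableSpace D] in
theorem ext_add_ext_left (hD : IsCompl D₁ D₂) (f : D₁ → ℝ) (g : D₂ → ℝ) (x : D₁) :
    ext f (x : D) + ext g (x : D) = f x := by
  rw [ext_coe, ext_of_notMem g (Set.disjoint_left.1 hD.disjoint x.2), add_zero]

omit [MeasurableSpace D] in
theorem ext_add_ext_right (hD : IsCompl D₁ D₂) (f : D₁ → ℝ) (g : D₂ → ℝ) (y : D₂) :
    ext f (y : D) + ext g (y : D) = g y := by
  rw [ext_coe, ext_of_notMem f (Set.disjoint_right.1 hD.disjoint y.2), zero_add]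

omit [MeasurableSpace D] in
theorem forall_of_isCompl (hD : IsCompl D₁ D₂) {p : D → Prop} (h₁ : ∀ x : D₁, p x)
    (h₂ : ∀ y : D₂, p y) (x : D) : p x := by
  rcases (hD.sup_eq_top.ge (Set.mem_univ x) : x ∈ D₁ ∪ D₂) with h | h
  · exact h₁ ⟨x, h⟩
  · exact h₂ ⟨x, h⟩

omit [MeasurableSpace D] in
theorem one_le_ext_add_ext (hD : IsCompl D₁ D₂) {f : D₁ → ℝ} {g : D₂ → ℝ} (hf : ∀ x, 1 ≤ f x)
    (hg : ∀ y, 1 ≤ g y) (x : D) : 1 ≤ ext f x + ext g x :=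
  forall_of_isCompl hD (p := fun x => 1 ≤ ext f x + ext g x)
    (fun x => by rw [ext_add_ext_left hD]; exact hf x)
    (fun y => by rw [ext_add_ext_right hD]; exact hg y) x

theorem lintegral_map_val_left (hD₁ : MeasurableSet D₁) (hD : IsCompl D₁ D₂) (f : D₁ → ℝ)
    (g : D₂ → ℝ) (m : Measure D₁) :
    ∫⁻ x, ENNReal.ofReal (ext f x + ext g x) ∂(m.map Subtype.val) =
      ∫⁻ x, ENNReal.ofReal (f x) ∂m := by
  rw [(MeasurableEmbedding.subtype_coe hD₁).lintegral_map]
  simp_rw [ext_add_ext_left hD]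

theorem lintegral_map_val_right (hD₂ : MeasurableSet D₂) (hD : IsCompl D₁ D₂) (f : D₁ → ℝ)
    (g : D₂ → ℝ) (m : Measure D₂) :
    ∫⁻ x, ENNReal.ofReal (ext f x + ext g x) ∂(m.map Subtype.val) =
      ∫⁻ y, ENNReal.ofReal (g y) ∂m := by
  rw [(MeasurableEmbedding.subtype_coe hD₂).lintegral_map]
  simp_rw [ext_add_ext_right hD]

theorem lintegral_sum_smul_le {E ι : Type*} [MeasurableSpace E] {μ : ι → Measure E} {g : E → ℝ≥0∞}
    {c b : ι → ℝ} {s : ℝ} (hc : ∀ i, 0 ≤ c i) (hb : ∀ i, 0 ≤ b i)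
    (hμ : ∀ i, ∫⁻ y, g y ∂(μ i) ≤ ENNReal.ofReal (b i)) (hs : HasSum (fun i => c i * b i) s) :
    ∫⁻ y, g y ∂(Measure.sum fun i => ENNReal.ofReal (c i) • μ i) ≤ ENNReal.ofReal s := by
  rw [lintegral_sum_measure]
  simp_rw [lintegral_smul_measure]
  rw [← hs.tsum_eq, ENNReal.ofReal_tsum_of_nonneg (fun i => mul_nonneg (hc i) (hb i)) hs.summable]
  refine ENNReal.tsum_le_tsum fun i => ?_
  rw [ENNReal.ofReal_mul (hc i), smul_eq_mul]
  gcongr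
  exact hμ i

theorem hasSum_integral_sum_smul {E ι : Type*} [MeasurableSpace E] {μ : ι → Measure E} {f : E → ℝ}
    {c : ι → ℝ} (hc : ∀ i, 0 ≤ c i)
    (hf : Integrable f (Measure.sum fun i => ENNReal.ofReal (c i) • μ i)) :
    HasSum (fun i => c i * ∫ y, f y ∂(μ i))
      (∫ y, f y ∂(Measure.sum fun i => ENNReal.ofReal (c i) • μ i)) := by
  refine (hasSum_integral_measure hf).congr_fun fun i => ?_
  rw [integral_smul_measure, ENNReal.toReal_ofReal (hc i), smul_eq_mul]

theorem hasSum_geometric_shift {γ θ : ℝ} (hγ : 0 < γ) (hγθ : γ < θ) (a : ℝ) :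
    HasSum (fun k : ℕ => θ⁻¹ ^ (k + 1) * (a * γ ^ k)) (a * (θ - γ)⁻¹) := by
  have hθ : 0 < θ := hγ.trans hγθ
  have h := (hasSum_geometric_of_lt_one (div_nonneg hγ.le hθ.le)
    ((div_lt_one hθ).2 hγθ)).mul_left (θ⁻¹ * a)
  have e : a * (θ - γ)⁻¹ = θ⁻¹ * a * (1 - γ / θ)⁻¹ := by
    have : θ - γ ≠ 0 := by linarith
    have : 1 - γ / θ ≠ 0 := by
      have := (div_lt_one hθ).2 hγθ
      linarith
    field_simp
  rw [e]
  refine h.congr_fun fun k => ?_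
  rw [div_pow, inv_pow]
  field_simp
  ring

theorem expParam₀_eq_of_bounds {E : Type*} [MeasurableSpace E] {S : ℕ → Kernel E E} {t : ℝ}
    (ht : 0 < t) (hlow : ENNReal.ofReal t ≤ expParam₀ S)
    (hb : ∀ x, ∃ (j : ℕ) (C : ℝ), ∀ n : ℕ, 1 ≤ n →
      S n x Set.univ ≤ ENNReal.ofReal (C * (n : ℝ) ^ j * t ^ n)) :
    expParam₀ S = ENNReal.ofReal t := by
  refine le_antisymm (iSup_le fun x => ?_) hlow
  obtain ⟨j, C, hC⟩ := hb x
  exact expParam_le_of_bound (j := j) (C := C) ht fun n hn => by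
    rw [dirac_bind_kernel]; exact hC n hn

namespace IsTriangular

variable {S : ℕ → Kernel D D} {P : ℕ → Kernel D₁ D₁} {Q : Kernel D₁ D₂} {R : ℕ → Kernel D₂ D₂}

theorem le_left (h : IsTriangular S P Q R) (n : ℕ) (x : D₁) :
    P n x Set.univ ≤ S n x Set.univ := by
  rw [h.left, Measure.add_apply, Measure.map_apply measurable_subtype_coe MeasurableSet.univ,
    Set.preimage_univ]
  exact le_self_add

theorem bind_le_left (h : IsTriangular S P Q R) {n k : ℕ} (hk : k < n) (x : D₁) :
    ((P k x).bind Q).bind (R (n - 1 - k)) Set.univ ≤ S n x Set.univ := by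
  rw [h.left, Measure.add_apply, Measure.map_apply measurable_subtype_coe MeasurableSet.univ,
    Measure.map_apply measurable_subtype_coe MeasurableSet.univ, Set.preimage_univ,
    Set.preimage_univ, Measure.finsetSum_apply]
  exact (Finset.single_le_sum (f := fun k => ((P k x).bind Q).bind (R (n - 1 - k)) Set.univ)
    (fun _ _ => bot_le) (Finset.mem_range.2 hk)).trans le_add_self

theorem right_univ (h : IsTriangular S P Q R) (n : ℕ) (y : D₂) :
    S n y Set.univ = R n y Set.univ := by
  rw [h.right, Measure.map_apply measurable_subtype_coe MeasurableSet.univ, Set.preimage_univ]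

theorem integral_right (h : IsTriangular S P Q R) (hD₂ : MeasurableSet D₂) (n : ℕ) (y : D₂)
    (f : D → ℝ) : ∫ z, f z ∂(S n y) = ∫ z : D₂, f z ∂(R n y) := by
  rw [h.right, (MeasurableEmbedding.subtype_coe hD₂).integral_map]

theorem integrable_right (h : IsTriangular S P Q R) (hD₂ : MeasurableSet D₂) {n : ℕ} {y : D₂}
    {f : D → ℝ} (hf : Integrable (fun z : D₂ => f z) (R n y)) : Integrable f (S n y) := by
  rw [h.right, (MeasurableEmbedding.subtype_coe hD₂).integrable_map_iff]
  exact hf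

theorem integrable_left (h : IsTriangular S P Q R) (hD₁ : MeasurableSet D₁)
    (hD₂ : MeasurableSet D₂) {n : ℕ} {x : D₁} {f : D → ℝ}
    (hf₁ : Integrable (fun z : D₁ => f z) (P n x))
    (hf₂ : ∀ k < n, Integrable (fun z : D₂ => f z) (((P k x).bind Q).bind (R (n - 1 - k)))) :
    Integrable f (S n x) := by
  rw [h.left, integrable_add_measure, (MeasurableEmbedding.subtype_coe hD₁).integrable_map_iff,
    (MeasurableEmbedding.subtype_coe hD₂).integrable_map_iff, integrable_finsetSum_measure]
  exact ⟨hf₁, fun k hk => hf₂ k (Finset.mem_range.1 hk)⟩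

theorem integral_left (h : IsTriangular S P Q R) (hD₁ : MeasurableSet D₁)
    (hD₂ : MeasurableSet D₂) {n : ℕ} {x : D₁} {f : D → ℝ}
    (hf₁ : Integrable (fun z : D₁ => f z) (P n x))
    (hf₂ : ∀ k < n, Integrable (fun z : D₂ => f z) (((P k x).bind Q).bind (R (n - 1 - k)))) :
    ∫ z, f z ∂(S n x) = ∫ z : D₁, f z ∂(P n x) +
      ∑ k ∈ Finset.range n, ∫ z : D₂, f z ∂(((P k x).bind Q).bind (R (n - 1 - k))) := by
  have h2 : ∀ k ∈ Finset.range n,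
      Integrable (fun z : D₂ => f z) (((P k x).bind Q).bind (R (n - 1 - k))) :=
    fun k hk => hf₂ k (Finset.mem_range.1 hk)
  rw [h.left, integral_add_measure, (MeasurableEmbedding.subtype_coe hD₁).integral_map,
    (MeasurableEmbedding.subtype_coe hD₂).integral_map, integral_finsetSum_measure h2]
  · rw [(MeasurableEmbedding.subtype_coe hD₁).integrable_map_iff]
    exact hf₁
  · rw [(MeasurableEmbedding.subtype_coe hD₂).integrable_map_iff, integrable_finsetSum_measure]
    exact h2

theorem expParam₀_le_left (h : IsTriangular S P Q R) : expParam₀ P ≤ expParam₀ S :=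
  iSup_le fun x => (expParam_mono (ν := Measure.dirac (x : D)) fun n => by
    rw [dirac_bind_kernel, dirac_bind_kernel]; exact h.le_left n x).trans
    (le_iSup (fun x => expParam S (Measure.dirac x)) (x : D))

theorem expParam_right (h : IsTriangular S P Q R) (y : D₂) :
    expParam S (Measure.dirac (y : D)) = expParam R (Measure.dirac y) := by
  refine le_antisymm (expParam_mono fun n => ?_) (expParam_mono fun n => ?_) <;>
  rw [dirac_bind_kernel, dirac_bind_kernel, h.right_univ]

theorem expParam₀_le_right (h : IsTriangular S P Q R) : expParam₀ R ≤ expParam₀ S :=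
  iSup_le fun y => (h.expParam_right y).symm.trans_le
    (le_iSup (fun x => expParam S (Measure.dirac x)) (y : D))

theorem jAt_right (h : IsTriangular S P Q R) (hθ : expParam₀ S = expParam₀ R) (y : D₂) :
    jAt S y = jAt R y := by
  simp only [jAt, polyParam, dirac_bind_kernel, h.right_univ, hθ]

end IsTriangular

end Glue

/-! ### The first block dominates -/

section First

variable {D : Type*} [MeasurableSpace D] {D₁ D₂ : Set D}

/-- The measure `ν + ∑_{k ≥ 0} θ^{-k-1} ν Q R_k` on `D`. -/
noncomputable def tailMeasure (Q : Kernel D₁ D₂) (R : ℕ → Kernel D₂ D₂) (θ : ℝ)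
    (ν : Measure D₁) : Measure D :=
  ν.map Subtype.val + Measure.sum fun k : ℕ =>
    ENNReal.ofReal (θ⁻¹ ^ (k + 1)) • ((ν.bind Q).bind (R k)).map Subtype.val

theorem tailMeasure_apply (Q : Kernel D₁ D₂) (R : ℕ → Kernel D₂ D₂) (θ : ℝ)
    (ν : Measure D₁) {A : Set D} (hA : MeasurableSet A) :
    tailMeasure Q R θ ν A = ∫⁻ z, (Measure.dirac (z : D) A + ∑' k : ℕ,
      ENNReal.ofReal (θ⁻¹ ^ (k + 1)) * ((Q z).bind (R k)) (Subtype.val ⁻¹' A)) ∂ν := by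
  have hv : Measurable (Subtype.val : D₁ → D) := measurable_subtype_coe
  have hA₂ : MeasurableSet ((Subtype.val : D₂ → D) ⁻¹' A) := measurable_subtype_coe hA
  have h1 : Measurable fun z : D₁ => Measure.dirac (z : D) A :=
    (Measure.measurable_coe hA).comp (Measure.measurable_dirac.comp hv)
  have h2 : ∀ k, Measurable fun z : D₁ => ((Q z).bind (R k)) (Subtype.val ⁻¹' A) := fun k =>
    (Measure.measurable_coe hA₂).comp ((Measure.measurable_bind' (R k).measurable).comp
      Q.measurable)
  rw [lintegral_add_left h1, lintegral_tsum fun k => ((h2 k).const_mul _).aemeasurable,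
    tailMeasure, Measure.add_apply, Measure.sum_apply _ hA]
  congr 1
  · rw [Measure.map_apply hv hA, ← lintegral_indicator_one (hv hA)]
    refine lintegral_congr fun z => ?_
    rw [Measure.dirac_apply' _ hA]
    rfl
  · congr 1
    funext k
    rw [lintegral_const_mul _ (h2 k), Measure.smul_apply, smul_eq_mul,
      Measure.map_apply measurable_subtype_coe hA, bind_bind_apply _ _ _ hA₂]

/-- `ν ↦ tailMeasure ν` is linear, and therefore commutes with `∑ i, η_i(x) ν_i`. -/
theorem sum_smul_tailMeasure {I : Type*} (Q : Kernel D₁ D₂) (R : ℕ → Kernel D₂ D₂) (θ : ℝ)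
    (η : I → D₁ → ℝ) (ν : I → Measure D₁) (x : D₁) :
    Measure.sum (fun i => ENNReal.ofReal (η i x) • tailMeasure Q R θ (ν i)) =
      tailMeasure Q R θ (limitMeasure η ν x) := by
  ext A hA
  rw [Measure.sum_apply _ hA, tailMeasure_apply _ _ _ _ hA, lintegral_limitMeasure]
  congr 1
  funext i
  rw [Measure.smul_apply, smul_eq_mul, tailMeasure_apply _ _ _ _ hA]

variable {WP : D₁ → ℝ} {WR : D₂ → ℝ} {γ c : ℝ} {Q : Kernel D₁ D₂} {R : ℕ → Kernel D₂ D₂}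

theorem lintegral_bind_jump_le (hWR : Measurable WR) (hQ : JumpBound Q WP WR) {ν : Measure D₁}
    {b : ℝ} (hν : ∫⁻ x, ENNReal.ofReal (WP x) ∂ν ≤ ENNReal.ofReal b) :
    ∫⁻ y, ENNReal.ofReal (WR y) ∂(ν.bind Q) ≤ ENNReal.ofReal b := by
  have := lintegral_bind_ofReal_le zero_le_one hWR (fun x => by rw [one_mul]; exact hQ x) hν
  rwa [one_mul] at this

theorem lintegral_bind_geom_le (hc : 0 < c) (hγ : 0 < γ) (hWR : Measurable WR)
    (hR : GeomBound R WR c γ) {m : Measure D₂} {b : ℝ}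
    (hm : ∫⁻ x, ENNReal.ofReal (WR x) ∂m ≤ ENNReal.ofReal b) (k : ℕ) :
    ∫⁻ y, ENNReal.ofReal (WR y) ∂(m.bind (R k)) ≤ ENNReal.ofReal (c * γ ^ k * b) :=
  lintegral_bind_ofReal_le (by positivity) hWR (fun y => hR y k) hm

theorem lintegral_tailMeasure_le {θ : ℝ} (hD₁ : MeasurableSet D₁) (hD₂ : MeasurableSet D₂)
    (hD : IsCompl D₁ D₂) (hc : 0 < c) (hγ : 0 < γ) (hγθ : γ < θ) (hWR : Measurable WR)
    (hQ : JumpBound Q WP WR) (hR : GeomBound R WR c γ) {ν : Measure D₁} {b : ℝ} (hb : 0 ≤ b)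
    (hν : ∫⁻ x, ENNReal.ofReal (WP x) ∂ν ≤ ENNReal.ofReal b) :
    ∫⁻ x, ENNReal.ofReal (ext WP x + ext WR x) ∂(tailMeasure Q R θ ν) ≤
      ENNReal.ofReal ((1 + c * (θ - γ)⁻¹) * b) := by
  have hθ : 0 < θ := hγ.trans hγθ
  have hd : 0 < (θ - γ)⁻¹ := inv_pos.2 (sub_pos.2 hγθ)
  rw [tailMeasure, lintegral_add_measure, lintegral_map_val_left hD₁ hD]
  have e : (1 + c * (θ - γ)⁻¹) * b = b + c * b * (θ - γ)⁻¹ := by ring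
  rw [e, ENNReal.ofReal_add hb (by positivity)]
  refine add_le_add hν (lintegral_sum_smul_le (b := fun k => c * b * γ ^ k)
    (fun k => by positivity) (fun k => by positivity) (fun k => ?_)
    (hasSum_geometric_shift hγ hγθ (c * b)))
  rw [lintegral_map_val_right hD₂ hD]
  refine (lintegral_bind_geom_le hc hγ hWR hR (lintegral_bind_jump_le hWR hQ hν) k).trans
    (le_of_eq ?_)
  congr 1
  ring

theorem integral_tailMeasure {θ : ℝ} (hθ : 0 < θ) (hD₁ : MeasurableSet D₁)
    (hD₂ : MeasurableSet D₂) {ν : Measure D₁} {f : D → ℝ}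
    (hf : Integrable f (tailMeasure Q R θ ν)) :
    ∫ x, f x ∂(tailMeasure Q R θ ν) = ∫ x : D₁, f x ∂ν +
      ∑' k : ℕ, θ⁻¹ ^ (k + 1) * ∫ y : D₂, f y ∂((ν.bind Q).bind (R k)) := by
  rw [tailMeasure] at hf ⊢
  rw [integrable_add_measure] at hf
  rw [integral_add_measure hf.1 hf.2, (MeasurableEmbedding.subtype_coe hD₁).integral_map,
    ← (hasSum_integral_sum_smul (fun k => by positivity) hf.2).tsum_eq]
  simp_rw [(MeasurableEmbedding.subtype_coe hD₂).integral_map]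

variable {S : ℕ → Kernel D D} {P : ℕ → Kernel D₁ D₁} {Λ : Kernel D₁ D₁} {j : D₁ → ℕ} {α : ℕ → ℝ}
  {θ B : ℝ}

theorem integrable_block_sum (hA : ConvergesToKernel P WP Λ j α θ B)
    (hc : 0 < c) (hγ : 0 < γ) (hWR : Measurable WR) (hQ : JumpBound Q WP WR)
    (hR : GeomBound R WR c γ) {f : D₂ → ℝ} (hf : Measurable f) {N : ℝ} (hN : 0 ≤ N)
    (hfN : ∀ y, |f y| ≤ N * WR y) (x : D₁) (k m : ℕ) :
    Integrable f (((P k x).bind Q).bind (R m)) :=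
  integrable_of_lintegral_le hf hN hfN (lintegral_bind_geom_le hc hγ hWR hR
    (lintegral_bind_jump_le hWR hQ (hA.lintegral_eq_ofReal_integral k x).le) m)

/-- With `h_k(z) = δ_z Q R_k f`, so that `|h_k| ≤ c γ^k ‖f‖ W_P`, one has
`S_n f(x) = P_n f(x) + ∑_{k<n} P_{n-1-k} h_k(x)` and the limit is
`Λ f(x) + ∑_k θ^{-k-1} Λ h_k(x)`. The terms are compared one by one. -/
theorem first_estimate_left (h : IsTriangular S P Q R)
    (hA : ConvergesToKernel P WP Λ j α θ B) (hD₁ : MeasurableSet D₁) (hD₂ : MeasurableSet D₂)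
    (hD : IsCompl D₁ D₂) (hc : 0 < c) (hγ : 0 < γ) (hγθ : γ < θ) (hWRm : Measurable WR)
    (hWR : ∀ y, 1 ≤ WR y) (hQ : JumpBound Q WP WR)
    (hR : GeomBound R WR c γ) {J : ℝ} (hJ : ∀ x, (j x : ℝ) ≤ J) {x : D₁} {n : ℕ} {f : D → ℝ}
    {N : ℝ} (hn : 1 ≤ n) (hf : Measurable f) (hN : 0 ≤ N)
    (hfN : ∀ z, |f z| ≤ N * (ext WP z + ext WR z)) :
    |θ⁻¹ ^ n * ((n : ℝ) ^ j x)⁻¹ * (∫ z, f z ∂(S n x)) -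
        ∫ z, f z ∂(tailMeasure Q R θ (Λ x))| ≤
      rateA1 ((1 + c / γ * (1 + 2 * B)) * (3 + 1 / (1 - γ / θ)) + c) γ θ J α n * WP x * N := by
  have hθ : 0 < θ := hγ.trans hγθ
  have hr0 : 0 < γ / θ := div_pos hγ hθ
  have hr1 : γ / θ < 1 := (div_lt_one hθ).2 hγθ
  have hB := hA.bound_nonneg
  have hJ0 : 0 ≤ J := (j x).cast_nonneg.trans (hJ x)
  have hw0 : 0 ≤ WP x * N := mul_nonneg (hA.W_pos x).le hN
  have hα := hA.rate_nonneg
  have hf₁m : Measurable fun z : D₁ => f z := hf.comp measurable_subtype_coe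
  have hf₂m : Measurable fun z : D₂ => f z := hf.comp measurable_subtype_coe
  have hf₁ : ∀ z : D₁, |f z| ≤ N * WP z := fun z => by
    have := hfN z; rwa [ext_add_ext_left hD] at this
  have hf₂ : ∀ z : D₂, |f z| ≤ N * WR z := fun z => by
    have := hfN z; rwa [ext_add_ext_right hD] at this
  have hfint₁ : ∀ k, Integrable (fun z : D₁ => f z) (P k x) := fun k =>
    integrable_of_lintegral_le hf₁m hN hf₁ (hA.lintegral_eq_ofReal_integral k x).le
  have hfint₂ : ∀ k m, Integrable (fun z : D₂ => f z) (((P k x).bind Q).bind (R m)) :=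
    integrable_block_sum hA hc hγ hWRm hQ hR hf₂m hN hf₂ x
  have hW : ∀ z, 1 ≤ ext WP z + ext WR z := one_le_ext_add_ext hD hA.one_le_W hWR
  have hΛx := lintegral_bind_jump_le hWRm hQ (hA.lintegral_limit_le x)
  have hfintΛ : ∀ k, Integrable (fun z : D₂ => f z) (((Λ x).bind Q).bind (R k)) := fun k =>
    integrable_of_lintegral_le hf₂m hN hf₂ (lintegral_bind_geom_le hc hγ hWRm hR hΛx k)
  have hfintT : Integrable f (tailMeasure Q R θ (Λ x)) :=
    integrable_of_lintegral_le hf hN hfN (lintegral_tailMeasure_le hD₁ hD₂ hD hc hγ hγθ hWRm hQ hR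
      (mul_nonneg hB (hA.W_pos x).le) (hA.lintegral_limit_le x))
  set g : ℕ → D₁ → ℝ := fun k z => ∫ y : D₂, f y ∂((R k ∘ₖ Q) z) with hg
  have hgm : ∀ k, Measurable (g k) := fun k =>
    (StronglyMeasurable.integral_kernel (κ := R k ∘ₖ Q) hf₂m.stronglyMeasurable).measurable
  have hgN : ∀ k z, |g k z| ≤ (c * γ ^ k * N) * WP z := fun k z => by
    have h1 : ∫⁻ y, ENNReal.ofReal (WR y) ∂((R k ∘ₖ Q) z) ≤
        ENNReal.ofReal (c * γ ^ k * WP z) := by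
      rw [Kernel.comp_apply]
      exact lintegral_bind_geom_le hc hγ hWRm hR (hQ z) k
    refine (abs_integral_le_of_lintegral_le hN (mul_nonneg (by positivity) (hA.W_pos z).le)
      (Eventually.of_forall hf₂) h1).trans (le_of_eq (by ring))
  have hcomp : ∀ (μ : Measure D₁) (k : ℕ), (μ.bind Q).bind (R k) = μ.bind (R k ∘ₖ Q) :=
    fun μ k => Measure.comp_assoc
  have hgP : ∀ k m, ∫ y : D₂, f y ∂(((P k x).bind Q).bind (R m)) = ∫ z, g m z ∂(P k x) :=
    fun k m => by
      have := hfint₂ k m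
      rw [hcomp] at this ⊢
      rw [integral_bind_kernel this]
  have hgΛ : ∀ m, ∫ y : D₂, f y ∂(((Λ x).bind Q).bind (R m)) = ∫ z, g m z ∂(Λ x) := fun m => by
    have := hfintΛ m
    rw [hcomp] at this ⊢
    rw [integral_bind_kernel this]
  -- the sum is reversed, so that the index `k` counts the steps spent in `D₂`
  have hS : θ⁻¹ ^ n * ((n : ℝ) ^ j x)⁻¹ * (∫ z, f z ∂(S n x)) =
      θ⁻¹ ^ n * ((n : ℝ) ^ j x)⁻¹ * (∫ z : D₁, f z ∂(P n x)) + ∑ k ∈ Finset.range n,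
        θ⁻¹ ^ (k + 1) * (θ⁻¹ ^ (n - 1 - k) * ((n : ℝ) ^ j x)⁻¹ * ∫ z, g k z ∂(P (n - 1 - k) x)) := by
    rw [h.integral_left hD₁ hD₂ (hfint₁ n) (fun k _ => hfint₂ k _), mul_add,
      ← Finset.sum_range_reflect, Finset.mul_sum]
    congr 1
    refine Finset.sum_congr rfl fun k hk => ?_
    have hk' := Finset.mem_range.1 hk
    have e1 : n - 1 - (n - 1 - k) = k := by omega
    have e2 : n = (k + 1) + (n - 1 - k) := by omega
    rw [e1, hgP]
    conv_lhs => rw [show θ⁻¹ ^ n = θ⁻¹ ^ (k + 1) * θ⁻¹ ^ (n - 1 - k) by rw [← pow_add, ← e2]]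
    ring
  have hpow : ∀ k : ℕ, θ⁻¹ ^ (k + 1) * (c * γ ^ k) = (γ / θ) ^ (k + 1) * (c / γ) := fun k => by
    rw [div_pow, inv_pow, pow_succ γ]
    field_simp
  set K := (1 + c / γ * (1 + 2 * B)) * (WP x * N) with hK
  have hK0 : 0 ≤ K := by positivity
  have hcγ : 0 ≤ c / γ := by positivity
  have key := abs_add_sum_sub_tsum_le (r := γ / θ) (J := J) (K := K) hr0 hr1 hJ0 hK0
    hA.rate_zero hα (n := n) (u := θ⁻¹ ^ n * ((n : ℝ) ^ j x)⁻¹ * (∫ z : D₁, f z ∂(P n x)))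
    (U := ∫ z : D₁, f z ∂(Λ x))
    (v := fun k => θ⁻¹ ^ (k + 1) *
      (θ⁻¹ ^ (n - 1 - k) * ((n : ℝ) ^ j x)⁻¹ * ∫ z, g k z ∂(P (n - 1 - k) x)))
    (w := fun k => θ⁻¹ ^ (k + 1) * ∫ z, g k z ∂(Λ x)) ?_ ?_ ?_
  · rw [hS, integral_tailMeasure hθ hD₁ hD₂ hfintT]
    simp_rw [hgΛ]
    refine key.trans ?_
    rw [rateA1]
    have hsum : ∑ k ∈ Finset.range (n + 1), (γ / θ) ^ k * (α (n - k) + J * ((k : ℝ) / n)) ≤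
        ∑ k ∈ Finset.range (n + 1), (γ / θ) ^ k * ((1 + J) * α (n - k) + J * ((k : ℝ) / n)) := by
      refine Finset.sum_le_sum fun k _ => ?_
      gcongr
      nlinarith [hα (n - k)]
    have hpos : 0 ≤ ∑ k ∈ Finset.range (n + 1),
        (γ / θ) ^ k * ((1 + J) * α (n - k) + J * ((k : ℝ) / n)) :=
      Finset.sum_nonneg fun k _ => mul_nonneg (by positivity)
        (add_nonneg (mul_nonneg (by linarith) (hα _)) (by positivity))
    set T := ∑ k ∈ Finset.range (n + 1),
      (γ / θ) ^ k * ((1 + J) * α (n - k) + J * ((k : ℝ) / n))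
    have h1r : 0 < 1 - γ / θ := by linarith
    have h3 : 0 ≤ K * (3 + 1 / (1 - γ / θ)) := by positivity
    have h4 : 0 ≤ c * T * (WP x * N) := by positivity
    calc K * (3 + 1 / (1 - γ / θ)) * _ ≤ K * (3 + 1 / (1 - γ / θ)) * T :=
          mul_le_mul_of_nonneg_left hsum h3
      _ ≤ K * (3 + 1 / (1 - γ / θ)) * T + c * T * (WP x * N) := by linarith
      _ = _ := by rw [hK]; ring
  · have h1 := hA.estimate x n (fun z : D₁ => f z) N hn hf₁m hf₁
    refine h1.trans ?_
    have h2 : 0 ≤ (γ / θ) ^ n := by positivity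
    calc α n * WP x * N = (WP x * N) * α n := by ring
      _ ≤ K * α n := by
        refine mul_le_mul_of_nonneg_right ?_ (hα n)
        rw [hK]
        exact le_mul_of_one_le_left hw0 (le_add_of_nonneg_right (by positivity))
      _ ≤ _ := mul_le_mul_of_nonneg_left (by linarith) hK0
  · intro k hk
    have hlt : n - 1 - k < n := by omega
    have h1 := hA.scaled_estimate_self (h.P_zero x) hlt (hgm k) (hgN k)
    have e1 : (n : ℝ) - ((n - 1 - k : ℕ) : ℝ) = ((k + 1 : ℕ) : ℝ) := by
      rw [sub_eq_iff_eq_add, ← Nat.cast_add]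
      congr 1
      omega
    have e2 : n - 1 - k = n - (k + 1) := by omega
    rw [e1] at h1
    rw [← mul_sub, abs_mul, abs_of_nonneg (by positivity : 0 ≤ θ⁻¹ ^ (k + 1))]
    refine (mul_le_mul_of_nonneg_left h1 (by positivity)).trans ?_
    rw [e2]
    have h2 : α (n - (k + 1)) + j x * (((k + 1 : ℕ) : ℝ) / n) ≤
        α (n - (k + 1)) + J * (((k + 1 : ℕ) : ℝ) / n) := by
      gcongr
      exact hJ x
    have h3 : 0 ≤ α (n - (k + 1)) + J * (((k + 1 : ℕ) : ℝ) / n) :=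
      add_nonneg (hα _) (by positivity)
    set A := α (n - (k + 1)) + J * (((k + 1 : ℕ) : ℝ) / n)
    calc θ⁻¹ ^ (k + 1) * ((1 + 2 * B) * (α (n - (k + 1)) + j x * (((k + 1 : ℕ) : ℝ) / n)) *
          (WP x * (c * γ ^ k * N)))
        = (θ⁻¹ ^ (k + 1) * (c * γ ^ k)) * ((1 + 2 * B) * (WP x * N)) *
          (α (n - (k + 1)) + j x * (((k + 1 : ℕ) : ℝ) / n)) := by ring
      _ ≤ (θ⁻¹ ^ (k + 1) * (c * γ ^ k)) * ((1 + 2 * B) * (WP x * N)) * A := by gcongr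
      _ = (c / γ * (1 + 2 * B) * (WP x * N)) * ((γ / θ) ^ (k + 1) * A) := by rw [hpow]; ring
      _ ≤ K * ((γ / θ) ^ (k + 1) * A) := by
        refine mul_le_mul_of_nonneg_right ?_ (by positivity)
        rw [hK]
        linarith
      _ = _ := by ring
  · intro k
    have h1 := hA.abs_limit_le (x := x) (hgN k)
    rw [abs_mul, abs_of_nonneg (by positivity : 0 ≤ θ⁻¹ ^ (k + 1))]
    calc θ⁻¹ ^ (k + 1) * |∫ z, g k z ∂(Λ x)|
        ≤ θ⁻¹ ^ (k + 1) * (B * (WP x * (c * γ ^ k * N))) :=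
          mul_le_mul_of_nonneg_left h1 (by positivity)
      _ = (θ⁻¹ ^ (k + 1) * (c * γ ^ k)) * (B * (WP x * N)) := by ring
      _ = (c / γ * B * (WP x * N)) * (γ / θ) ^ (k + 1) := by rw [hpow]; ring
      _ ≤ K * (γ / θ) ^ (k + 1) := by
        refine mul_le_mul_of_nonneg_right ?_ (by positivity)
        rw [hK]
        have : 0 ≤ c / γ * B * (WP x * N) := by positivity
        have : 0 ≤ c / γ * (WP x * N) := by positivity
        linarith

/-- On `D₂` the limit is `0`, and the bound `c γⁿ` is absorbed by the term `k = n` of the rate,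
where `α 0 = 1`. -/
theorem first_estimate_right (h : IsTriangular S P Q R)
    (hD₂ : MeasurableSet D₂)
    (hD : IsCompl D₁ D₂) (hc : 0 < c) (hγ : 0 < γ) (hγθ : γ < θ)
    (hWR : ∀ y, 1 ≤ WR y) (hR : GeomBound R WR c γ) {C J : ℝ} (hJ : 0 ≤ J) (hC : c ≤ C)
    (hα0 : α 0 = 1) (hα : ∀ n, 0 ≤ α n) {y : D₂} {n : ℕ} {f : D → ℝ}
    {N : ℝ} (hN : 0 ≤ N) (hfN : ∀ z, |f z| ≤ N * (ext WP z + ext WR z)) :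
    |θ⁻¹ ^ n * (∫ z, f z ∂(S n y))| ≤ rateA1 C γ θ J α n * WR y * N := by
  have hθ : 0 < θ := hγ.trans hγθ
  have hWR0 : 0 ≤ WR y := zero_le_one.trans (hWR y)
  have hf₂ : ∀ z : D₂, |f z| ≤ N * WR z := fun z => by
    have := hfN z; rwa [ext_add_ext_right hD] at this
  rw [h.integral_right hD₂, abs_mul, abs_of_nonneg (by positivity : 0 ≤ θ⁻¹ ^ n)]
  have h1 := abs_integral_le_of_lintegral_le hN (by positivity) (Eventually.of_forall hf₂) (hR y n)
  have h2 : (γ / θ) ^ n ≤ ∑ k ∈ Finset.range (n + 1),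
      (γ / θ) ^ k * ((1 + J) * α (n - k) + J * ((k : ℝ) / n)) := by
    have hr0 : 0 < γ / θ := div_pos hγ hθ
    refine le_trans ?_ (Finset.single_le_sum (f := fun k : ℕ =>
      (γ / θ) ^ k * ((1 + J) * α (n - k) + J * ((k : ℝ) / n)))
      (fun k _ => mul_nonneg (by positivity)
        (add_nonneg (mul_nonneg (by linarith) (hα _)) (by positivity)))
      (Finset.mem_range.2 (Nat.lt_succ_self n)))
    rw [Nat.sub_self, hα0]
    refine le_mul_of_one_le_right (by positivity) ?_
    have : 0 ≤ J * ((n : ℝ) / n) := by positivity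
    linarith
  rw [rateA1]
  set T := ∑ k ∈ Finset.range (n + 1),
      (γ / θ) ^ k * ((1 + J) * α (n - k) + J * ((k : ℝ) / n))
  have hC0 : 0 ≤ C := hc.le.trans hC
  have hT0 : 0 ≤ T := le_trans (pow_nonneg (div_pos hγ hθ).le n) h2
  calc θ⁻¹ ^ n * |∫ z : D₂, f z ∂(R n y)| ≤ θ⁻¹ ^ n * (N * (c * γ ^ n * WR y)) :=
        mul_le_mul_of_nonneg_left h1 (by positivity)
    _ = c * (γ / θ) ^ n * (WR y * N) := by rw [div_pow, inv_pow]; field_simp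
    _ ≤ C * T * (WR y * N) := by gcongr
    _ = _ := by ring

/-- If `D₁` dominates, Assumption (A) passes from `P` to `S`. -/
theorem first_case {I : Type*} (h : IsTriangular S P Q R) (hD₁ : MeasurableSet D₁)
    (hD₂ : MeasurableSet D₂) (hD : IsCompl D₁ D₂) {ηP : I → D₁ → ℝ} {νP : I → Measure D₁}
    (hα0 : α 0 = 1) (H : AssumptionA1 P Q R WP ηP νP α WR γ c) :
    expParam₀ S = expParam₀ P ∧
    (∀ x, jAt S x = ext (jAt P) x) ∧
    ∃ (C : ℝ) (p : I → ℝ), 0 < C ∧ (∀ i, 0 < p i) ∧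
      AssumptionA S (fun x => ext WP x + ext WR x)
        (fun i x => p i * ext (ηP i) x)
        (fun i => ENNReal.ofReal (p i)⁻¹ • tailMeasure Q R (theta₀ S) (νP i))
        (rateA1 C γ (theta₀ P) (j₀ P) α) := by
  have HA := H.assumptionA
  obtain ⟨Λ, j, B, hΛ, hj, hA⟩ := HA.exists_convergesToKernel hα0
  set θ := theta₀ P with hθdef
  set J := j₀ P with hJdef
  have hγ := H.gamma_pos
  have hγθ : γ < θ := H.gamma_lt
  have hc := H.c_pos
  have hθ : 0 < θ := hγ.trans hγθ
  have hr0 : 0 < γ / θ := div_pos hγ hθ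
  have hr1 : γ / θ < 1 := (div_lt_one hθ).2 hγθ
  have hJ : ∀ x, (j x : ℝ) ≤ J := fun x => by
    rw [← hj]; exact le_ciSup H.finite_j x
  obtain ⟨x₀⟩ := HA.nonempty
  have hJ0 : 0 ≤ J := (j x₀).cast_nonneg.trans (hJ x₀)
  have hB := hA.bound_nonneg
  have hα := hA.rate_nonneg
  -- the last summand makes `C ≥ c`, which the points of `D₂` require
  set C := (1 + c / γ * (1 + 2 * B)) * (3 + 1 / (1 - γ / θ)) + c with hC
  have h1r : 0 < 1 - γ / θ := by linarith
  have hC0 : 0 < C := by positivity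
  have hcC : c ≤ C := by rw [hC]; exact le_add_of_nonneg_left (by positivity)
  have hW : ∀ z, 1 ≤ ext WP z + ext WR z := one_le_ext_add_ext hD hA.one_le_W H.one_le_WR
  have hrate : Tendsto (rateA1 C γ θ J α) atTop (𝓝 0) := tendsto_rateA1 hr0 hr1 HA.tendsto_rate
  have hleft := fun (x : D₁) (n : ℕ) (f : D → ℝ) (N : ℝ) (hn : 1 ≤ n) (hf : Measurable f)
    (hN : 0 ≤ N) (hfN : ∀ z, |f z| ≤ N * (ext WP z + ext WR z)) =>
    first_estimate_left h hA hD₁ hD₂ hD hc hγ hγθ H.measurable_WR H.one_le_WR H.jump H.geom hJ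
      (x := x) hn hf hN hfN
  have hright := fun (y : D₂) (n : ℕ) (f : D → ℝ) (N : ℝ) (hN : 0 ≤ N)
    (hfN : ∀ z, |f z| ≤ N * (ext WP z + ext WR z)) =>
    first_estimate_right (S := S) (θ := θ) h hD₂ hD hc hγ hγθ H.one_le_WR H.geom hJ0 hcC hα0 hα
      (y := y) (n := n) hN hfN
  have hone : ∀ z : D, |(1 : ℝ)| ≤ 1 * (ext WP z + ext WR z) := fun z => by
    rw [abs_one, one_mul]; exact hW z
  have hbl : ∀ x : D₁, ∃ C : ℝ, ∀ n : ℕ, 1 ≤ n →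
      S n x Set.univ ≤ ENNReal.ofReal (C * (n : ℝ) ^ j x * θ ^ n) := fun x => by
    refine exists_mass_bound (r := fun n => rateA1 C γ θ J α n * WP x * 1) hθ
      (fun n => h.finite n x) ?_ fun n hn =>
      hleft x n (fun _ => 1) 1 hn measurable_const zero_le_one hone
    have := (hrate.mul_const (WP x)).mul_const 1
    simpa using this
  have hbr : ∀ y : D₂, ∃ C : ℝ, ∀ n : ℕ, 1 ≤ n →
      S n y Set.univ ≤ ENNReal.ofReal (C * (n : ℝ) ^ 0 * θ ^ n) := fun y => by
    refine exists_mass_bound (r := fun n => rateA1 C γ θ J α n * WR y * 1) (L := 0) hθ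
      (fun n => h.finite n y) ?_ fun n hn => ?_
    · have := (hrate.mul_const (WR y)).mul_const 1
      simpa using this
    · have := hright y n (fun _ => 1) 1 zero_le_one hone
      simpa using this
  have hexpP : expParam₀ P = ENNReal.ofReal θ := HA.expParam₀_eq
  have hexp : expParam₀ S = ENNReal.ofReal θ := by
    refine expParam₀_eq_of_bounds hθ (hexpP ▸ h.expParam₀_le_left)
      (forall_of_isCompl hD (fun x => ?_) (fun y => ?_))
    · obtain ⟨C, hC⟩ := hbl x
      exact ⟨_, C, hC⟩
    · obtain ⟨C, hC⟩ := hbr y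
      exact ⟨0, C, hC⟩
  have hθS : theta₀ S = θ := by rw [theta₀, hexp, ENNReal.toReal_ofReal hθ.le]
  -- `S` dominates `P` on `D₁`, so that `j_S` cannot be smaller than `j_P`
  have hjl : ∀ x : D₁, jAt S x = j x := fun x => by
    obtain ⟨C, hC⟩ := hbl x
    have hC' : ∀ n : ℕ, 1 ≤ n → ((Measure.dirac (x : D)).bind (S n)) Set.univ ≤
        ENNReal.ofReal (C * (n : ℝ) ^ j x * θ ^ n) := fun n hn => by
      rw [dirac_bind_kernel]; exact hC n hn
    refine le_antisymm (polyParam_le_of_bound hθ hexp hC')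
      (le_polyParam hθ hexp hC' fun ℓ h0 hℓ hlim => ?_)
    rw [← hj] at hℓ
    refine liminf_scaledMass_ne_zero h0 hℓ ?_
    rw [hexpP, ← hexp]
    refine liminf_eq_zero_of_le (Eventually.of_forall fun n => ?_) hlim
    refine scaledMass_mono ?_
    rw [dirac_bind_kernel, dirac_bind_kernel]
    exact h.le_left n x
  have hjr : ∀ y : D₂, jAt S y = (0 : ℕ) := fun y => by
    obtain ⟨C, hC⟩ := hbr y
    refine le_antisymm (polyParam_le_of_bound hθ hexp (C := C) fun n hn => ?_) ?_
    · rw [dirac_bind_kernel]; exact hC n hn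
    · rw [Nat.cast_zero]; exact polyParam_nonneg _ _
  refine ⟨hexp.trans hexpP.symm, forall_of_isCompl hD (fun x => ?_) (fun y => ?_), ?_⟩
  · rw [hjl, ext_coe, hj]
  · rw [hjr, ext_of_notMem _ (Set.disjoint_right.1 hD.disjoint y.2), Nat.cast_zero]
  have := HA.prob
  have hWP0 : ∀ z, 0 ≤ WP z := fun z => (hA.W_pos z).le
  have hd : 0 < (θ - γ)⁻¹ := inv_pos.2 (sub_pos.2 hγθ)
  have hν : ∀ i, ∫⁻ z, ENNReal.ofReal (ext WP z + ext WR z) ∂(tailMeasure Q R θ (νP i)) ≤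
      ENNReal.ofReal ((1 + c * (θ - γ)⁻¹) * ∫ z, WP z ∂(νP i)) := fun i =>
    lintegral_tailMeasure_le hD₁ hD₂ hD hc hγ hγθ H.measurable_WR H.jump H.geom
      (integral_nonneg hWP0) (ofReal_integral_eq_lintegral_ofReal (HA.integrable_W i)
        (Eventually.of_forall hWP0)).ge
  have hmass : ∀ i, tailMeasure Q R θ (νP i) Set.univ ≠ ⊤ := fun i => by
    refine ne_top_of_le_ne_top ENNReal.ofReal_ne_top (le_trans ?_ (hν i))
    rw [← lintegral_one (μ := tailMeasure Q R θ (νP i))]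
    exact lintegral_mono fun z => ENNReal.one_le_ofReal.2 (hW z)
  have hmass1 : ∀ i, 1 ≤ tailMeasure Q R θ (νP i) Set.univ := fun i => by
    rw [tailMeasure, Measure.add_apply, Measure.map_apply measurable_subtype_coe MeasurableSet.univ,
      Set.preimage_univ, measure_univ]
    exact le_self_add
  -- `p i` is the mass which normalises `ν_{S,i}`
  set p : I → ℝ := fun i => (tailMeasure Q R θ (νP i) Set.univ).toReal with hp
  have hp0 : ∀ i, 0 < p i := fun i =>
    ENNReal.toReal_pos (zero_lt_one.trans_le (hmass1 i)).ne' (hmass i)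
  refine ⟨C, p, hC0, hp0, ?_⟩
  rw [hθS]
  have hηS : ∀ i x, 0 ≤ p i * ext (ηP i) x := fun i => forall_of_isCompl hD
    (fun x => by rw [ext_coe]; exact mul_nonneg (hp0 i).le (HA.eta_nonneg i x))
    (fun y => by rw [ext_of_notMem _ (Set.disjoint_right.1 hD.disjoint y.2), mul_zero])
  have hliml : ∀ x : D₁, limitMeasure (fun i x => p i * ext (ηP i) x)
      (fun i => ENNReal.ofReal (p i)⁻¹ • tailMeasure Q R θ (νP i)) x =
        tailMeasure Q R θ (Λ x) := fun x => by
    rw [hΛ, ← sum_smul_tailMeasure, limitMeasure]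
    congr 1
    funext i
    rw [smul_smul, ← ENNReal.ofReal_mul (hηS i x), ext_coe]
    congr 2
    have := (hp0 i).ne'
    field_simp
  have hlimr : ∀ y : D₂, limitMeasure (fun i x => p i * ext (ηP i) x)
      (fun i => ENNReal.ofReal (p i)⁻¹ • tailMeasure Q R θ (νP i)) y = 0 := fun y => by
    simp [limitMeasure, ext_of_notMem _ (Set.disjoint_right.1 hD.disjoint y.2)]
  have hboundl : ∀ x : D₁, ∫⁻ z, ENNReal.ofReal (ext WP z + ext WR z)
      ∂(tailMeasure Q R θ (Λ x)) ≤ ENNReal.ofReal ((1 + c * (θ - γ)⁻¹) * (B * WP x)) := fun x =>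
    lintegral_tailMeasure_le hD₁ hD₂ hD hc hγ hγθ H.measurable_WR H.jump H.geom
      (mul_nonneg hB (hWP0 x)) (hA.lintegral_limit_le x)
  have hWm : Measurable fun z => ext WP z + ext WR z :=
    (measurable_ext hD₁ hA.measurable_W).add (measurable_ext hD₂ H.measurable_WR)
  refine assumptionA_of_limitMeasure (B := (1 + c * (θ - γ)⁻¹) * B) hexp hθ HA.theta₀_le_one
    (forall_of_isCompl hD (fun x => ⟨_, hjl x⟩) (fun y => ⟨_, hjr y⟩)) hWm hW HA.countable
    (fun i => ⟨?_⟩) (fun i => (measurable_ext hD₁ (HA.mem_eta i).1).const_mul _) hηS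
    (fun i => ?_) (forall_of_isCompl hD (fun x => ?_) (fun y => ?_))
    (fun n => forall_of_isCompl hD (fun x => ?_) (fun y => ?_)) hrate
    (forall_of_isCompl hD (fun x => ?_) (fun y => ?_))
  · rw [Measure.smul_apply, smul_eq_mul, ENNReal.ofReal_inv_of_pos (hp0 i),
      ENNReal.ofReal_toReal (hmass i)]
    exact ENNReal.inv_mul_cancel (zero_lt_one.trans_le (hmass1 i)).ne' (hmass i)
  · obtain ⟨x, hx⟩ := HA.eta_ne_zero i
    exact ⟨x, by rw [ext_coe]; exact mul_ne_zero (hp0 i).ne' hx⟩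
  · rw [hliml, ext_add_ext_left hD, mul_assoc]
    exact hboundl x
  · rw [hlimr, lintegral_zero_measure]
    exact bot_le
  · have hWm₂ : ∀ z : D₂, |ext WP (z : D) + ext WR (z : D)| ≤ 1 * WR z := fun z => by
      rw [ext_add_ext_right hD, one_mul, abs_of_nonneg (zero_le_one.trans (H.one_le_WR z))]
    refine h.integrable_left hD₁ hD₂ ?_ fun k _ => integrable_block_sum hA hc hγ
      H.measurable_WR H.jump H.geom (hWm.comp measurable_subtype_coe) zero_le_one hWm₂ x k _
    simp_rw [ext_add_ext_left hD]
    exact hA.integrable_W n x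
  · refine h.integrable_right hD₂ ?_
    simp_rw [ext_add_ext_right hD]
    refine integrable_of_lintegral_le H.measurable_WR zero_le_one (fun z => ?_) (H.geom y n)
    rw [one_mul, abs_of_nonneg (zero_le_one.trans (H.one_le_WR z))]
  · refine convergesAt_of_limitMeasure hW (fun i => hηS i x) ((hliml x).symm ▸ hboundl x) (hjl x)
      fun n f N hn hf hN hfN => ?_
    rw [hθS, hliml, ext_add_ext_left hD]
    exact hleft x n f N hn hf hN hfN
  · refine convergesAt_of_limitMeasure (b := 0) hW (fun i => hηS i y) ?_ (hjr y)
      fun n f N hn hf hN hfN => ?_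
    · rw [hlimr, lintegral_zero_measure]
      exact bot_le
    · rw [hθS, hlimr, ext_add_ext_right hD, integral_zero_measure, sub_zero, pow_zero, inv_one,
        mul_one]
      exact hright y n f N hN hfN

end First

/-! ### The second block dominates -/

section Second

variable {D : Type*} [MeasurableSpace D] {D₁ D₂ : Set D}

namespace ConvergesToKernel

variable {E : Type*} [MeasurableSpace E] {S : ℕ → Kernel E E} {W : E → ℝ} {Λ : Kernel E E}
  {j : E → ℕ} {a : ℕ → ℝ} {θ B : ℝ}

theorem integral_abs_bound (h : ConvergesToKernel S W Λ j a θ B) {x : E} {n : ℕ} {f : E → ℝ}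
    {N : ℝ} (hn : 1 ≤ n) (hf : Measurable f) (hfN : ∀ y, |f y| ≤ N * W y) :
    |∫ y, f y ∂(S n x)| ≤ (a n + B) * (n : ℝ) ^ j x * θ ^ n * (W x * N) := by
  have hn' : (0 : ℝ) < n := by exact_mod_cast hn
  have hθ := h.theta_pos
  have h1 := h.estimate x n f N hn hf hfN
  have h2 := h.abs_limit_le (x := x) hfN
  set L := ∫ y, f y ∂(Λ x)
  set M := ∫ y, f y ∂(S n x)
  have h3 : |θ⁻¹ ^ n * ((n : ℝ) ^ j x)⁻¹ * M| ≤ (a n + B) * (W x * N) := by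
    have := abs_sub_abs_le_abs_sub (θ⁻¹ ^ n * ((n : ℝ) ^ j x)⁻¹ * M) L
    linarith
  have e : M = (n : ℝ) ^ j x * θ ^ n * (θ⁻¹ ^ n * ((n : ℝ) ^ j x)⁻¹ * M) := by
    rw [inv_pow]; field_simp
  rw [e, abs_mul, abs_of_nonneg (by positivity : 0 ≤ (n : ℝ) ^ j x * θ ^ n)]
  calc (n : ℝ) ^ j x * θ ^ n * |θ⁻¹ ^ n * ((n : ℝ) ^ j x)⁻¹ * M|
      ≤ (n : ℝ) ^ j x * θ ^ n * ((a n + B) * (W x * N)) :=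
        mul_le_mul_of_nonneg_left h3 (by positivity)
    _ = _ := by ring

theorem exists_lintegral_le (h : ConvergesToKernel S W Λ j a θ B)
    (h0 : ∀ x, S 0 x = Measure.dirac x) {J : ℕ} (hJ : ∀ x, j x ≤ J) (n : ℕ) :
    ∃ M : ℝ, 0 ≤ M ∧ ∀ x, ∫⁻ y, ENNReal.ofReal (W y) ∂(S n x) ≤ ENNReal.ofReal (M * W x) := by
  rcases Nat.eq_zero_or_pos n with rfl | hn
  · refine ⟨1, zero_le_one, fun x => ?_⟩
    rw [h0, lintegral_dirac' _ h.measurable_W.ennreal_ofReal, one_mul]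
  · have hn1 : (1 : ℝ) ≤ n := by exact_mod_cast hn
    have ha := h.rate_nonneg n
    have hB := h.bound_nonneg
    have hθ := h.theta_pos
    refine ⟨(a n + B) * (n : ℝ) ^ J * θ ^ n, by positivity, fun x => ?_⟩
    rw [h.lintegral_eq_ofReal_integral]
    refine ENNReal.ofReal_le_ofReal ((le_abs_self _).trans
      ((h.integral_abs_bound (N := 1) hn h.measurable_W fun y => ?_).trans ?_))
    · rw [one_mul, abs_of_pos (h.W_pos y)]
    · rw [mul_one]
      have := (h.W_pos x).le
      gcongr
      exact hJ x

theorem mass_le (h : ConvergesToKernel S W Λ j a θ B) (hfin : ∀ n x, IsFiniteMeasure (S n x))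
    {M : ℝ} (hM : ∀ n, a n ≤ M) {ℓ n : ℕ} {x : E} (hj : j x ≤ ℓ) (hn : 1 ≤ n) :
    S n x Set.univ ≤ ENNReal.ofReal ((M + B) * (n : ℝ) ^ ℓ * θ ^ n * W x) := by
  have := hfin n x
  have hn1 : (1 : ℝ) ≤ n := by exact_mod_cast hn
  have ha := h.rate_nonneg n
  have hB := h.bound_nonneg
  have hθ := h.theta_pos
  have hW := (h.W_pos x).le
  have h1 := h.integral_abs_bound (x := x) (f := fun _ => 1) (N := 1) hn measurable_const
    (fun y => by rw [abs_one, one_mul]; exact h.one_le_W y)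
  rw [integral_const, smul_eq_mul, mul_one, mul_one, abs_of_nonneg measureReal_nonneg] at h1
  rw [← ENNReal.ofReal_toReal (measure_ne_top (S n x) Set.univ)]
  refine ENNReal.ofReal_le_ofReal (h1.trans ?_)
  have := hM n
  have : 0 ≤ M + B := by linarith
  gcongr

theorem measurable_j (h : ConvergesToKernel S W Λ j a θ B)
    (hfin : ∀ n x, IsFiniteMeasure (S n x)) (hS : expParam₀ S = ENNReal.ofReal θ)
    (hj : ∀ x, jAt S x = j x) (ha : Tendsto a atTop (𝓝 0)) : Measurable j := by
  refine measurable_jAt h.theta_pos hS hj fun x => ?_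
  refine exists_mass_bound (L := ∫ _, (1 : ℝ) ∂(Λ x)) (r := fun n => a n * W x * 1) h.theta_pos
    (fun n => hfin n x) ?_ fun n hn => h.estimate x n (fun _ => 1) 1 hn measurable_const fun y => ?_
  · have := (ha.mul_const (W x)).mul_const 1
    simpa using this
  · rw [abs_one, one_mul]; exact h.one_le_W y

end ConvergesToKernel

theorem exists_le_of_tendsto {a : ℕ → ℝ} (ha : Tendsto a atTop (𝓝 0)) : ∃ M, ∀ n, a n ≤ M := by
  obtain ⟨M, hM⟩ := (Metric.isBounded_range_of_tendsto a ha).exists_norm_le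
  exact ⟨M, fun n => (le_abs_self _).trans (hM _ ⟨n, rfl⟩)⟩

theorem limitMeasure_map_right {I : Type*} {η : I → D → ℝ} {ηR : I → D₂ → ℝ}
    (ν : I → Measure D₂) {y : D₂} (h : ∀ i, η i y = ηR i y) :
    limitMeasure η (fun i => (ν i).map Subtype.val) (y : D) =
      (limitMeasure ηR ν y).map Subtype.val := by
  ext A hA
  rw [Measure.map_apply measurable_subtype_coe hA, limitMeasure, limitMeasure,
    Measure.sum_apply _ hA, Measure.sum_apply _ (measurable_subtype_coe hA)]
  simp [h, Measure.map_apply measurable_subtype_coe hA]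

variable {WP : D₁ → ℝ} {WR : D₂ → ℝ} {γ c : ℝ} {S : ℕ → Kernel D D} {P : ℕ → Kernel D₁ D₁}
  {Q : Kernel D₁ D₂} {R : ℕ → Kernel D₂ D₂} {Λ : Kernel D₂ D₂} {j : D₂ → ℕ} {α : ℕ → ℝ} {θ B : ℝ}

theorem IsTriangular.finite_R (h : IsTriangular S P Q R) (n : ℕ) (y : D₂) :
    IsFiniteMeasure (R n y) := by
  have := h.finite n y
  refine ⟨?_⟩
  rw [← h.right_univ]
  exact measure_lt_top _ _

/-- On `D₂` the semigroups `S` and `R` agree, and so do their limits. -/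
theorem estimate_right (h : IsTriangular S P Q R) (hA : ConvergesToKernel R WR Λ j α θ B)
    (hD₂ : MeasurableSet D₂) (hD : IsCompl D₁ D₂) {y : D₂} {n : ℕ} {f : D → ℝ} {N : ℝ}
    (hn : 1 ≤ n) (hf : Measurable f) (hfN : ∀ z, |f z| ≤ N * (ext WP z + ext WR z)) :
    |θ⁻¹ ^ n * ((n : ℝ) ^ j y)⁻¹ * (∫ z, f z ∂(S n y)) -
        ∫ z, f z ∂((Λ y).map Subtype.val)| ≤ α n * WR y * N := by
  rw [h.integral_right hD₂, (MeasurableEmbedding.subtype_coe hD₂).integral_map]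
  refine hA.estimate y n (fun z : D₂ => f z) N hn (hf.comp measurable_subtype_coe) fun z => ?_
  have := hfN z
  rwa [ext_add_ext_right hD] at this

/-- The measure `∑_{k ≥ 0} θ^{-k-1} (P_k Q Λ)(x, ·)` on `D`. -/
noncomputable def entranceMeasure (P : ℕ → Kernel D₁ D₁) (Q : Kernel D₁ D₂) (Λ : Kernel D₂ D₂)
    (θ : ℝ) (x : D₁) : Measure D :=
  Measure.sum fun k : ℕ =>
    ENNReal.ofReal (θ⁻¹ ^ (k + 1)) • (((P k x).bind Q).bind Λ).map Subtype.val

theorem lintegral_entranceMeasure_le (hD₂ : MeasurableSet D₂) (hD : IsCompl D₁ D₂)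
    (hc : 0 < c) (hγ : 0 < γ) (hγθ : γ < θ) (hWR : Measurable WR) (hWP : ∀ x, 1 ≤ WP x)
    (hQ : JumpBound Q WP WR) (hP : GeomBound P WP c γ) (hB : 0 ≤ B)
    (hΛ : ∀ y, ∫⁻ z, ENNReal.ofReal (WR z) ∂(Λ y) ≤ ENNReal.ofReal (B * WR y)) (x : D₁) :
    ∫⁻ z, ENNReal.ofReal (ext WP z + ext WR z) ∂(entranceMeasure P Q Λ θ x) ≤
      ENNReal.ofReal (B * c * (θ - γ)⁻¹ * WP x) := by
  have hWP0 : 0 ≤ WP x := zero_le_one.trans (hWP x)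
  have hθ : 0 < θ := hγ.trans hγθ
  have e : B * c * (θ - γ)⁻¹ * WP x = (B * c * WP x) * (θ - γ)⁻¹ := by ring
  rw [e, entranceMeasure]
  refine lintegral_sum_smul_le (b := fun k => B * c * WP x * γ ^ k)
    (fun k => by positivity) (fun k => by positivity) (fun k => ?_)
    (hasSum_geometric_shift hγ hγθ (B * c * WP x))
  rw [lintegral_map_val_right hD₂ hD]
  refine (lintegral_bind_ofReal_le hB hWR hΛ (lintegral_bind_jump_le hWR hQ (hP x k))).trans
    (le_of_eq ?_)
  congr 1
  ring

/-- The decomposition `S_n f(x) = P_n f(x) + ∑_{k<n} P_k Q R_{n-1-k} f(x)`, where only the starting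
points `y` of `R` with `j y = ℓ` contribute at the order `n^ℓ`. -/
theorem second_estimate_left (h : IsTriangular S P Q R)
    (hA : ConvergesToKernel R WR Λ j α θ B) (hjm : Measurable j) (hD₁ : MeasurableSet D₁)
    (hD₂ : MeasurableSet D₂) (hD : IsCompl D₁ D₂) (hc : 0 < c) (hγ : 0 < γ) (hγθ : γ < θ)
    (hWP : ∀ y, 1 ≤ WP y) (hQ : JumpBound Q WP WR) (hP : GeomBound P WP c γ) {J : ℝ}
    (hJ : ∀ y, (j y : ℝ) ≤ J) {x : D₁} {ℓ : ℕ} (hℓJ : (ℓ : ℝ) ≤ J)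
    (hℓ : ∀ k, ∀ᵐ y ∂((P k x).bind Q), j y ≤ ℓ) {n : ℕ} {f : D → ℝ}
    {N : ℝ} (hn : 1 ≤ n) (hf : Measurable f) (hN : 0 ≤ N)
    (hfN : ∀ z, |f z| ≤ N * (ext WP z + ext WR z)) :
    |θ⁻¹ ^ n * ((n : ℝ) ^ ℓ)⁻¹ * (∫ z, f z ∂(S n x)) -
        ∫ z, f z ∂(entranceMeasure P Q (levelKernel Λ j hjm ℓ) θ x)| ≤
      rateA2 ((c + c / γ * (1 + 2 * B)) * (3 + 1 / (1 - γ / θ)) + 1) γ θ J α n * WP x * N := by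
  have hθ : 0 < θ := hγ.trans hγθ
  have hr0 : 0 < γ / θ := div_pos hγ hθ
  have hr1 : γ / θ < 1 := (div_lt_one hθ).2 hγθ
  have hn' : (0 : ℝ) < n := by exact_mod_cast hn
  have hB := hA.bound_nonneg
  have hJ0 : 0 ≤ J := ℓ.cast_nonneg.trans hℓJ
  have hWP0 : 0 ≤ WP x := zero_le_one.trans (hWP x)
  have hw0 : 0 ≤ WP x * N := mul_nonneg hWP0 hN
  have hα := hA.rate_nonneg
  have hWRm := hA.measurable_W
  have hf₁m : Measurable fun z : D₁ => f z := hf.comp measurable_subtype_coe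
  have hf₂m : Measurable fun z : D₂ => f z := hf.comp measurable_subtype_coe
  have hf₁ : ∀ z : D₁, |f z| ≤ N * WP z := fun z => by
    have := hfN z; rwa [ext_add_ext_left hD] at this
  have hf₂ : ∀ z : D₂, |f z| ≤ N * WR z := fun z => by
    have := hfN z; rwa [ext_add_ext_right hD] at this
  set Λℓ := levelKernel Λ j hjm ℓ with hΛℓ
  have hΛℓB : ∀ y, ∫⁻ z, ENNReal.ofReal (WR z) ∂(Λℓ y) ≤ ENNReal.ofReal (B * WR y) := fun y =>
    (lintegral_levelKernel_le hjm ℓ y _).trans (hA.lintegral_limit_le y)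
  have hμ : ∀ k, ∫⁻ y, ENNReal.ofReal (WR y) ∂((P k x).bind Q) ≤
      ENNReal.ofReal (c * γ ^ k * WP x) := fun k => lintegral_bind_jump_le hWRm hQ (hP x k)
  have hJ' : ∀ y, j y ≤ ⌈J⌉₊ := fun y => by exact_mod_cast (hJ y).trans (Nat.le_ceil J)
  have hfint₁ : Integrable (fun z : D₁ => f z) (P n x) :=
    integrable_of_lintegral_le hf₁m hN hf₁ (hP x n)
  have hfint₂ : ∀ k m, Integrable (fun z : D₂ => f z) (((P k x).bind Q).bind (R m)) :=
    fun k m => by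
      obtain ⟨M, hM0, hM⟩ := hA.exists_lintegral_le h.R_zero hJ' m
      exact integrable_of_lintegral_le hf₂m hN hf₂ (lintegral_bind_ofReal_le hM0 hWRm hM (hμ k))
  have hfintΛ : ∀ k, Integrable (fun z : D₂ => f z) (((P k x).bind Q).bind Λℓ) := fun k =>
    integrable_of_lintegral_le hf₂m hN hf₂ (lintegral_bind_ofReal_le hB hWRm hΛℓB (hμ k))
  have hfintT : Integrable f (entranceMeasure P Q Λℓ θ x) :=
    integrable_of_lintegral_le hf hN hfN (lintegral_entranceMeasure_le hD₂ hD hc hγ hγθ hWRm hWP hQ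
      hP hB hΛℓB x)
  have hT : ∫ z, f z ∂(entranceMeasure P Q Λℓ θ x) =
      0 + ∑' k : ℕ, θ⁻¹ ^ (k + 1) * ∫ z : D₂, f z ∂(((P k x).bind Q).bind Λℓ) := by
    rw [entranceMeasure] at hfintT ⊢
    rw [zero_add, ← (hasSum_integral_sum_smul (fun k => by positivity) hfintT).tsum_eq]
    simp_rw [(MeasurableEmbedding.subtype_coe hD₂).integral_map]
  have hS : θ⁻¹ ^ n * ((n : ℝ) ^ ℓ)⁻¹ * (∫ z, f z ∂(S n x)) =
      θ⁻¹ ^ n * ((n : ℝ) ^ ℓ)⁻¹ * (∫ z : D₁, f z ∂(P n x)) + ∑ k ∈ Finset.range n,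
        θ⁻¹ ^ (k + 1) * (θ⁻¹ ^ (n - 1 - k) * ((n : ℝ) ^ ℓ)⁻¹ *
          ∫ z : D₂, f z ∂(((P k x).bind Q).bind (R (n - 1 - k)))) := by
    rw [h.integral_left hD₁ hD₂ hfint₁ (fun k _ => hfint₂ k _), mul_add, Finset.mul_sum]
    congr 1
    refine Finset.sum_congr rfl fun k hk => ?_
    have hk' := Finset.mem_range.1 hk
    have e2 : n = (k + 1) + (n - 1 - k) := by omega
    conv_lhs => rw [show θ⁻¹ ^ n = θ⁻¹ ^ (k + 1) * θ⁻¹ ^ (n - 1 - k) by rw [← pow_add, ← e2]]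
    ring
  have hpow : ∀ k : ℕ, θ⁻¹ ^ (k + 1) * (c * γ ^ k) = (γ / θ) ^ (k + 1) * (c / γ) := fun k => by
    rw [div_pow, inv_pow, pow_succ γ]
    field_simp
  set K := (c + c / γ * (1 + 2 * B)) * (WP x * N) with hK
  have hcγ : 0 ≤ c / γ := by positivity
  have hK0 : 0 ≤ K := by positivity
  have key := abs_add_sum_sub_tsum_le (r := γ / θ) (J := J) (K := K) hr0 hr1 hJ0 hK0
    hA.rate_zero hα (n := n) (u := θ⁻¹ ^ n * ((n : ℝ) ^ ℓ)⁻¹ * (∫ z : D₁, f z ∂(P n x)))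
    (U := 0)
    (v := fun k => θ⁻¹ ^ (k + 1) * (θ⁻¹ ^ (n - 1 - k) * ((n : ℝ) ^ ℓ)⁻¹ *
          ∫ z : D₂, f z ∂(((P k x).bind Q).bind (R (n - 1 - k)))))
    (w := fun k => θ⁻¹ ^ (k + 1) * ∫ z : D₂, f z ∂(((P k x).bind Q).bind Λℓ)) ?_ ?_ ?_
  · rw [hS, hT]
    refine key.trans ?_
    have e : rateA2 ((c + c / γ * (1 + 2 * B)) * (3 + 1 / (1 - γ / θ)) + 1) γ θ J α n =
        ((c + c / γ * (1 + 2 * B)) * (3 + 1 / (1 - γ / θ)) + 1) * ∑ k ∈ Finset.range (n + 1),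
          (γ / θ) ^ k * (α (n - k) + J * ((k : ℝ) / n)) := by
      rw [rateA2]
      congr 1
      exact Finset.sum_congr rfl fun k _ => mul_comm _ _
    rw [e]
    have hpos : 0 ≤ ∑ k ∈ Finset.range (n + 1), (γ / θ) ^ k * (α (n - k) + J * ((k : ℝ) / n)) :=
      Finset.sum_nonneg fun k _ => mul_nonneg (by positivity)
        (add_nonneg (hα _) (by positivity))
    set T := ∑ k ∈ Finset.range (n + 1), (γ / θ) ^ k * (α (n - k) + J * ((k : ℝ) / n))
    have h4 : 0 ≤ T * (WP x * N) := by positivity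
    calc K * (3 + 1 / (1 - γ / θ)) * T ≤ K * (3 + 1 / (1 - γ / θ)) * T + T * (WP x * N) := by
          linarith
      _ = _ := by rw [hK]; ring
  · have h1 := abs_integral_le_of_lintegral_le hN (by positivity) (Eventually.of_forall hf₁)
      (hP x n)
    have h2 : ((n : ℝ) ^ ℓ)⁻¹ ≤ 1 := inv_le_one_of_one_le₀ (one_le_pow₀ (by exact_mod_cast hn))
    rw [sub_zero, abs_mul, abs_of_nonneg (by positivity : 0 ≤ θ⁻¹ ^ n * ((n : ℝ) ^ ℓ)⁻¹)]
    calc θ⁻¹ ^ n * ((n : ℝ) ^ ℓ)⁻¹ * |∫ z : D₁, f z ∂(P n x)|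
        ≤ θ⁻¹ ^ n * 1 * (N * (c * γ ^ n * WP x)) := by gcongr
      _ = c * (WP x * N) * (γ / θ) ^ n := by rw [div_pow, inv_pow]; field_simp
      _ ≤ K * (γ / θ) ^ n := by
        refine mul_le_mul_of_nonneg_right ?_ (by positivity)
        rw [hK]
        exact mul_le_mul_of_nonneg_right (le_add_of_nonneg_right (by positivity)) hw0
      _ ≤ _ := mul_le_mul_of_nonneg_left (by linarith [hα n]) hK0
  · intro k hk
    have hlt : n - 1 - k < n := by omega
    have e1 : (n : ℝ) - ((n - 1 - k : ℕ) : ℝ) = ((k + 1 : ℕ) : ℝ) := by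
      rw [sub_eq_iff_eq_add, ← Nat.cast_add]
      congr 1
      omega
    have e2 : n - 1 - k = n - (k + 1) := by omega
    have hαm := hα (n - 1 - k)
    have hmix := abs_integral_bind_sub_le (μ := (P k x).bind Q) (κ := R (n - 1 - k)) (lam := Λℓ)
      (f := fun z : D₂ => f z) (W := WR) (c := θ⁻¹ ^ (n - 1 - k) * ((n : ℝ) ^ ℓ)⁻¹) (c' := 1)
      (ε := (1 + 2 * B) * (α (n - 1 - k) + ℓ * (((k + 1 : ℕ) : ℝ) / n)) * N)
      (by positivity) (by positivity) (hμ k) (hfint₂ k _) (hfintΛ k) (by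
        filter_upwards [hℓ k] with y hy
        have h1 := hA.scaled_estimate_of_lt (h.R_zero y) hlt hy hf₂m hf₂
        rw [e1] at h1
        rw [one_mul, integral_levelKernel]
        refine h1.trans (le_of_eq ?_)
        ring)
    rw [one_mul] at hmix
    rw [← mul_sub, abs_mul, abs_of_nonneg (by positivity : 0 ≤ θ⁻¹ ^ (k + 1))]
    refine (mul_le_mul_of_nonneg_left hmix (by positivity)).trans ?_
    rw [e2] at hαm ⊢
    have h2 : α (n - (k + 1)) + ℓ * (((k + 1 : ℕ) : ℝ) / n) ≤
        α (n - (k + 1)) + J * (((k + 1 : ℕ) : ℝ) / n) := by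
      gcongr
    have h3 : 0 ≤ α (n - (k + 1)) + J * (((k + 1 : ℕ) : ℝ) / n) :=
      add_nonneg (hα _) (by positivity)
    set A := α (n - (k + 1)) + J * (((k + 1 : ℕ) : ℝ) / n)
    calc θ⁻¹ ^ (k + 1) * ((1 + 2 * B) * (α (n - (k + 1)) + ℓ * (((k + 1 : ℕ) : ℝ) / n)) * N *
          (c * γ ^ k * WP x))
        = (θ⁻¹ ^ (k + 1) * (c * γ ^ k)) * ((1 + 2 * B) * (WP x * N)) *
          (α (n - (k + 1)) + ℓ * (((k + 1 : ℕ) : ℝ) / n)) := by ring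
      _ ≤ (θ⁻¹ ^ (k + 1) * (c * γ ^ k)) * ((1 + 2 * B) * (WP x * N)) * A := by gcongr
      _ = (c / γ * (1 + 2 * B) * (WP x * N)) * ((γ / θ) ^ (k + 1) * A) := by rw [hpow]; ring
      _ ≤ K * ((γ / θ) ^ (k + 1) * A) := by
        refine mul_le_mul_of_nonneg_right ?_ (by positivity)
        rw [hK]
        have : 0 ≤ c * (WP x * N) := by positivity
        linarith
      _ = _ := by ring
  · intro k
    have hb := lintegral_bind_ofReal_le hB hWRm hΛℓB (hμ k)
    have h1 := abs_integral_le_of_lintegral_le hN (by positivity) (Eventually.of_forall hf₂) hb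
    rw [abs_mul, abs_of_nonneg (by positivity : 0 ≤ θ⁻¹ ^ (k + 1))]
    calc θ⁻¹ ^ (k + 1) * |∫ z : D₂, f z ∂(((P k x).bind Q).bind Λℓ)|
        ≤ θ⁻¹ ^ (k + 1) * (N * (B * (c * γ ^ k * WP x))) :=
          mul_le_mul_of_nonneg_left h1 (by positivity)
      _ = (θ⁻¹ ^ (k + 1) * (c * γ ^ k)) * (B * (WP x * N)) := by ring
      _ = (c / γ * B * (WP x * N)) * (γ / θ) ^ (k + 1) := by rw [hpow]; ring
      _ ≤ K * (γ / θ) ^ (k + 1) := by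
        refine mul_le_mul_of_nonneg_right ?_ (by positivity)
        rw [hK]
        have : 0 ≤ c / γ * B * (WP x * N) := by positivity
        have : 0 ≤ c / γ * (WP x * N) := by positivity
        have : 0 ≤ c * (WP x * N) := by positivity
        linarith

end Second

section SecondCase

variable {D : Type*} [MeasurableSpace D] {D₁ D₂ : Set D} {S : ℕ → Kernel D D}
  {P : ℕ → Kernel D₁ D₁} {Q : Kernel D₁ D₂} {R : ℕ → Kernel D₂ D₂}

/-- A time shift by `k + 1` costs a constant factor in the polynomial normalisation, because
`m + (k + 1) ≤ (k + 2) m` for `m ≥ 1`. -/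
theorem natCast_rpow_neg_le (m k : ℕ) (hm : 1 ≤ m) {ℓ : ℝ} (hℓ : 0 ≤ ℓ) :
    (m : ℝ≥0∞) ^ (-ℓ) ≤ ((k + 2 : ℕ) : ℝ≥0∞) ^ ℓ * ((m + (k + 1) : ℕ) : ℝ≥0∞) ^ (-ℓ) := by
  have h1 : ((m + (k + 1) : ℕ) : ℝ≥0∞) ^ ℓ ≤ ((k + 2 : ℕ) : ℝ≥0∞) ^ ℓ * (m : ℝ≥0∞) ^ ℓ := by
    rw [← ENNReal.mul_rpow_of_nonneg _ _ hℓ]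
    refine ENNReal.rpow_le_rpow ?_ hℓ
    have : m + (k + 1) ≤ (k + 2) * m := by nlinarith
    exact_mod_cast this
  have h2 : ((k + 2 : ℕ) : ℝ≥0∞) ^ ℓ ≠ 0 :=
    (ENNReal.rpow_pos (by positivity) (ENNReal.natCast_ne_top _)).ne'
  have h3 : ((k + 2 : ℕ) : ℝ≥0∞) ^ ℓ ≠ ⊤ :=
    ENNReal.rpow_ne_top_of_nonneg hℓ (ENNReal.natCast_ne_top _)
  rw [ENNReal.rpow_neg, ENNReal.rpow_neg]
  calc ((m : ℝ≥0∞) ^ ℓ)⁻¹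
      = ((k + 2 : ℕ) : ℝ≥0∞) ^ ℓ * (((k + 2 : ℕ) : ℝ≥0∞) ^ ℓ * (m : ℝ≥0∞) ^ ℓ)⁻¹ := by
        rw [ENNReal.mul_inv (Or.inl h2) (Or.inl h3), ← mul_assoc, ENNReal.mul_inv_cancel h2 h3,
          one_mul]
    _ ≤ _ := mul_le_mul_right (ENNReal.inv_le_inv.2 h1) _

/-- `S_{m+k+1}(x, ·)` dominates the mass of `δ_x P_k Q R_m`. -/
theorem IsTriangular.liminf_scaledMass_right (h : IsTriangular S P Q R) {θ : ℝ} (hθ : 0 < θ)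
    {ℓ : ℝ} (hℓ : 0 ≤ ℓ) (k : ℕ) (x : D₁)
    (hS : liminf (scaledMass S (ENNReal.ofReal θ) (Measure.dirac (x : D)) ℓ) atTop = 0) :
    liminf (scaledMass R (ENNReal.ofReal θ) ((P k x).bind Q) ℓ) atTop = 0 := by
  set t := ENNReal.ofReal θ with ht
  have ht0 : t ≠ 0 := (ENNReal.ofReal_pos.2 hθ).ne'
  have htt : t ≠ ⊤ := ENNReal.ofReal_ne_top
  set c := ((k + 2 : ℕ) : ℝ≥0∞) ^ ℓ * t ^ (k + 1)
  have hc : c ≠ ⊤ := ENNReal.mul_ne_top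
    (ENNReal.rpow_ne_top_of_nonneg hℓ (ENNReal.natCast_ne_top _)) (ENNReal.pow_ne_top htt)
  refine liminf_eq_zero_of_le
    (v := fun m => c * scaledMass S t (Measure.dirac (x : D)) ℓ (m + (k + 1))) ?_ ?_
  · filter_upwards [eventually_ge_atTop 1] with m hm
    have h1 := h.bind_le_left (n := m + (k + 1)) (k := k) (by omega) x
    rw [show m + (k + 1) - 1 - k = m by omega] at h1
    have h2 : t⁻¹ ^ m = t ^ (k + 1) * t⁻¹ ^ (m + (k + 1)) := by
      rw [pow_add t⁻¹, mul_comm (t⁻¹ ^ m), ← mul_assoc, ← mul_pow,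
        ENNReal.mul_inv_cancel ht0 htt, one_pow, one_mul]
    rw [scaledMass, scaledMass, dirac_bind_kernel, h2]
    calc (m : ℝ≥0∞) ^ (-ℓ) * (t ^ (k + 1) * t⁻¹ ^ (m + (k + 1))) *
          (((P k x).bind Q).bind (R m)) Set.univ
        ≤ (((k + 2 : ℕ) : ℝ≥0∞) ^ ℓ * ((m + (k + 1) : ℕ) : ℝ≥0∞) ^ (-ℓ)) *
          (t ^ (k + 1) * t⁻¹ ^ (m + (k + 1))) * S (m + (k + 1)) x Set.univ := by
          gcongr
          exact natCast_rpow_neg_le m k hm hℓ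
      _ = _ := by ring
  · rw [ENNReal.liminf_const_mul_of_ne_top hc, Filter.liminf_nat_add, hS, mul_zero]

/-- The measure `∑_{k ≥ 0} θ^{-k-1} δ_x P_k Q`, that is, the law of `X_T` weighted by `θ^{-T}`,
where `T` is the entrance time of `D₂`. -/
noncomputable def entranceLaw (P : ℕ → Kernel D₁ D₁) (Q : Kernel D₁ D₂) (θ : ℝ) (x : D₁) :
    Measure D₂ :=
  Measure.sum fun k : ℕ => ENNReal.ofReal (θ⁻¹ ^ (k + 1)) • (P k x).bind Q

variable {WP : D₁ → ℝ} {WR : D₂ → ℝ} {γ c θ B : ℝ} {Λ : Kernel D₂ D₂} {j : D₂ → ℕ} {α : ℕ → ℝ}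

theorem lintegral_entranceLaw (P : ℕ → Kernel D₁ D₁) (Q : Kernel D₁ D₂) (θ : ℝ) (x : D₁)
    (g : D₂ → ℝ≥0∞) : ∫⁻ y, g y ∂(entranceLaw P Q θ x) =
      ∑' k : ℕ, ENNReal.ofReal (θ⁻¹ ^ (k + 1)) * ∫⁻ y, g y ∂((P k x).bind Q) := by
  simp [entranceLaw, lintegral_sum_measure, lintegral_smul_measure]

theorem lintegral_entranceLaw_le (hc : 0 < c) (hγ : 0 < γ) (hγθ : γ < θ) (hWR : Measurable WR)
    (hWP : ∀ x, 1 ≤ WP x) (hQ : JumpBound Q WP WR) (hP : GeomBound P WP c γ) (x : D₁) :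
    ∫⁻ y, ENNReal.ofReal (WR y) ∂(entranceLaw P Q θ x) ≤
      ENNReal.ofReal (c * WP x * (θ - γ)⁻¹) := by
  have hWP0 : 0 ≤ WP x := zero_le_one.trans (hWP x)
  have hθ : 0 < θ := hγ.trans hγθ
  refine lintegral_sum_smul_le (b := fun k => c * WP x * γ ^ k)
    (fun k => by positivity) (fun k => by positivity) (fun k => ?_)
    (hasSum_geometric_shift hγ hγθ (c * WP x))
  refine (lintegral_bind_jump_le hWR hQ (hP x k)).trans (le_of_eq ?_)
  congr 1
  ring

theorem measurable_integral_entranceLaw (P : ℕ → Kernel D₁ D₁) (Q : Kernel D₁ D₂) (θ : ℝ)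
    {g : D₂ → ℝ} (hg : Measurable g) (hg0 : ∀ y, 0 ≤ g y) :
    Measurable fun x => ∫ y, g y ∂(entranceLaw P Q θ x) := by
  have e : (fun x => ∫ y, g y ∂(entranceLaw P Q θ x)) = fun x => (∑' k : ℕ,
      ENNReal.ofReal (θ⁻¹ ^ (k + 1)) * ∫⁻ y, ENNReal.ofReal (g y) ∂((Q ∘ₖ P k) x)).toReal := by
    funext x
    rw [integral_eq_lintegral_of_nonneg_ae (Eventually.of_forall hg0) hg.aestronglyMeasurable,
      lintegral_entranceLaw]
    simp_rw [Kernel.comp_apply]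
  rw [e]
  exact (Measurable.tsum fun k =>
    (hg.ennreal_ofReal.lintegral_kernel (κ := Q ∘ₖ P k)).const_mul _).ennreal_toReal

theorem measurable_of_level {E : Type*} [MeasurableSpace E] {ℓ : E → ℕ} (hℓ : Measurable ℓ)
    {G : ℕ → E → ℝ} (hG : ∀ m, Measurable (G m)) : Measurable fun x => G (ℓ x) x := by
  intro s hs
  have e : (fun x => G (ℓ x) x) ⁻¹' s = ⋃ m, ℓ ⁻¹' {m} ∩ G m ⁻¹' s := by
    ext x
    simp
  rw [e]
  exact MeasurableSet.iUnion fun m => (hℓ (measurableSet_singleton m)).inter (hG m hs)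

theorem measurable_integral_level (P : ℕ → Kernel D₁ D₁) (Q : Kernel D₁ D₂) (θ : ℝ)
    (hj : Measurable j) {ℓ : D₁ → ℕ} (hℓ : Measurable ℓ) {g : D₂ → ℝ} (hg : Measurable g)
    (hg0 : ∀ y, 0 ≤ g y) :
    Measurable fun x => ∫ y, (if j y = ℓ x then g y else 0) ∂(entranceLaw P Q θ x) := by
  refine measurable_of_level (G := fun m x => ∫ y, (if j y = m then g y else 0)
    ∂(entranceLaw P Q θ x)) hℓ fun m => ?_
  refine measurable_integral_entranceLaw P Q θ
    (Measurable.ite (hj (measurableSet_singleton m)) hg measurable_const) fun y => ?_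
  split_ifs
  · exact hg0 y
  · exact le_rfl

theorem measurable_of_blocks (hD₁ : MeasurableSet D₁) (hD₂ : MeasurableSet D₂)
    (hD : IsCompl D₁ D₂) {f : D → ℝ} (h₁ : Measurable fun x : D₁ => f x)
    (h₂ : Measurable fun y : D₂ => f y) : Measurable f := by
  have e : f = fun z => ext (fun x : D₁ => f x) z + ext (fun y : D₂ => f y) z :=
    funext (forall_of_isCompl hD
      (fun x => (ext_add_ext_left hD (fun x : D₁ => f x) (fun y : D₂ => f y) x).symm)
      (fun y => (ext_add_ext_right hD (fun x : D₁ => f x) (fun y : D₂ => f y) y).symm))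
  rw [e]
  exact (measurable_ext hD₁ h₁).add (measurable_ext hD₂ h₂)

theorem entranceMeasure_eq (P : ℕ → Kernel D₁ D₁) (Q : Kernel D₁ D₂) (Λ : Kernel D₂ D₂) (θ : ℝ)
    (x : D₁) : entranceMeasure P Q Λ θ x = ((entranceLaw P Q θ x).bind Λ).map Subtype.val := by
  ext A hA
  have hA' : MeasurableSet ((Subtype.val : D₂ → D) ⁻¹' A) := measurable_subtype_coe hA
  rw [Measure.map_apply measurable_subtype_coe hA, Measure.bind_apply hA' Λ.aemeasurable,
    lintegral_entranceLaw, entranceMeasure, Measure.sum_apply _ hA]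
  congr 1
  funext k
  rw [Measure.smul_apply, smul_eq_mul, Measure.map_apply measurable_subtype_coe hA,
    Measure.bind_apply hA' Λ.aemeasurable]

/-- If `η i x` is the integral of `ηR i` over the level `j = ℓ` with respect to `μ`, the limit
measure of the whole chain at `x` is that of `R`, restricted to this level and integrated. -/
theorem limitMeasure_bind_level {I : Type*} [Countable I] {η : I → D → ℝ} {ηR : I → D₂ → ℝ}
    {ν : I → Measure D₂} (hΛ : ∀ y, Λ y = limitMeasure ηR ν y) (hjm : Measurable j) {ℓ : ℕ}
    (hηm : ∀ i, Measurable (ηR i)) (hη0 : ∀ i y, 0 ≤ ηR i y) {x : D} {μ : Measure D₂}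
    (hint : ∀ i, Integrable (fun y => if j y = ℓ then ηR i y else 0) μ)
    (hη : ∀ i, η i x = ∫ y, (if j y = ℓ then ηR i y else 0) ∂μ) :
    limitMeasure η (fun i => (ν i).map Subtype.val) x =
      (μ.bind (levelKernel Λ j hjm ℓ)).map Subtype.val := by
  ext A hA
  have hA' : MeasurableSet ((Subtype.val : D₂ → D) ⁻¹' A) := measurable_subtype_coe hA
  have hη' : ∀ i, ENNReal.ofReal (η i x) =
      ∫⁻ y, (if j y = ℓ then ENNReal.ofReal (ηR i y) else 0) ∂μ := fun i => by
    rw [hη, ofReal_integral_eq_lintegral_ofReal (hint i) (Eventually.of_forall fun y => ?_)]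
    · refine lintegral_congr fun y => ?_
      split_ifs
      · rfl
      · exact ENNReal.ofReal_zero
    · dsimp only [Pi.zero_apply]
      split_ifs
      · exact hη0 i y
      · exact le_rfl
  have hm : ∀ i, Measurable fun y => if j y = ℓ then ENNReal.ofReal (ηR i y) else 0 := fun i =>
    Measurable.ite (hjm (measurableSet_singleton ℓ)) (hηm i).ennreal_ofReal measurable_const
  rw [Measure.map_apply measurable_subtype_coe hA, Measure.bind_apply hA' (Kernel.aemeasurable _),
    limitMeasure, Measure.sum_apply _ hA]
  have h1 : ∀ y, levelKernel Λ j hjm ℓ y (Subtype.val ⁻¹' A) = ∑' i,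
      (if j y = ℓ then ENNReal.ofReal (ηR i y) else 0) * ν i (Subtype.val ⁻¹' A) := fun y => by
    by_cases hy : j y = ℓ
    · rw [levelKernel_of_eq hjm hy, hΛ, limitMeasure, Measure.sum_apply _ hA']
      simp [hy]
    · rw [levelKernel_of_ne hjm hy]
      simp [hy]
  simp_rw [h1]
  rw [lintegral_tsum fun i => ((hm i).mul_const _).aemeasurable]
  congr 1
  funext i
  rw [lintegral_mul_const _ (hm i), Measure.smul_apply, smul_eq_mul,
    Measure.map_apply measurable_subtype_coe hA, hη']

theorem ConvergesToKernel.bind_mass_le (hA : ConvergesToKernel R WR Λ j α θ B)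
    (hfin : ∀ n y, IsFiniteMeasure (R n y)) {M : ℝ} (hM : ∀ n, α n ≤ M) {ℓ : ℕ} {μ : Measure D₂}
    (hj : ∀ᵐ y ∂μ, j y ≤ ℓ) {b : ℝ}
    (hμ : ∫⁻ y, ENNReal.ofReal (WR y) ∂μ ≤ ENNReal.ofReal b) (n : ℕ) (hn : 1 ≤ n) :
    (μ.bind (R n)) Set.univ ≤ ENNReal.ofReal ((M + B) * b * (n : ℝ) ^ ℓ * θ ^ n) := by
  have hθ := hA.theta_pos
  have hMB : 0 ≤ M + B := by linarith [hM 0, hA.rate_nonneg 0, hA.bound_nonneg]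
  have h0 : 0 ≤ (M + B) * (n : ℝ) ^ ℓ * θ ^ n := by positivity
  rw [Measure.bind_apply MeasurableSet.univ (R n).aemeasurable]
  refine (lintegral_mono_ae (g := fun y => ENNReal.ofReal ((M + B) * (n : ℝ) ^ ℓ * θ ^ n) *
    ENNReal.ofReal (WR y)) ?_).trans ?_
  · filter_upwards [hj] with y hy
    rw [← ENNReal.ofReal_mul h0]
    exact hA.mass_le hfin hM hy hn
  · rw [lintegral_const_mul' _ _ ENNReal.ofReal_ne_top]
    refine (mul_le_mul_right hμ _).trans (le_of_eq ?_)
    rw [← ENNReal.ofReal_mul h0]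
    congr 1
    ring

/-- The highest level `ℓ` reached by the chain when it enters `D₂`. By Fatou's lemma, some entrance
law `δ_x P_k Q` has this polynomial order. -/
theorem exists_level {J : ℕ} (hjJ : ∀ y, j y ≤ J) (hj : ∀ y, jAt R y = j y)
    (μ : ℕ → Measure D₂) :
    ∃ ℓ : ℕ, ℓ ≤ J ∧ (∀ k, ∀ᵐ y ∂(μ k), j y ≤ ℓ) ∧ ∃ k, ∀ r : ℝ, 0 ≤ r → r < ℓ →
      liminf (scaledMass R (expParam₀ R) (μ k) r) atTop ≠ 0 := by
  classical
  have hex : ∃ ℓ : ℕ, ∀ k, ∀ᵐ y ∂(μ k), j y ≤ ℓ := ⟨J, fun k => Eventually.of_forall hjJ⟩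
  refine ⟨Nat.find hex, Nat.find_min' hex fun k => Eventually.of_forall hjJ, Nat.find_spec hex, ?_⟩
  rcases Nat.eq_zero_or_pos (Nat.find hex) with h0 | hpos
  -- there is no `r` with `0 ≤ r < 0`, so that any `k` will do
  · exact ⟨0, fun r hr hr' => absurd hr (by rw [h0, Nat.cast_zero] at hr'; exact not_le.2 hr')⟩
  · have h1 := Nat.find_min hex (Nat.sub_lt hpos one_pos)
    push Not at h1
    obtain ⟨k, hk⟩ := h1
    refine ⟨k, fun r hr hr' hlim => hk ?_⟩
    filter_upwards [ae_jAt_le_of_liminf hr hlim] with y hy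
    rw [hj] at hy
    have : j y < Nat.find hex := by exact_mod_cast hy.trans_lt hr'
    omega

open scoped Classical in
/-- If `D₂` dominates, Assumption (A) passes from `R` to `S`. -/
theorem second_case {I : Type*} (h : IsTriangular S P Q R) (hD₁ : MeasurableSet D₁)
    (hD₂ : MeasurableSet D₂) (hD : IsCompl D₁ D₂) {ηR : I → D₂ → ℝ} {νR : I → Measure D₂}
    (hα0 : α 0 = 1) (H : AssumptionA2 P Q R WR ηR νR α WP γ c) :
    expParam₀ S = expParam₀ R ∧
    (∀ x : D₁, IsGreatest (Set.range fun n : ℕ => polyParam R ((P n x).bind Q)) (jAt S x)) ∧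
    (∀ y : D₂, jAt S y = jAt R y) ∧
    ∃ C : ℝ, 0 < C ∧ ∀ η : I → D → ℝ, (∀ i (y : D₂), η i y = ηR i y) →
      (∀ i (x : D₁), η i x =
        ∫ y, (if jAt R y = jAt S x then ηR i y else 0) ∂(entranceLaw P Q (theta₀ R) x)) →
      AssumptionA S (fun x => ext WP x + ext WR x) η (fun i => (νR i).map Subtype.val)
        (rateA2 C γ (theta₀ R) (j₀ R) α) := by
  have HA := H.assumptionA
  have hI := HA.countable
  obtain ⟨Λ, j, B, hΛ, hj, hA⟩ := HA.exists_convergesToKernel hα0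
  set θ := theta₀ R with hθdef
  set J := j₀ R with hJdef
  have hγ := H.gamma_pos
  have hγθ : γ < θ := H.gamma_lt
  have hc := H.c_pos
  have hθ : 0 < θ := hγ.trans hγθ
  have hr0 : 0 < γ / θ := div_pos hγ hθ
  have hr1 : γ / θ < 1 := (div_lt_one hθ).2 hγθ
  have hJ : ∀ y, (j y : ℝ) ≤ J := fun y => by
    rw [← hj]; exact le_ciSup H.finite_j y
  obtain ⟨y₀⟩ := HA.nonempty
  have hJ0 : 0 ≤ J := (j y₀).cast_nonneg.trans (hJ y₀)
  have hB := hA.bound_nonneg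
  have hα := hA.rate_nonneg
  have hexpR : expParam₀ R = ENNReal.ofReal θ := HA.expParam₀_eq
  have hjm : Measurable j := hA.measurable_j h.finite_R hexpR hj HA.tendsto_rate
  obtain ⟨M, hM⟩ := exists_le_of_tendsto HA.tendsto_rate
  -- the last summand makes `C ≥ 1`, so that `α n`, the error on `D₂`, is at most the rate
  set C := (c + c / γ * (1 + 2 * B)) * (3 + 1 / (1 - γ / θ)) + 1 with hC
  have h1r : 0 < 1 - γ / θ := by linarith
  have hC1 : 1 ≤ C := by rw [hC]; exact le_add_of_nonneg_left (by positivity)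
  have hC0 : 0 < C := zero_lt_one.trans_le hC1
  have hW : ∀ z, 1 ≤ ext WP z + ext WR z := one_le_ext_add_ext hD H.one_le_WP hA.one_le_W
  have hrate : Tendsto (rateA2 C γ θ J α) atTop (𝓝 0) := tendsto_rateA2 hr0 hr1 HA.tendsto_rate
  have hαrate : ∀ n, α n ≤ rateA2 C γ θ J α n := fun n => by
    have h1 : ∀ k ∈ Finset.range (n + 1),
        0 ≤ (α (n - k) + J * ((k : ℝ) / n)) * (γ / θ) ^ k := fun k _ =>
      mul_nonneg (add_nonneg (hα _) (by positivity)) (by positivity)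
    have h2 := Finset.single_le_sum h1 (Finset.mem_range.2 n.succ_pos)
    simp only [Nat.sub_zero, Nat.cast_zero, zero_div, mul_zero, add_zero, pow_zero, mul_one] at h2
    exact h2.trans (le_mul_of_one_le_left ((hα n).trans h2) hC1)
  have hlev := fun x : D₁ => exists_level (J := ⌊J⌋₊) (fun y => Nat.le_floor (hJ y)) hj
    fun k => (P k x).bind Q
  choose lev hlevJ hlev k₀ hk₀ using hlev
  have hlevJ' : ∀ x, (lev x : ℝ) ≤ J := fun x => (Nat.le_floor_iff hJ0).1 (hlevJ x)
  have hμ : ∀ x k, ∫⁻ y, ENNReal.ofReal (WR y) ∂((P k x).bind Q) ≤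
      ENNReal.ofReal (c * γ ^ k * WP x) := fun x k =>
    lintegral_bind_jump_le hA.measurable_W H.jump (H.geom x k)
  have hleft := fun (x : D₁) (n : ℕ) (f : D → ℝ) (N : ℝ) (hn : 1 ≤ n) (hf : Measurable f)
    (hN : 0 ≤ N) (hfN : ∀ z, |f z| ≤ N * (ext WP z + ext WR z)) =>
    second_estimate_left h hA hjm hD₁ hD₂ hD hc hγ hγθ H.one_le_WP H.jump H.geom hJ
      (hlevJ' x) (hlev x) hn hf hN hfN
  have hright := fun (y : D₂) (n : ℕ) (f : D → ℝ) (N : ℝ) (hn : 1 ≤ n) (hf : Measurable f)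
    (hfN : ∀ z, |f z| ≤ N * (ext WP z + ext WR z)) =>
    estimate_right (y := y) h hA hD₂ hD hn hf hfN
  have hone : ∀ z : D, |(1 : ℝ)| ≤ 1 * (ext WP z + ext WR z) := fun z => by
    rw [abs_one, one_mul]; exact hW z
  have hbl : ∀ x : D₁, ∃ C : ℝ, ∀ n : ℕ, 1 ≤ n →
      S n x Set.univ ≤ ENNReal.ofReal (C * (n : ℝ) ^ lev x * θ ^ n) := fun x => by
    refine exists_mass_bound (r := fun n => rateA2 C γ θ J α n * WP x * 1) hθ
      (fun n => h.finite n x) ?_ fun n hn =>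
      hleft x n (fun _ => 1) 1 hn measurable_const zero_le_one hone
    have := (hrate.mul_const (WP x)).mul_const 1
    simpa using this
  have hbr : ∀ y : D₂, ∃ C : ℝ, ∀ n : ℕ, 1 ≤ n →
      S n y Set.univ ≤ ENNReal.ofReal (C * (n : ℝ) ^ j y * θ ^ n) := fun y => by
    refine exists_mass_bound (r := fun n => α n * WR y * 1) hθ (fun n => h.finite n y) ?_
      fun n hn => hright y n (fun _ => 1) 1 hn measurable_const hone
    have := (HA.tendsto_rate.mul_const (WR y)).mul_const 1
    simpa using this
  have hexp : expParam₀ S = ENNReal.ofReal θ := by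
    refine expParam₀_eq_of_bounds hθ (hexpR ▸ h.expParam₀_le_right)
      (forall_of_isCompl hD (fun x => ?_) (fun y => ?_))
    · obtain ⟨C, hC⟩ := hbl x
      exact ⟨_, C, hC⟩
    · obtain ⟨C, hC⟩ := hbr y
      exact ⟨_, C, hC⟩
  have hθS : theta₀ S = θ := by rw [theta₀, hexp, ENNReal.toReal_ofReal hθ.le]
  have hSR : expParam₀ S = expParam₀ R := hexp.trans hexpR.symm
  have hjl : ∀ x : D₁, jAt S x = lev x := fun x => by
    obtain ⟨C, hC⟩ := hbl x
    have hC' : ∀ n : ℕ, 1 ≤ n → ((Measure.dirac (x : D)).bind (S n)) Set.univ ≤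
        ENNReal.ofReal (C * (n : ℝ) ^ lev x * θ ^ n) := fun n hn => by
      rw [dirac_bind_kernel]; exact hC n hn
    refine le_antisymm (polyParam_le_of_bound hθ hexp hC')
      (le_polyParam hθ hexp hC' fun ℓ h0 hℓ hlim => hk₀ x ℓ h0 hℓ ?_)
    rw [hexp] at hlim
    rw [hexpR]
    exact h.liminf_scaledMass_right hθ h0 _ x hlim
  have hjr : ∀ y : D₂, jAt S y = j y := fun y => (h.jAt_right hSR y).trans (hj y)
  have hmass : ∀ (x : D₁) (k n : ℕ), 1 ≤ n → (((P k x).bind Q).bind (R n)) Set.univ ≤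
      ENNReal.ofReal ((M + B) * (c * γ ^ k * WP x) * (n : ℝ) ^ lev x * θ ^ n) := fun x k =>
    hA.bind_mass_le h.finite_R hM (hlev x k) (hμ x k)
  refine ⟨hSR, fun x => ⟨⟨k₀ x, ?_⟩, ?_⟩, h.jAt_right hSR, C, hC0, fun η hηr hηl => ?_⟩
  · rw [hjl]
    exact le_antisymm (polyParam_le_of_bound hθ hexpR (hmass x _))
      (le_polyParam hθ hexpR (hmass x _) (hk₀ x))
  · rintro _ ⟨k, rfl⟩
    rw [hjl]
    exact polyParam_le_of_bound hθ hexpR (hmass x k)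
  have hWP0 : ∀ x, 0 ≤ WP x := fun x => zero_le_one.trans (H.one_le_WP x)
  have hd : 0 < (θ - γ)⁻¹ := inv_pos.2 (sub_pos.2 hγθ)
  have hif : ∀ i (x : D₁) y, (if jAt R y = jAt S x then ηR i y else 0) =
      if j y = lev x then ηR i y else 0 := fun i x y => by
    simp only [hj, hjl, Nat.cast_inj]
  have hifm : ∀ i (ℓ : ℕ), Measurable fun y => if j y = ℓ then ηR i y else 0 := fun i ℓ =>
    Measurable.ite (hjm (measurableSet_singleton ℓ)) (HA.mem_eta i).1 measurable_const
  have hif0 : ∀ i (ℓ : ℕ) y, 0 ≤ if j y = ℓ then ηR i y else 0 := fun i ℓ y => by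
    split_ifs
    · exact HA.eta_nonneg i y
    · exact le_rfl
  have hifN : ∀ i (ℓ : ℕ) y, |if j y = ℓ then ηR i y else 0| ≤ normW WR (ηR i) * WR y :=
    fun i ℓ y => by
      split_ifs
      · exact abs_le_normW_mul hA.one_le_W (HA.mem_eta i) y
      · rw [abs_zero]
        exact mul_nonneg (normW_nonneg hA.one_le_W _) (hA.W_pos y).le
  have hηl' : ∀ i (x : D₁), η i x =
      ∫ y, (if j y = lev x then ηR i y else 0) ∂(entranceLaw P Q θ x) := fun i x => by
    rw [hηl]; simp_rw [hif]
  have hη0 : ∀ i x, 0 ≤ η i x := fun i => forall_of_isCompl hD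
    (fun x => by rw [hηl']; exact integral_nonneg (hif0 i _))
    (fun y => by rw [hηr]; exact HA.eta_nonneg i y)
  have hliml : ∀ x : D₁, limitMeasure η (fun i => (νR i).map Subtype.val) x =
      entranceMeasure P Q (levelKernel Λ j hjm (lev x)) θ x := fun x => by
    rw [entranceMeasure_eq]
    exact limitMeasure_bind_level hΛ hjm (fun i => (HA.mem_eta i).1) HA.eta_nonneg
      (fun i => integrable_of_lintegral_le (hifm i _) (normW_nonneg hA.one_le_W _) (hifN i _)
        (lintegral_entranceLaw_le hc hγ hγθ hA.measurable_W H.one_le_WP H.jump H.geom x))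
      fun i => hηl' i x
  have hlimr : ∀ y : D₂, limitMeasure η (fun i => (νR i).map Subtype.val) y =
      (Λ y).map Subtype.val := fun y => by
    rw [hΛ]; exact limitMeasure_map_right νR fun i => hηr i y
  have hboundl : ∀ x : D₁, ∫⁻ z, ENNReal.ofReal (ext WP z + ext WR z)
      ∂(entranceMeasure P Q (levelKernel Λ j hjm (lev x)) θ x) ≤
        ENNReal.ofReal (B * c * (θ - γ)⁻¹ * WP x) := fun x =>
    lintegral_entranceMeasure_le hD₂ hD hc hγ hγθ hA.measurable_W H.one_le_WP H.jump H.geom hB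
      (fun y => (lintegral_levelKernel_le hjm _ y _).trans (hA.lintegral_limit_le y)) x
  have hboundr : ∀ y : D₂, ∫⁻ z, ENNReal.ofReal (ext WP z + ext WR z)
      ∂((Λ y).map Subtype.val) ≤ ENNReal.ofReal (B * WR y) := fun y => by
    rw [lintegral_map_val_right hD₂ hD]; exact hA.lintegral_limit_le y
  have hWm : Measurable fun z => ext WP z + ext WR z :=
    (measurable_ext hD₁ H.measurable_WP).add (measurable_ext hD₂ hA.measurable_W)
  have hjS : ∀ x, ∃ k : ℕ, jAt S x = k :=
    forall_of_isCompl hD (fun x => ⟨_, hjl x⟩) (fun y => ⟨_, hjr y⟩)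
  have hlevm : Measurable lev := by
    choose jS hjS using hjS
    have hjSl : ∀ x : D₁, jS x = lev x := fun x => by
      have := (hjS x).symm.trans (hjl x); exact_mod_cast this
    have hjSr : ∀ y : D₂, jS y = j y := fun y => by
      have := (hjS y).symm.trans (hjr y); exact_mod_cast this
    have : Measurable jS := measurable_jAt hθ hexp hjS (forall_of_isCompl hD
      (fun x => by rw [hjSl]; exact hbl x) (fun y => by rw [hjSr]; exact hbr y))
    have e : lev = fun x : D₁ => jS x := funext fun x => (hjSl x).symm
    rw [e]
    exact this.comp measurable_subtype_coe
  have hηm : ∀ i, Measurable (η i) := fun i => by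
    refine measurable_of_blocks hD₁ hD₂ hD ?_ ?_
    · simp_rw [hηl']
      exact measurable_integral_level P Q θ hjm hlevm (HA.mem_eta i).1 (HA.eta_nonneg i)
    · simp_rw [hηr]
      exact (HA.mem_eta i).1
  have := HA.prob
  have hJ' : ∀ y, j y ≤ ⌈J⌉₊ := fun y => by exact_mod_cast (hJ y).trans (Nat.le_ceil J)
  have hmax : 0 ≤ B * c * (θ - γ)⁻¹ := by positivity
  refine assumptionA_of_limitMeasure (B := B * c * (θ - γ)⁻¹ + B) hexp hθ HA.theta₀_le_one hjS
    hWm hW hI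
    (fun i => Measure.isProbabilityMeasure_map measurable_subtype_coe.aemeasurable) hηm hη0
    (fun i => ?_) (forall_of_isCompl hD (fun x => ?_) (fun y => ?_))
    (fun n => forall_of_isCompl hD (fun x => ?_) (fun y => ?_)) hrate
    (forall_of_isCompl hD (fun x => ?_) (fun y => ?_))
  · obtain ⟨y, hy⟩ := HA.eta_ne_zero i
    exact ⟨y, by rw [hηr]; exact hy⟩
  · rw [hliml, ext_add_ext_left hD]
    refine (hboundl x).trans (ENNReal.ofReal_le_ofReal ?_)
    exact mul_le_mul_of_nonneg_right (le_add_of_nonneg_right hB) (hWP0 x)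
  · rw [hlimr, ext_add_ext_right hD]
    refine (hboundr y).trans (ENNReal.ofReal_le_ofReal ?_)
    exact mul_le_mul_of_nonneg_right (le_add_of_nonneg_left hmax) (hA.W_pos y).le
  · refine h.integrable_left hD₁ hD₂ ?_ fun k _ => ?_
    · simp_rw [ext_add_ext_left hD]
      exact integrable_of_lintegral_le H.measurable_WP zero_le_one
        (fun z => by rw [one_mul, abs_of_nonneg (hWP0 z)]) (H.geom x n)
    · simp_rw [ext_add_ext_right hD]
      obtain ⟨M', hM0, hM'⟩ := hA.exists_lintegral_le h.R_zero hJ' (n - 1 - k)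
      exact integrable_of_lintegral_le hA.measurable_W zero_le_one
        (fun z => by rw [one_mul, abs_of_nonneg (hA.W_pos z).le])
        (lintegral_bind_ofReal_le hM0 hA.measurable_W hM' (hμ x k))
  · refine h.integrable_right hD₂ ?_
    simp_rw [ext_add_ext_right hD]
    exact hA.integrable_W n y
  · refine convergesAt_of_limitMeasure hW (fun i => hη0 i x) ((hliml x).symm ▸ hboundl x) (hjl x)
      fun n f N hn hf hN hfN => ?_
    rw [hθS, hliml, ext_add_ext_left hD]
    exact hleft x n f N hn hf hN hfN
  · refine convergesAt_of_limitMeasure hW (fun i => hη0 i y) ((hlimr y).symm ▸ hboundr y) (hjr y)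
      fun n f N hn hf hN hfN => ?_
    rw [hθS, hlimr, ext_add_ext_right hD]
    refine (hright y n f N hn hf hfN).trans ?_
    have := (hA.W_pos y).le
    gcongr
    exact hαrate n

end SecondCase

/-! ### Equal exponential parameters -/

section Third

variable {D : Type*} [MeasurableSpace D] {D₁ D₂ : Set D}

namespace ConvergesToKernel

variable {E : Type*} [MeasurableSpace E] {S : ℕ → Kernel E E} {W : E → ℝ} {Λ : Kernel E E}
  {j : E → ℕ} {a : ℕ → ℝ} {θ B : ℝ}

theorem lintegral_le_of_eq_zero (h : ConvergesToKernel S W Λ j a θ B)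
    (h0 : ∀ x, S 0 x = Measure.dirac x) {x : E} (hj : j x = 0) (n : ℕ) :
    ∫⁻ y, ENNReal.ofReal (W y) ∂(S n x) ≤ ENNReal.ofReal ((a n + B) * θ ^ n * W x) := by
  rcases Nat.eq_zero_or_pos n with rfl | hn
  · rw [h0, lintegral_dirac' _ h.measurable_W.ennreal_ofReal, h.rate_zero, pow_zero, mul_one]
    exact ENNReal.ofReal_le_ofReal (le_mul_of_one_le_left (h.W_pos x).le
      (le_add_of_nonneg_right h.bound_nonneg))
  · rw [h.lintegral_eq_ofReal_integral]
    refine ENNReal.ofReal_le_ofReal ((le_abs_self _).trans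
      ((h.integral_abs_bound (N := 1) hn h.measurable_W fun y => ?_).trans (le_of_eq ?_)))
    · rw [one_mul, abs_of_pos (h.W_pos y)]
    · rw [hj]; ring

theorem tendsto_of_eq_zero (h : ConvergesToKernel S W Λ j a θ B) (ha : Tendsto a atTop (𝓝 0))
    {x : E} (hj : j x = 0) {f : E → ℝ} {N : ℝ} (hf : Measurable f) (hfN : ∀ y, |f y| ≤ N * W y) :
    Tendsto (fun n => θ⁻¹ ^ n * ∫ y, f y ∂(S n x)) atTop (𝓝 (∫ y, f y ∂(Λ x))) := by
  rw [tendsto_iff_norm_sub_tendsto_zero]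
  have hlim : Tendsto (fun n => a n * W x * N) atTop (𝓝 0) := by
    have := (ha.mul_const (W x)).mul_const N
    simpa using this
  refine squeeze_zero' (Eventually.of_forall fun n => _root_.norm_nonneg _) ?_ hlim
  filter_upwards [eventually_ge_atTop 1] with n hn
  have := h.estimate x n f N hn hf hfN
  rwa [hj, pow_zero, inv_one, mul_one] at this

/-- The limit measures are quasi-stationary: `Λ(x, ·) S_m = θ^m Λ(x, ·)`. -/
theorem integral_limit_bind (h : ConvergesToKernel S W Λ j a θ B) (ha : Tendsto a atTop (𝓝 0))
    (h0 : ∀ x, S 0 x = Measure.dirac x) (hadd : ∀ n m x, S (n + m) x = (S n x).bind (S m))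
    (hj : ∀ x, j x = 0) {f : E → ℝ} {N : ℝ} (hf : Measurable f) (hN : 0 ≤ N)
    (hfN : ∀ y, |f y| ≤ N * W y) (x : E) (m : ℕ) :
    Integrable f ((Λ x).bind (S m)) ∧
      ∫ y, f y ∂((Λ x).bind (S m)) = θ ^ m * ∫ y, f y ∂(Λ x) := by
  have hθ := h.theta_pos
  have hB := h.bound_nonneg
  have ham := h.rate_nonneg m
  have hc : 0 ≤ (a m + B) * θ ^ m := by positivity
  have hS : ∀ z, ∫⁻ y, ENNReal.ofReal (W y) ∂(S m z) ≤
      ENNReal.ofReal ((a m + B) * θ ^ m * W z) := fun z => h.lintegral_le_of_eq_zero h0 (hj z) m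
  set g : E → ℝ := fun z => ∫ y, f y ∂(S m z) with hg
  have hgm : Measurable g :=
    (StronglyMeasurable.integral_kernel (κ := S m) hf.stronglyMeasurable).measurable
  have hgN : ∀ z, |g z| ≤ (N * ((a m + B) * θ ^ m)) * W z := fun z => by
    refine (abs_integral_le_of_lintegral_le hN (mul_nonneg hc (h.W_pos z).le)
      (Eventually.of_forall hfN) (hS z)).trans (le_of_eq (by ring))
  have hint : Integrable f ((Λ x).bind (S m)) := integrable_of_lintegral_le hf hN hfN
    (lintegral_bind_ofReal_le hc h.measurable_W hS (h.lintegral_limit_le x))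
  refine ⟨hint, ?_⟩
  rw [integral_bind_kernel hint]
  have h1 := h.tendsto_of_eq_zero ha (hj x) hgm hgN
  have h2 := ((tendsto_add_atTop_iff_nat m).2
    (h.tendsto_of_eq_zero ha (hj x) hf hfN)).const_mul (θ ^ m)
  refine tendsto_nhds_unique (h1.congr fun n => ?_) h2
  rw [hadd, integral_bind_kernel (by
    rw [← hadd]
    exact integrable_of_lintegral_le hf hN hfN (h.lintegral_eq_ofReal_integral _ x).le), pow_add,
    inv_pow θ m]
  field_simp
  rfl

end ConvergesToKernel

/-- A positive limit of the masses at the order `n^J` makes `j_S(x)` at least `J`. -/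
theorem liminf_scaledMass_ne_zero_of_tendsto {E : Type*} [MeasurableSpace E] {S : ℕ → Kernel E E}
    {x : E} {θ p : ℝ} {J : ℕ} (hθ : 0 < θ) (hfin : ∀ n, IsFiniteMeasure (S n x)) (hp : 0 < p)
    (h : Tendsto (fun n : ℕ => θ⁻¹ ^ n * ((n : ℝ) ^ J)⁻¹ * ∫ _, (1 : ℝ) ∂(S n x)) atTop (𝓝 p))
    {r : ℝ} (hr : r < J) :
    liminf (scaledMass S (ENNReal.ofReal θ) (Measure.dirac x) r) atTop ≠ 0 := by
  intro hlim
  have h1 := (ENNReal.tendsto_ofReal h).liminf_eq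
  have h2 := liminf_eq_zero_of_le (u := fun n : ℕ => ENNReal.ofReal
    (θ⁻¹ ^ n * ((n : ℝ) ^ J)⁻¹ * ∫ _, (1 : ℝ) ∂(S n x))) ?_ hlim
  · rw [h1] at h2
    exact absurd h2 (ENNReal.ofReal_pos.2 hp).ne'
  · filter_upwards [eventually_ge_atTop 1] with n hn
    have hn1 : (1 : ℝ) ≤ n := by exact_mod_cast hn
    have hn0 : (0 : ℝ) < n := by linarith
    have := hfin n
    rw [scaledMass, dirac_bind_kernel, natCast_rpow_mul_inv_pow hθ hn, integral_const, smul_eq_mul,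
      mul_one, ENNReal.ofReal_mul (by positivity), measureReal_def,
      ENNReal.ofReal_toReal (measure_ne_top _ _)]
    gcongr ENNReal.ofReal ?_ * _
    rw [mul_comm]
    gcongr
    rw [← Real.rpow_natCast, ← Real.rpow_neg hn0.le]
    exact Real.rpow_le_rpow_of_exponent_le hn1 (by linarith)

theorem ConvergesAt.mono {E : Type*} [MeasurableSpace E] {S : ℕ → Kernel E E} {I : Type*}
    {W : E → ℝ} {η : I → E → ℝ} {ν : I → Measure E} {a b : ℕ → ℝ} {x : E}
    (h : ConvergesAt S W η ν a x) (hW : ∀ x, 1 ≤ W x) (hab : ∀ n, a n ≤ b n) :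
    ConvergesAt S W η ν b x := fun f hf n hn => (h f hf n hn).trans
  (mul_le_mul_of_nonneg_right (mul_le_mul_of_nonneg_right (hab n) (zero_le_one.trans (hW x)))
    (normW_nonneg hW f))

theorem AssumptionA.measurable_jAt {E : Type*} [MeasurableSpace E] {S : ℕ → Kernel E E} {I : Type*}
    {W : E → ℝ} {η : I → E → ℝ} {ν : I → Measure E} {a : ℕ → ℝ} (h : AssumptionA S W η ν a)
    (ha : a 0 = 1) (hfin : ∀ n x, IsFiniteMeasure (S n x)) : Measurable (jAt S) := by
  obtain ⟨Λ, j, B, -, hj, hA⟩ := h.exists_convergesToKernel ha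
  have hjm := hA.measurable_j hfin h.expParam₀_eq hj h.tendsto_rate
  have e : jAt S = fun x => (j x : ℝ) := funext hj
  rw [e]
  exact measurable_from_nat.comp hjm

variable {WP : D₁ → ℝ} {WR : D₂ → ℝ} {S : ℕ → Kernel D D} {P : ℕ → Kernel D₁ D₁}
  {Q : Kernel D₁ D₂} {R : ℕ → Kernel D₂ D₂} {ΛP : Kernel D₁ D₁} {ΛR : Kernel D₂ D₂}
  {jP : D₁ → ℕ} {j : D₂ → ℕ} {αP αR : ℕ → ℝ} {θ BP BR : ℝ}

/-- In `S_n f(x) = P_n f(x) + ∑_{k<n} P_k Q R_{n-1-k} f(x)` all the terms of the sum have the same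
exponential order `θⁿ`, which produces the additional factor `n`. -/
theorem third_estimate_left (h : IsTriangular S P Q R)
    (hP : ConvergesToKernel P WP ΛP jP αP θ BP) (hjP : ∀ x, jP x = 0)
    (hR : ConvergesToKernel R WR ΛR j αR θ BR) (hjm : Measurable j) (hD₁ : MeasurableSet D₁)
    (hD₂ : MeasurableSet D₂) (hD : IsCompl D₁ D₂) (hQ : JumpBound Q WP WR) {M : ℝ}
    (hM : ∀ n, αP n ≤ M) {J : ℕ} (hJ : ∀ y, j y ≤ J) {x : D₁} {ℓ : ℕ}
    (hℓ : ∀ k, ∀ᵐ y ∂((P k x).bind Q), j y ≤ ℓ) {n : ℕ} {f : D → ℝ}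
    {N : ℝ} (hn : 1 ≤ n) (hf : Measurable f) (hN : 0 ≤ N)
    (hfN : ∀ z, |f z| ≤ N * (ext WP z + ext WR z)) :
    |θ⁻¹ ^ n * ((n : ℝ) ^ (1 + ℓ))⁻¹ * (∫ z, f z ∂(S n x)) -
        ∫ z, f z ∂(((ENNReal.ofReal (θ⁻¹ / (1 + ℓ)) • (ΛP x).bind Q).bind
          (levelKernel ΛR j hjm ℓ)).map Subtype.val)| ≤
      rateA3 ((M + BP) + θ⁻¹ * ((1 + BR) * (M + BP) + (1 + BP) * BR + BP * BR)) ℓ αP αR n *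
        WP x * N := by
  have hθ := hP.theta_pos
  have hn' : (0 : ℝ) < n := by exact_mod_cast hn
  have hn1 : (1 : ℝ) ≤ n := by exact_mod_cast hn
  have hBP := hP.bound_nonneg
  have hBR := hR.bound_nonneg
  have hαP := hP.rate_nonneg
  have hαR := hR.rate_nonneg
  have hWP0 := (hP.W_pos x).le
  have hM0 : 0 ≤ M := (hαP 0).trans (hM 0)
  have hWRm := hR.measurable_W
  have hf₁m : Measurable fun z : D₁ => f z := hf.comp measurable_subtype_coe
  have hf₂m : Measurable fun z : D₂ => f z := hf.comp measurable_subtype_coe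
  have hf₁ : ∀ z : D₁, |f z| ≤ N * WP z := fun z => by
    have := hfN z; rwa [ext_add_ext_left hD] at this
  have hf₂ : ∀ z : D₂, |f z| ≤ N * WR z := fun z => by
    have := hfN z; rwa [ext_add_ext_right hD] at this
  set w := WP x * N with hw
  have hw0 : 0 ≤ w := mul_nonneg hWP0 hN
  set Λℓ := levelKernel ΛR j hjm ℓ with hΛℓ
  have hΛℓB : ∀ y, ∫⁻ z, ENNReal.ofReal (WR z) ∂(Λℓ y) ≤ ENNReal.ofReal (BR * WR y) := fun y =>
    (lintegral_levelKernel_le hjm ℓ y _).trans (hR.lintegral_limit_le y)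
  have hPk : ∀ k, ∫⁻ y, ENNReal.ofReal (WP y) ∂(P k x) ≤
      ENNReal.ofReal ((M + BP) * θ ^ k * WP x) := fun k =>
    (hP.lintegral_le_of_eq_zero h.P_zero (hjP x) k).trans (ENNReal.ofReal_le_ofReal (by
      have := hM k
      gcongr))
  have hμ : ∀ k, ∫⁻ y, ENNReal.ofReal (WR y) ∂((P k x).bind Q) ≤
      ENNReal.ofReal ((M + BP) * θ ^ k * WP x) := fun k => lintegral_bind_jump_le hWRm hQ (hPk k)
  have hfint₁ : Integrable (fun z : D₁ => f z) (P n x) :=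
    integrable_of_lintegral_le hf₁m hN hf₁ (hPk n)
  have hfint₂ : ∀ k m, Integrable (fun z : D₂ => f z) (((P k x).bind Q).bind (R m)) :=
    fun k m => by
      obtain ⟨M', hM0', hM'⟩ := hR.exists_lintegral_le h.R_zero hJ m
      exact integrable_of_lintegral_le hf₂m hN hf₂ (lintegral_bind_ofReal_le hM0' hWRm hM' (hμ k))
  have hfintΛ : ∀ k, Integrable (fun z : D₂ => f z) (((P k x).bind Q).bind Λℓ) := fun k =>
    integrable_of_lintegral_le hf₂m hN hf₂ (lintegral_bind_ofReal_le hBR hWRm hΛℓB (hμ k))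
  -- `g z = δ_z Q Λ f`
  set g : D₁ → ℝ := fun z => ∫ y : D₂, f y ∂((Λℓ ∘ₖ Q) z) with hg
  have hgm : Measurable g :=
    (StronglyMeasurable.integral_kernel (κ := Λℓ ∘ₖ Q) hf₂m.stronglyMeasurable).measurable
  have hgN : ∀ z, |g z| ≤ (BR * N) * WP z := fun z => by
    have h1 : ∫⁻ y, ENNReal.ofReal (WR y) ∂((Λℓ ∘ₖ Q) z) ≤ ENNReal.ofReal (BR * WP z) := by
      rw [Kernel.comp_apply]
      exact lintegral_bind_ofReal_le hBR hWRm hΛℓB (hQ z)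
    refine (abs_integral_le_of_lintegral_le hN (mul_nonneg hBR (hP.W_pos z).le)
      (Eventually.of_forall hf₂) h1).trans (le_of_eq (by ring))
  have hcomp : ∀ μ : Measure D₁, (μ.bind Q).bind Λℓ = μ.bind (Λℓ ∘ₖ Q) :=
    fun μ => Measure.comp_assoc
  have hgP : ∀ k, ∫ y : D₂, f y ∂(((P k x).bind Q).bind Λℓ) = ∫ z, g z ∂(P k x) := fun k => by
    have := hfintΛ k
    rw [hcomp] at this ⊢
    rw [integral_bind_kernel this]
  set L := ∫ z, g z ∂(ΛP x) with hL
  have hLb : |L| ≤ BP * BR * w := (hP.abs_limit_le hgN).trans (le_of_eq (by rw [hw]; ring))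
  have hlim : ∫ z, f z ∂(((ENNReal.ofReal (θ⁻¹ / (1 + ℓ)) • (ΛP x).bind Q).bind Λℓ).map
      Subtype.val) = θ⁻¹ / (1 + ℓ) * L := by
    have hΛQ : ∫⁻ y, ENNReal.ofReal (WR y) ∂((ΛP x).bind Q) ≤ ENNReal.ofReal (BP * WP x) :=
      lintegral_bind_jump_le hWRm hQ (hP.lintegral_limit_le x)
    have hc : 0 ≤ θ⁻¹ / (1 + ℓ) := by positivity
    have hΛQ' : ∫⁻ y, ENNReal.ofReal (WR y) ∂(ENNReal.ofReal (θ⁻¹ / (1 + ℓ)) • (ΛP x).bind Q) ≤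
        ENNReal.ofReal (θ⁻¹ / (1 + ℓ) * (BP * WP x)) := by
      rw [lintegral_smul_measure, smul_eq_mul, ENNReal.ofReal_mul hc]
      gcongr
    have hi : Integrable (fun z : D₂ => f z) (((ΛP x).bind Q).bind Λℓ) :=
      integrable_of_lintegral_le hf₂m hN hf₂ (lintegral_bind_ofReal_le hBR hWRm hΛℓB hΛQ)
    have hi' : Integrable (fun z : D₂ => f z)
        ((ENNReal.ofReal (θ⁻¹ / (1 + ℓ)) • (ΛP x).bind Q).bind Λℓ) :=
      integrable_of_lintegral_le hf₂m hN hf₂ (lintegral_bind_ofReal_le hBR hWRm hΛℓB hΛQ')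
    rw [(MeasurableEmbedding.subtype_coe hD₂).integral_map, integral_bind_kernel hi',
      integral_smul_measure, ENNReal.toReal_ofReal hc, smul_eq_mul, ← integral_bind_kernel hi]
    congr 1
    rw [hcomp] at hi ⊢
    rw [integral_bind_kernel hi]
  have hS : θ⁻¹ ^ n * ((n : ℝ) ^ (1 + ℓ))⁻¹ * (∫ z, f z ∂(S n x)) =
      θ⁻¹ ^ n * ((n : ℝ) ^ (1 + ℓ))⁻¹ * (∫ z : D₁, f z ∂(P n x)) +
        θ⁻¹ / n * ∑ k ∈ Finset.range n, θ⁻¹ ^ k * (θ⁻¹ ^ (n - 1 - k) * ((n : ℝ) ^ ℓ)⁻¹ *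
          ∫ z : D₂, f z ∂(((P k x).bind Q).bind (R (n - 1 - k)))) := by
    rw [h.integral_left hD₁ hD₂ hfint₁ (fun k _ => hfint₂ k _), mul_add, Finset.mul_sum,
      Finset.mul_sum]
    congr 1
    refine Finset.sum_congr rfl fun k hk => ?_
    have hk' := Finset.mem_range.1 hk
    have e2 : n = 1 + k + (n - 1 - k) := by omega
    have e3 : θ⁻¹ ^ n = θ⁻¹ * θ⁻¹ ^ k * θ⁻¹ ^ (n - 1 - k) := by
      rw [← pow_succ', ← pow_add, add_comm k 1, ← e2]
    rw [e3, pow_add, pow_one, mul_inv]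
    ring
  -- the comparison of the `k`-th term with `((n-1-k)/n)^ℓ L`
  have hterm : ∀ k ∈ Finset.range n, |θ⁻¹ ^ k * (θ⁻¹ ^ (n - 1 - k) * ((n : ℝ) ^ ℓ)⁻¹ *
        ∫ z : D₂, f z ∂(((P k x).bind Q).bind (R (n - 1 - k)))) -
        (((n - 1 - k : ℕ) : ℝ) / n) ^ ℓ * L| ≤
      (1 + BR) * (M + BP) * (αR (n - 1 - k) * (((n - 1 - k : ℕ) : ℝ) / n) ^ ℓ + ℓ / n) * w +
        (1 + BP) * BR * αP k * w := fun k hk => by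
    have hk' := Finset.mem_range.1 hk
    have hmn : n - 1 - k ≤ n := by omega
    set m := n - 1 - k
    have hαm := hαR m
    have hq0 : 0 ≤ ((m : ℝ) / n) ^ ℓ := by positivity
    have hmix := abs_integral_bind_sub_le (μ := (P k x).bind Q) (κ := R m) (lam := Λℓ)
      (f := fun z : D₂ => f z) (W := WR) (c := θ⁻¹ ^ m * ((n : ℝ) ^ ℓ)⁻¹) (c' := ((m : ℝ) / n) ^ ℓ)
      (ε := (1 + BR) * (αR m * ((m : ℝ) / n) ^ ℓ + ℓ / n) * N)
      (by positivity) (by positivity) (hμ k) (hfint₂ k _) (hfintΛ k) (by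
        filter_upwards [hℓ k] with y hy
        rw [integral_levelKernel]
        refine (hR.scaled_estimate (h.R_zero y) hn hmn hy hf₂m hf₂).trans (le_of_eq ?_)
        ring)
    have hlast := hP.scaled_estimate (h.P_zero x) hn hk'.le (hjP x).le hgm hgN
    rw [if_pos (hjP x), pow_zero, pow_zero, inv_one, mul_one, one_mul, mul_one, Nat.cast_zero,
      zero_div, add_zero] at hlast
    rw [hgP] at hmix
    set I₁ := ∫ z : D₂, f z ∂(((P k x).bind Q).bind (R m))
    set I₂ := ∫ z, g z ∂(P k x)
    have e : θ⁻¹ ^ k * (θ⁻¹ ^ m * ((n : ℝ) ^ ℓ)⁻¹ * I₁) - ((m : ℝ) / n) ^ ℓ * L =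
        θ⁻¹ ^ k * (θ⁻¹ ^ m * ((n : ℝ) ^ ℓ)⁻¹ * I₁ - ((m : ℝ) / n) ^ ℓ * I₂) +
          ((m : ℝ) / n) ^ ℓ * (θ⁻¹ ^ k * I₂ - L) := by ring
    rw [e]
    refine (abs_add_le _ _).trans (add_le_add ?_ ?_)
    · rw [abs_mul, abs_of_nonneg (by positivity : 0 ≤ θ⁻¹ ^ k)]
      refine (mul_le_mul_of_nonneg_left hmix (by positivity)).trans (le_of_eq ?_)
      rw [hw, inv_pow]
      field_simp
    · rw [abs_mul, abs_of_nonneg hq0]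
      refine (mul_le_mul (div_pow_le_one hmn ℓ) hlast (abs_nonneg _) zero_le_one).trans
        (le_of_eq ?_)
      rw [hw]; ring
  have hrefl : ∀ u : ℕ → ℝ,
      ∑ k ∈ Finset.range n, u (n - 1 - k) = ∑ k ∈ Finset.range n, u k := fun u =>
    Finset.sum_range_reflect u n
  set A := ∑ k ∈ Finset.range n, θ⁻¹ ^ k * (θ⁻¹ ^ (n - 1 - k) * ((n : ℝ) ^ ℓ)⁻¹ *
          ∫ z : D₂, f z ∂(((P k x).bind Q).bind (R (n - 1 - k)))) with hA
  set V := ∑ m ∈ Finset.range n, ((m : ℝ) / n) ^ ℓ with hV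
  set sP := ∑ k ∈ Finset.range n, αP k with hsP
  set sR := ∑ m ∈ Finset.range n, αR m * ((m : ℝ) / n) ^ ℓ with hsR
  have hsP0 : 0 ≤ sP := Finset.sum_nonneg fun k _ => hαP k
  have hsR0 : 0 ≤ sR := Finset.sum_nonneg fun k _ => mul_nonneg (hαR k) (by positivity)
  have hsum : |A - V * L| ≤ ((1 + BR) * (M + BP) * (sR + ℓ) + (1 + BP) * BR * sP) * w := by
    have e1 : A - V * L = ∑ k ∈ Finset.range n,
        (θ⁻¹ ^ k * (θ⁻¹ ^ (n - 1 - k) * ((n : ℝ) ^ ℓ)⁻¹ *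
          ∫ z : D₂, f z ∂(((P k x).bind Q).bind (R (n - 1 - k)))) -
        (((n - 1 - k : ℕ) : ℝ) / n) ^ ℓ * L) := by
      rw [Finset.sum_sub_distrib, ← Finset.sum_mul, hrefl fun m => ((m : ℝ) / n) ^ ℓ]
    rw [e1]
    refine (Finset.abs_sum_le_sum_abs _ _).trans ((Finset.sum_le_sum hterm).trans (le_of_eq ?_))
    rw [Finset.sum_add_distrib, ← Finset.sum_mul, ← Finset.sum_mul, ← Finset.mul_sum,
      ← Finset.mul_sum, hrefl fun m => αR m * ((m : ℝ) / n) ^ ℓ + ℓ / n, Finset.sum_add_distrib,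
      Finset.sum_const, Finset.card_range, nsmul_eq_mul, mul_div_cancel₀ _ hn'.ne']
    ring
  have hVb : |V / n - 1 / (1 + ℓ)| ≤ ℓ / n := abs_sum_div_pow_sub_le hn ℓ
  have hfirst : |θ⁻¹ ^ n * ((n : ℝ) ^ (1 + ℓ))⁻¹ * (∫ z : D₁, f z ∂(P n x))| ≤
      (M + BP) / n * w := by
    have h1 := abs_integral_le_of_lintegral_le hN (by positivity) (Eventually.of_forall hf₁) (hPk n)
    rw [abs_mul, abs_of_nonneg (by positivity)]
    have h2 : ((n : ℝ) ^ (1 + ℓ))⁻¹ ≤ (n : ℝ)⁻¹ :=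
      inv_anti₀ hn' (le_self_pow₀ hn1 (by omega))
    calc θ⁻¹ ^ n * ((n : ℝ) ^ (1 + ℓ))⁻¹ * |∫ z : D₁, f z ∂(P n x)|
        ≤ θ⁻¹ ^ n * (n : ℝ)⁻¹ * (N * ((M + BP) * θ ^ n * WP x)) := by gcongr
      _ = _ := by rw [hw, inv_pow]; field_simp
  -- `α_{P,0} = 1` absorbs the contribution of `P_n`
  have hone : 1 ≤ sP := by
    have := Finset.single_le_sum (f := αP) (fun k _ => hαP k) (Finset.mem_range.2 hn)
    rwa [hP.rate_zero] at this
  have hrate : ∀ C, 0 ≤ C → C / n * (ℓ + sP + sR) ≤ rateA3 C ℓ αP αR n := fun C hC => by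
    rw [rateA3, add_assoc, hsP, hsR, ← Finset.sum_add_distrib]
    gcongr
    simp_rw [div_pow]
    refine Finset.sum_le_sum_of_subset_of_nonneg
      (Finset.range_subset_range.2 (Nat.le_succ n)) fun k _ _ =>
      add_nonneg (hαP k) (mul_nonneg (hαR k) (by positivity))
  set C := (M + BP) + θ⁻¹ * ((1 + BR) * (M + BP) + (1 + BP) * BR + BP * BR) with hC
  have hC0 : 0 ≤ C := by positivity
  have hℓ0 : (0 : ℝ) ≤ ℓ := ℓ.cast_nonneg
  rw [hS, hlim]
  have e : θ⁻¹ ^ n * ((n : ℝ) ^ (1 + ℓ))⁻¹ * (∫ z : D₁, f z ∂(P n x)) + θ⁻¹ / n * A -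
      θ⁻¹ / (1 + ℓ) * L = θ⁻¹ ^ n * ((n : ℝ) ^ (1 + ℓ))⁻¹ * (∫ z : D₁, f z ∂(P n x)) +
        (θ⁻¹ / n * (A - V * L) + θ⁻¹ * (V / n - 1 / (1 + ℓ)) * L) := by
    field_simp
    ring
  rw [e]
  have h2 : |θ⁻¹ / n * (A - V * L)| ≤
      θ⁻¹ / n * (((1 + BR) * (M + BP) * (sR + ℓ) + (1 + BP) * BR * sP) * w) := by
    rw [abs_mul, abs_of_nonneg (by positivity : 0 ≤ θ⁻¹ / n)]
    gcongr
  have h3 : |θ⁻¹ * (V / n - 1 / (1 + ℓ)) * L| ≤ θ⁻¹ * (ℓ / n) * (BP * BR * w) := by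
    rw [abs_mul, abs_mul, abs_of_nonneg (by positivity : 0 ≤ θ⁻¹)]
    gcongr
  set T := ℓ + sP + sR with hT
  have hT0 : 0 ≤ T := by positivity
  have hTP : 1 ≤ T := by linarith
  have hTP' : sP ≤ T := by linarith
  have hTR : sR + ℓ ≤ T := by linarith
  have hTℓ : (ℓ : ℝ) ≤ T := by linarith
  calc _ ≤ (M + BP) / n * w +
        (θ⁻¹ / n * (((1 + BR) * (M + BP) * (sR + ℓ) + (1 + BP) * BR * sP) * w) +
          θ⁻¹ * (ℓ / n) * (BP * BR * w)) :=
        (abs_add_le _ _).trans (add_le_add hfirst ((abs_add_le _ _).trans (add_le_add h2 h3)))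
    _ = ((M + BP) * 1 + θ⁻¹ * ((1 + BR) * (M + BP) * (sR + ℓ) + (1 + BP) * BR * sP +
          BP * BR * ℓ)) / n * w := by field_simp
    _ ≤ ((M + BP) * T + θ⁻¹ * ((1 + BR) * (M + BP) * T + (1 + BP) * BR * T +
          BP * BR * T)) / n * w := by gcongr
    _ = C / n * T * w := by rw [hC]; ring
    _ ≤ rateA3 C ℓ αP αR n * w := mul_le_mul_of_nonneg_right (hrate C hC0) hw0
    _ = _ := by rw [hw]; ring

end Third

section ThirdCase

variable {D : Type*} [MeasurableSpace D] {D₁ D₂ : Set D} {WP : D₁ → ℝ} {WR : D₂ → ℝ}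
  {S : ℕ → Kernel D D} {P : ℕ → Kernel D₁ D₁} {Q : Kernel D₁ D₂} {R : ℕ → Kernel D₂ D₂}
  {ΛP : Kernel D₁ D₁} {ΛR : Kernel D₂ D₂} {jP : D₁ → ℕ} {j : D₂ → ℕ} {αP αR : ℕ → ℝ} {θ BP BR : ℝ}

/-- By quasi-stationarity, a set which is not charged by `Λ(x, ·) Q` is not charged by the entrance
laws `Λ(x, ·) P_m Q` either. -/
theorem ConvergesToKernel.limit_bind_eq_zero (h : IsTriangular S P Q R)
    (hP : ConvergesToKernel P WP ΛP jP αP θ BP) (ha : Tendsto αP atTop (𝓝 0))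
    (hjP : ∀ x, jP x = 0) (hQ : JumpBound Q WP WR) (hWR : ∀ y, 1 ≤ WR y) {A : Set D₂}
    (hA : MeasurableSet A) {x : D₁} (h0 : ((ΛP x).bind Q) A = 0) (m : ℕ) :
    (((ΛP x).bind (P m)).bind Q) A = 0 := by
  have hle : ∀ z, Q z A ≤ ENNReal.ofReal (WP z) := fun z => by
    refine le_trans ?_ (hQ z)
    calc Q z A ≤ Q z Set.univ := measure_mono (Set.subset_univ A)
      _ = ∫⁻ _, 1 ∂(Q z) := lintegral_one.symm
      _ ≤ _ := lintegral_mono fun y => ENNReal.one_le_ofReal.2 (hWR y)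
  have hm : Measurable fun z => Q z A := Q.measurable_coe hA
  have hf : ∀ z, |(Q z A).toReal| ≤ 1 * WP z := fun z => by
    rw [one_mul, abs_of_nonneg ENNReal.toReal_nonneg]
    exact ENNReal.toReal_le_of_le_ofReal (hP.W_pos z).le (hle z)
  have hof : ∀ z, ENNReal.ofReal (Q z A).toReal = Q z A := fun z =>
    ENNReal.ofReal_toReal (ne_top_of_le_ne_top ENNReal.ofReal_ne_top (hle z))
  obtain ⟨hint, heq⟩ := hP.integral_limit_bind ha h.P_zero h.P_add hjP hm.ennreal_toReal
    zero_le_one hf x m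
  rw [Measure.bind_apply hA Q.aemeasurable] at h0 ⊢
  have hzero : ∫ z, (Q z A).toReal ∂(ΛP x) = 0 := by
    rw [integral_eq_lintegral_of_nonneg_ae (Eventually.of_forall fun z => ENNReal.toReal_nonneg)
      hm.ennreal_toReal.aestronglyMeasurable]
    simp_rw [hof]
    rw [h0, ENNReal.toReal_zero]
  rw [hzero, mul_zero] at heq
  have := ofReal_integral_eq_lintegral_ofReal hint
    (Eventually.of_forall fun z => ENNReal.toReal_nonneg)
  simp_rw [hof] at this
  rw [← this, heq, ENNReal.ofReal_zero]

theorem bind_levelKernel_univ_ne_zero (hjm : Measurable j) {ℓ : ℕ} {μ : Measure D₂}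
    (h : μ {y | j y = ℓ ∧ ΛR y Set.univ ≠ 0} ≠ 0) :
    (μ.bind (levelKernel ΛR j hjm ℓ)) Set.univ ≠ 0 := by
  rw [Measure.bind_apply MeasurableSet.univ (Kernel.aemeasurable _)]
  intro h0
  rw [lintegral_eq_zero_iff ((levelKernel ΛR j hjm ℓ).measurable_coe MeasurableSet.univ)] at h0
  refine h (measure_eq_zero_iff_ae_notMem.2 ?_)
  filter_upwards [h0] with y hy
  rintro ⟨h1, h2⟩
  rw [levelKernel_of_eq hjm h1] at hy
  exact h2 hy

open scoped Classical in
/-- If the exponential parameters of the two blocks agree, Assumption (A) passes from `P` and `R`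
to `S`, with an additional polynomial factor on `D₁`. -/
theorem third_case {I J : Type*} (h : IsTriangular S P Q R) (hD₁ : MeasurableSet D₁)
    (hD₂ : MeasurableSet D₂) (hD : IsCompl D₁ D₂) {ηP : I → D₁ → ℝ} {νP : I → Measure D₁}
    {ηR : J → D₂ → ℝ} {νR : J → Measure D₂} {ℓ : ℕ}
    (hαP0 : αP 0 = 1) (hαR0 : αR 0 = 1) (hjP : ∀ x, jAt P x = 0) (hfinJ : FiniteJ₀ R)
    (hθRP : expParam₀ R = expParam₀ P) (HP : AssumptionA P WP ηP νP αP)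
    (hηP : ∀ x, ∃ k, 0 < ηP k x) (HR : AssumptionA R WR ηR νR αR) (hQ : JumpBound Q WP WR)
    (hle : ∀ x k, ∀ᵐ y ∂((P k x).bind Q), jAt R y ≤ ℓ)
    (hpos : ∀ k, ∃ m, (((νP k).bind (P m)).bind Q) {y | jAt R y = ℓ ∧ ∃ i, 0 < ηR i y} ≠ 0) :
    expParam₀ S = expParam₀ R ∧ expParam₀ S = expParam₀ P ∧
    (∀ x : D₁, jAt S x = 1 + ℓ) ∧ (∀ y : D₂, jAt S y = jAt R y) ∧
    ∃ C : ℝ, 0 < C ∧ ∀ η : J → D → ℝ, (∀ i (y : D₂), η i y = ηR i y) →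
      (∀ i (x : D₁), η i x = (theta₀ P)⁻¹ / (1 + ℓ) *
        ∫ y, (if jAt R y = ℓ then ηR i y else 0) ∂((limitMeasure ηP νP x).bind Q)) →
      AssumptionA S (fun x => ext WP x + ext WR x) η (fun i => (νR i).map Subtype.val)
        (fun n => max (rateA3 C ℓ αP αR n) (αR n)) ∧
      (∀ x ∈ D₁, ConvergesAt S (fun x => ext WP x + ext WR x) η
        (fun i => (νR i).map Subtype.val) (rateA3 C ℓ αP αR) x) ∧
      (∀ x ∈ D₂, ConvergesAt S (fun x => ext WP x + ext WR x) η
        (fun i => (νR i).map Subtype.val) αR x) := by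
  have hI := HR.countable
  obtain ⟨ΛP, jP, BP, hΛP, hjP', hA⟩ := HP.exists_convergesToKernel hαP0
  obtain ⟨ΛR, j, BR, hΛR, hj, hB⟩ := HR.exists_convergesToKernel hαR0
  have hjP0 : ∀ x, jP x = 0 := fun x => by
    have := (hjP' x).symm.trans (hjP x)
    exact_mod_cast this
  have hθeq : theta₀ R = theta₀ P := by rw [theta₀, hθRP, theta₀]
  rw [hθeq] at hB
  set θ := theta₀ P with hθdef
  have hθ : 0 < θ := HP.theta₀_pos
  have hexpP : expParam₀ P = ENNReal.ofReal θ := HP.expParam₀_eq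
  have hexpR : expParam₀ R = ENNReal.ofReal θ := hθRP.trans hexpP
  have hBP := hA.bound_nonneg
  have hBR := hB.bound_nonneg
  have hjm : Measurable j := hB.measurable_j h.finite_R hexpR hj HR.tendsto_rate
  obtain ⟨M, hM⟩ := exists_le_of_tendsto HP.tendsto_rate
  have hM1 : 1 ≤ M := hαP0 ▸ hM 0
  have hJ : ∀ y, j y ≤ ⌈j₀ R⌉₊ := fun y => by
    have h1 : jAt R y ≤ j₀ R := le_ciSup hfinJ y
    rw [hj] at h1
    exact_mod_cast h1.trans (Nat.le_ceil _)
  have hℓ : ∀ x k, ∀ᵐ y ∂((P k x).bind Q), j y ≤ ℓ := fun x k => by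
    filter_upwards [hle x k] with y hy
    rw [hj] at hy
    exact_mod_cast hy
  set C := (M + BP) + θ⁻¹ * ((1 + BR) * (M + BP) + (1 + BP) * BR + BP * BR) with hC
  have hC0 : 0 < C := by positivity
  set Λ : D₁ → Measure D := fun x => ((ENNReal.ofReal (θ⁻¹ / (1 + ℓ)) • (ΛP x).bind Q).bind
    (levelKernel ΛR j hjm ℓ)).map Subtype.val with hΛdef
  have hW : ∀ z, 1 ≤ ext WP z + ext WR z := one_le_ext_add_ext hD hA.one_le_W hB.one_le_W
  have hrate : Tendsto (rateA3 C ℓ αP αR) atTop (𝓝 0) :=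
    tendsto_rateA3 HP.tendsto_rate HR.tendsto_rate hB.rate_nonneg
  have hleft := fun (x : D₁) (n : ℕ) (f : D → ℝ) (N : ℝ) (hn : 1 ≤ n) (hf : Measurable f)
    (hN : 0 ≤ N) (hfN : ∀ z, |f z| ≤ N * (ext WP z + ext WR z)) =>
    third_estimate_left h hA hjP0 hB hjm hD₁ hD₂ hD hQ hM hJ (hℓ x) hn hf hN hfN
  have hright := fun (y : D₂) (n : ℕ) (f : D → ℝ) (N : ℝ) (hn : 1 ≤ n) (hf : Measurable f)
    (hfN : ∀ z, |f z| ≤ N * (ext WP z + ext WR z)) =>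
    estimate_right (y := y) h hB hD₂ hD hn hf hfN
  have hone : ∀ z : D, |(1 : ℝ)| ≤ 1 * (ext WP z + ext WR z) := fun z => by
    rw [abs_one, one_mul]; exact hW z
  have hrlim : ∀ x : D₁, Tendsto (fun n => rateA3 C ℓ αP αR n * WP x * 1) atTop (𝓝 0) :=
    fun x => by
      have := (hrate.mul_const (WP x)).mul_const 1
      simpa using this
  have hbl : ∀ x : D₁, ∃ C : ℝ, ∀ n : ℕ, 1 ≤ n →
      S n x Set.univ ≤ ENNReal.ofReal (C * (n : ℝ) ^ (1 + ℓ) * θ ^ n) := fun x =>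
    exists_mass_bound hθ (fun n => h.finite n x) (hrlim x) fun n hn =>
      hleft x n (fun _ => 1) 1 hn measurable_const zero_le_one hone
  have hbr : ∀ y : D₂, ∃ C : ℝ, ∀ n : ℕ, 1 ≤ n →
      S n y Set.univ ≤ ENNReal.ofReal (C * (n : ℝ) ^ j y * θ ^ n) := fun y => by
    refine exists_mass_bound (r := fun n => αR n * WR y * 1) hθ (fun n => h.finite n y) ?_
      fun n hn => hright y n (fun _ => 1) 1 hn measurable_const hone
    have := (HR.tendsto_rate.mul_const (WR y)).mul_const 1
    simpa using this
  have hexp : expParam₀ S = ENNReal.ofReal θ := by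
    refine expParam₀_eq_of_bounds hθ (hexpR ▸ h.expParam₀_le_right)
      (forall_of_isCompl hD (fun x => ?_) (fun y => ?_))
    · obtain ⟨C, hC⟩ := hbl x
      exact ⟨_, C, hC⟩
    · obtain ⟨C, hC⟩ := hbr y
      exact ⟨_, C, hC⟩
  have hθS : theta₀ S = θ := by rw [theta₀, hexp, ENNReal.toReal_ofReal hθ.le]
  have hSR : expParam₀ S = expParam₀ R := hexp.trans hexpR.symm
  have hcθ : 0 < θ⁻¹ / (1 + ℓ) := by positivity
  have hΛQ : ∀ x, ∫⁻ y, ENNReal.ofReal (WR y) ∂((ΛP x).bind Q) ≤ ENNReal.ofReal (BP * WP x) :=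
    fun x => lintegral_bind_jump_le hB.measurable_W hQ (hA.lintegral_limit_le x)
  have hΛQ' : ∀ x, ∫⁻ y, ENNReal.ofReal (WR y)
      ∂(ENNReal.ofReal (θ⁻¹ / (1 + ℓ)) • (ΛP x).bind Q) ≤
        ENNReal.ofReal (θ⁻¹ / (1 + ℓ) * (BP * WP x)) := fun x => by
    rw [lintegral_smul_measure, smul_eq_mul, ENNReal.ofReal_mul hcθ.le]
    gcongr
    exact hΛQ x
  have hboundl : ∀ x : D₁, ∫⁻ z, ENNReal.ofReal (ext WP z + ext WR z) ∂(Λ x) ≤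
      ENNReal.ofReal (BR * (θ⁻¹ / (1 + ℓ)) * BP * WP x) := fun x => by
    rw [hΛdef, lintegral_map_val_right hD₂ hD]
    refine (lintegral_bind_ofReal_le hBR hB.measurable_W (fun y =>
      (lintegral_levelKernel_le hjm ℓ y _).trans (hB.lintegral_limit_le y)) (hΛQ' x)).trans
      (le_of_eq ?_)
    congr 1
    ring
  -- this positivity is what gives the lower bound `j_S ≥ 1 + ℓ` on `D₁`: the components of
  -- `Λ_P(x, ·)` put mass on entrance points of top level at some time, hence at time `1`
  have hposΛ : ∀ x, Λ x Set.univ ≠ 0 := fun x => by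
    rw [hΛdef, Measure.map_apply measurable_subtype_coe MeasurableSet.univ, Set.preimage_univ]
    refine bind_levelKernel_univ_ne_zero hjm ?_
    rw [Measure.smul_apply, smul_eq_mul]
    refine mul_ne_zero (ENNReal.ofReal_pos.2 hcθ).ne' fun h0 => ?_
    have hAm : MeasurableSet {y | j y = ℓ ∧ ΛR y Set.univ ≠ 0} :=
      (hjm (measurableSet_singleton ℓ)).inter
        ((ΛR.measurable_coe MeasurableSet.univ) (measurableSet_singleton 0).compl)
    obtain ⟨k, hk⟩ := hηP x
    obtain ⟨m, hm⟩ := hpos k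
    have h1 := hA.limit_bind_eq_zero h HP.tendsto_rate hjP0 hQ hB.one_le_W hAm h0 m
    rw [Measure.bind_bind (P m).aemeasurable Q.aemeasurable] at hm h1
    have hm2 : Measurable fun z => (P m z).bind Q :=
      (Measure.measurable_bind' Q.measurable).comp (P m).measurable
    rw [hΛP, Measure.bind_apply hAm hm2.aemeasurable, lintegral_limitMeasure,
      ENNReal.tsum_eq_zero] at h1
    have h2 := (mul_eq_zero.1 (h1 k)).resolve_left (ENNReal.ofReal_pos.2 hk).ne'
    rw [← Measure.bind_apply hAm hm2.aemeasurable] at h2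
    refine hm (measure_mono_null ?_ h2)
    rintro y ⟨hy1, i, hi⟩
    refine ⟨by rw [hj] at hy1; exact_mod_cast hy1, fun h3 => ?_⟩
    have := HR.prob i
    rw [hΛR, ← lintegral_one, lintegral_limitMeasure, ENNReal.tsum_eq_zero] at h3
    have h4 := h3 i
    rw [lintegral_one, measure_univ, mul_one] at h4
    exact (ENNReal.ofReal_pos.2 hi).ne' h4
  have hjl : ∀ x : D₁, jAt S x = (1 + ℓ : ℕ) := fun x => by
    obtain ⟨C', hC'⟩ := hbl x
    have hC'' : ∀ n : ℕ, 1 ≤ n → ((Measure.dirac (x : D)).bind (S n)) Set.univ ≤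
        ENNReal.ofReal (C' * (n : ℝ) ^ (1 + ℓ) * θ ^ n) := fun n hn => by
      rw [dirac_bind_kernel]; exact hC' n hn
    refine le_antisymm (polyParam_le_of_bound hθ hexp hC'')
      (le_polyParam hθ hexp hC'' fun r _ hr => ?_)
    have hint : Integrable (fun _ : D => (1 : ℝ)) (Λ x) :=
      integrable_of_lintegral_le measurable_const zero_le_one hone (hboundl x)
    rw [hexp]
    refine liminf_scaledMass_ne_zero_of_tendsto (p := ∫ _, (1 : ℝ) ∂(Λ x)) hθ
      (fun n => h.finite n x) ?_ ?_ hr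
    · rw [integral_const, smul_eq_mul, mul_one]
      rw [integrable_const_iff_isFiniteMeasure one_ne_zero] at hint
      exact ENNReal.toReal_pos (hposΛ x) (measure_ne_top _ _)
    · rw [tendsto_iff_norm_sub_tendsto_zero]
      refine squeeze_zero' (Eventually.of_forall fun n => norm_nonneg _) ?_ (hrlim x)
      filter_upwards [eventually_ge_atTop 1] with n hn
      exact hleft x n (fun _ => 1) 1 hn measurable_const zero_le_one hone
  have hjr : ∀ y : D₂, jAt S y = j y := fun y => (h.jAt_right hSR y).trans (hj y)
  refine ⟨hSR, hexp.trans hexpP.symm, fun x => by rw [hjl]; push_cast; rfl, h.jAt_right hSR, C, hC0,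
    fun η hηr hηl => ?_⟩
  have hif : ∀ i y, (if jAt R y = ℓ then ηR i y else 0) = if j y = ℓ then ηR i y else 0 :=
    fun i y => by simp only [hj, Nat.cast_inj]
  have hifm : ∀ i, Measurable fun y => if j y = ℓ then ηR i y else 0 := fun i =>
    Measurable.ite (hjm (measurableSet_singleton ℓ)) (HR.mem_eta i).1 measurable_const
  have hif0 : ∀ i y, 0 ≤ if j y = ℓ then ηR i y else 0 := fun i y => by
    split_ifs
    · exact HR.eta_nonneg i y
    · exact le_rfl
  have hifN : ∀ i y, |if j y = ℓ then ηR i y else 0| ≤ normW WR (ηR i) * WR y :=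
    fun i y => by
      split_ifs
      · exact abs_le_normW_mul hB.one_le_W (HR.mem_eta i) y
      · rw [abs_zero]
        exact mul_nonneg (normW_nonneg hB.one_le_W _) (hB.W_pos y).le
  have hηl' : ∀ i (x : D₁), η i x = θ⁻¹ / (1 + ℓ) *
      ∫ y, (if j y = ℓ then ηR i y else 0) ∂((ΛP x).bind Q) := fun i x => by
    rw [hηl, hΛP]; simp_rw [hif]
  have hη0 : ∀ i x, 0 ≤ η i x := fun i => forall_of_isCompl hD
    (fun x => by rw [hηl']; exact mul_nonneg hcθ.le (integral_nonneg (hif0 i)))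
    (fun y => by rw [hηr]; exact HR.eta_nonneg i y)
  have hliml : ∀ x : D₁, limitMeasure η (fun i => (νR i).map Subtype.val) x = Λ x := fun x =>
    limitMeasure_bind_level hΛR hjm (fun i => (HR.mem_eta i).1) HR.eta_nonneg
      (fun i => integrable_of_lintegral_le (hifm i) (normW_nonneg hB.one_le_W _) (hifN i) (hΛQ' x))
      fun i => by
        rw [hηl', integral_smul_measure, ENNReal.toReal_ofReal hcθ.le, smul_eq_mul]
  have hlimr : ∀ y : D₂, limitMeasure η (fun i => (νR i).map Subtype.val) y =
      (ΛR y).map Subtype.val := fun y => by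
    rw [hΛR]; exact limitMeasure_map_right νR fun i => hηr i y
  have hboundr : ∀ y : D₂, ∫⁻ z, ENNReal.ofReal (ext WP z + ext WR z)
      ∂((ΛR y).map Subtype.val) ≤ ENNReal.ofReal (BR * WR y) := fun y => by
    rw [lintegral_map_val_right hD₂ hD]; exact hB.lintegral_limit_le y
  have hηm : ∀ i, Measurable (η i) := fun i => by
    refine measurable_of_blocks hD₁ hD₂ hD ?_ ?_
    · simp_rw [hηl', ← Kernel.comp_apply]
      exact (StronglyMeasurable.integral_kernel (κ := Q ∘ₖ ΛP)
        (hifm i).stronglyMeasurable).measurable.const_mul _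
    · simp_rw [hηr]
      exact (HR.mem_eta i).1
  have hconvl : ∀ x : D₁, ConvergesAt S (fun x => ext WP x + ext WR x) η
      (fun i => (νR i).map Subtype.val) (rateA3 C ℓ αP αR) x := fun x => by
    refine convergesAt_of_limitMeasure hW (fun i => hη0 i x) ((hliml x).symm ▸ hboundl x) (hjl x)
      fun n f N hn hf hN hfN => ?_
    rw [hθS, hliml, ext_add_ext_left hD]
    exact hleft x n f N hn hf hN hfN
  have hconvr : ∀ y : D₂, ConvergesAt S (fun x => ext WP x + ext WR x) η
      (fun i => (νR i).map Subtype.val) αR y := fun y => by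
    refine convergesAt_of_limitMeasure hW (fun i => hη0 i y) ((hlimr y).symm ▸ hboundr y) (hjr y)
      fun n f N hn hf hN hfN => ?_
    rw [hθS, hlimr, ext_add_ext_right hD]
    exact hright y n f N hn hf hfN
  have hWm : Measurable fun z => ext WP z + ext WR z :=
    (measurable_ext hD₁ hA.measurable_W).add (measurable_ext hD₂ hB.measurable_W)
  have := HR.prob
  have hmax : 0 ≤ BR * (θ⁻¹ / (1 + ℓ)) * BP := by positivity
  refine ⟨assumptionA_of_limitMeasure (B := BR * (θ⁻¹ / (1 + ℓ)) * BP + BR) hexp hθ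
    HP.theta₀_le_one (forall_of_isCompl hD (fun x => ⟨_, hjl x⟩) (fun y => ⟨_, hjr y⟩))
    hWm hW hI
    (fun i => Measure.isProbabilityMeasure_map measurable_subtype_coe.aemeasurable) hηm hη0
    (fun i => ?_) (forall_of_isCompl hD (fun x => ?_) (fun y => ?_))
    (fun n => forall_of_isCompl hD (fun x => ?_) (fun y => ?_))
    (by simpa using hrate.max HR.tendsto_rate)
    (forall_of_isCompl hD (fun x => (hconvl x).mono hW fun n => le_max_left _ _)
      (fun y => (hconvr y).mono hW fun n => le_max_right _ _)),
    fun x hx => hconvl ⟨x, hx⟩, fun y hy => hconvr ⟨y, hy⟩⟩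
  · obtain ⟨y, hy⟩ := HR.eta_ne_zero i
    exact ⟨y, by rw [hηr]; exact hy⟩
  · rw [hliml, ext_add_ext_left hD]
    refine (hboundl x).trans (ENNReal.ofReal_le_ofReal ?_)
    exact mul_le_mul_of_nonneg_right (le_add_of_nonneg_right hBR) (hA.W_pos x).le
  · rw [hlimr, ext_add_ext_right hD]
    refine (hboundr y).trans (ENNReal.ofReal_le_ofReal ?_)
    exact mul_le_mul_of_nonneg_right (le_add_of_nonneg_left hmax) (hB.W_pos y).le
  · refine h.integrable_left hD₁ hD₂ ?_ fun k _ => ?_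
    · simp_rw [ext_add_ext_left hD]
      exact hA.integrable_W n x
    · simp_rw [ext_add_ext_right hD]
      obtain ⟨M', hM0, hM'⟩ := hB.exists_lintegral_le h.R_zero hJ (n - 1 - k)
      exact integrable_of_lintegral_le hB.measurable_W zero_le_one
        (fun z => by rw [one_mul, abs_of_nonneg (hB.W_pos z).le])
        (lintegral_bind_ofReal_le hM0 hB.measurable_W hM'
          (lintegral_bind_jump_le hB.measurable_W hQ (hA.lintegral_eq_ofReal_integral k x).le))
  · refine h.integrable_right hD₂ ?_
    simp_rw [ext_add_ext_right hD]
    exact hB.integrable_W n y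

end ThirdCase

/-! ### The explicit functions in terms of the kernels -/

section ExplicitEta

variable {D Ω : Type*} [MeasurableSpace D] [MeasurableSpace Ω] {D₁ D₂ : Set D}
  {κ : Kernel (D ⊕ Unit) (D ⊕ Unit)} {Pr : Kernel D Ω} {X : ℕ → Ω → D ⊕ Unit}

theorem exists_pos_of_tsum_pos {I : Type*} {f : I → ℝ} (h : 0 < ∑' i, f i) : ∃ i, 0 < f i := by
  by_contra! hf
  exact absurd (tsum_nonpos hf) (not_le.2 h)

theorem measurable_level {E : Type*} [MeasurableSpace E] {jR g : E → ℝ} (hj : Measurable jR)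
    (hg : Measurable g) (r : ℝ) [DecidablePred fun y => jR y = r] :
    Measurable fun y => if jR y = r then g y else 0 :=
  Measurable.ite (hj (measurableSet_singleton r)) hg measurable_const

theorem abs_level_le {E : Type*} [MeasurableSpace E] {jR g W : E → ℝ} (hW : ∀ y, 1 ≤ W y)
    (hg : MemLW W g) (r : ℝ) [DecidablePred fun y => jR y = r] (y : E) :
    |if jR y = r then g y else 0| ≤ normW W g * W y := by
  split_ifs
  · exact abs_le_normW_mul hW hg y
  · rw [abs_zero]
    exact mul_nonneg (normW_nonneg hW g) (zero_le_one.trans (hW y))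

open scoped Classical in
/-- The entrance expectation which defines `η` on `D₁` is an integral against `entranceLaw`. The
bounds on `W_P` and `W_R` make the series over the entrance times finite, hence the expectation is not a
junk value. -/
theorem IsAbsorbedMarkovChain.etaA2_left (hX : IsAbsorbedMarkovChain κ Pr X)
    (hD₁ : MeasurableSet D₁) (hD₂ : MeasurableSet D₂) (hD : IsCompl D₁ D₂)
    (hno : ∀ x ∈ D₂, ∀ᵐ ω ∂(Pr x), hitTime X D₁ ω = ⊤) {WP : D₁ → ℝ} {WR : D₂ → ℝ} {γ c θ : ℝ}
    (hc : 0 < c) (hγ : 0 < γ) (hγθ : γ < θ) (hWRm : Measurable WR) (hWR : ∀ y, 1 ≤ WR y)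
    (hWP : ∀ x, 1 ≤ WP x) (hQ : JumpBound (restrictTo D₁ hD₂ (semigroup Pr X 1)) WP WR)
    (hP : GeomBound (fun n => restrictTo D₁ hD₁ (semigroup Pr X n)) WP c γ) {jR g : D₂ → ℝ}
    (hj : Measurable jR) (hg : MemLW WR g) (hg0 : ∀ y, 0 ≤ g y) (r : ℝ) (x : D₁) :
    etaA2 Pr X θ jR g r x = ∫ y, (if jR y = r then g y else 0)
      ∂(entranceLaw (fun n => restrictTo D₁ hD₁ (semigroup Pr X n))
        (restrictTo D₁ hD₂ (semigroup Pr X 1)) θ x) := by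
  have hθ : 0 < θ := hγ.trans hγθ
  have hm := measurable_level hj hg.1 r
  have h0 : ∀ y, 0 ≤ if jR y = r then g y else 0 := fun y => by
    split_ifs
    · exact hg0 y
    · exact le_rfl
  have hint := integrable_of_lintegral_le hm (normW_nonneg hWR g) (abs_level_le hWR hg r)
    (lintegral_entranceLaw_le hc hγ hγθ hWRm hWP hQ hP x)
  have h1 := ofReal_integral_eq_lintegral_ofReal hint (Eventually.of_forall h0)
  have h2 := h1
  rw [lintegral_entranceLaw] at h2
  have h3 := lintegral_entrance hX hD₁ hD₂ hD hno hθ hm h0 x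
    (h2 ▸ ENNReal.ofReal_ne_top)
  rw [← h2] at h3
  refine (ENNReal.ofReal_eq_ofReal_iff (integral_nonneg fun ω => ?_) (integral_nonneg h0)).1 h3
  dsimp only [Pi.zero_apply]
  split_ifs
  · exact mul_nonneg (by positivity) (extB_nonneg h0 _)
  · exact le_rfl

theorem IsAbsorbedMarkovChain.exists_entrance_level (hX : IsAbsorbedMarkovChain κ Pr X)
    (hD₁ : MeasurableSet D₁) (hD₂ : MeasurableSet D₂) (hD : IsCompl D₁ D₂)
    (hno : ∀ x ∈ D₂, ∀ᵐ ω ∂(Pr x), hitTime X D₁ ω = ⊤) {J : Type*} [Countable J] {jR : D₂ → ℝ}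
    (hj : Measurable jR) {ηR : J → D₂ → ℝ} (hη : ∀ i, Measurable (ηR i)) {ν : Measure D₁} {r : ℝ}
    (h : 0 < lawFrom Pr ν {ω | extB jR (hitPos X D₂ ω) = r ∧
      0 < extB (fun y => ∑' i, ηR i y) (hitPos X D₂ ω) ∧ hitTime X D₂ ω < ⊤}) :
    ∃ m, ((ν.bind (restrictTo D₁ hD₁ (semigroup Pr X m))).bind
      (restrictTo D₁ hD₂ (semigroup Pr X 1))) {y | jR y = r ∧ ∃ i, 0 < ηR i y} ≠ 0 := by
  refine exists_entrance_pos hX hD₁ hD₂ hD hno ?_ ν ?_ h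
  · have e : {y | jR y = r ∧ ∃ i, 0 < ηR i y} = jR ⁻¹' {r} ∩ ⋃ i, {y | 0 < ηR i y} := by
      ext y
      simp
    rw [e]
    exact (hj (measurableSet_singleton r)).inter
      (MeasurableSet.iUnion fun i => measurableSet_lt measurable_const (hη i))
  · rintro ω ⟨h1, h2, h3⟩
    refine ⟨h3, ?_⟩
    by_cases hz : hitPos X D₂ ω ∈ Set.range (fun y : D₂ => (Sum.inl (y : D) : D ⊕ Unit))
    · obtain ⟨y, hy⟩ := hz
      rw [← hy, extB_inl_coe] at h1 h2
      exact ⟨y, ⟨h1, exists_pos_of_tsum_pos h2⟩, hy⟩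
    · rw [extB_of_notMem _ hz] at h2
      exact absurd h2 (lt_irrefl 0)

theorem etaA3_right (hD : IsCompl D₁ D₂) {I : Type*} (θ : ℝ) (ℓ : ℕ) (ηP : I → D₁ → ℝ)
    (νP : I → Measure D₁) (jR g : D₂ → ℝ) (y : D₂) : etaA3 Pr X θ ℓ ηP νP jR g y = g y := by
  simp [etaA3, ext_coe, ext_of_notMem _ (Set.disjoint_right.1 hD.disjoint y.2)]

open scoped Classical in
theorem IsAbsorbedMarkovChain.etaA3_left (hX : IsAbsorbedMarkovChain κ Pr X)
    (hD₂ : MeasurableSet D₂) (hD : IsCompl D₁ D₂) {I : Type*} {P : ℕ → Kernel D₁ D₁}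
    {WP : D₁ → ℝ} {WR : D₂ → ℝ} {ηP : I → D₁ → ℝ} {νP : I → Measure D₁} {α : ℕ → ℝ}
    (HP : AssumptionA P WP ηP νP α) (hWRm : Measurable WR) (hWR : ∀ y, 1 ≤ WR y)
    (hQ : JumpBound (restrictTo D₁ hD₂ (semigroup Pr X 1)) WP WR) {jR g : D₂ → ℝ}
    (hj : Measurable jR) (hg : MemLW WR g) (θ : ℝ) (ℓ : ℕ) (x : D₁) :
    etaA3 Pr X θ ℓ ηP νP jR g x = θ⁻¹ / (1 + ℓ) * ∫ y, (if jR y = ℓ then g y else 0)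
      ∂((limitMeasure ηP νP x).bind (restrictTo D₁ hD₂ (semigroup Pr X 1))) := by
  set Q := restrictTo D₁ hD₂ (semigroup Pr X 1)
  set f : D₂ → ℝ := fun y => if jR y = ℓ then g y else 0 with hf
  have hm : Measurable f := measurable_level hj hg.1 ℓ
  have hN := normW_nonneg hWR g
  have hfN : ∀ y, |f y| ≤ normW WR g * WR y := abs_level_le hWR hg ℓ
  have hint : ∀ {μ : Measure D₁} {b : ℝ}, ∫⁻ x, ENNReal.ofReal (WP x) ∂μ ≤ ENNReal.ofReal b →
      Integrable f (μ.bind Q) := fun hμ =>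
    integrable_of_lintegral_le hm hN hfN (lintegral_bind_jump_le hWRm hQ hμ)
  have hν : ∀ k, Integrable f ((νP k).bind Q) := fun k =>
    hint (ofReal_integral_eq_lintegral_ofReal (HP.integrable_W k)
      (Eventually.of_forall fun z => zero_le_one.trans (HP.one_le_W z))).ge
  obtain ⟨B, -, hB⟩ := HP.exists_lintegral_le
  have hΛ := hint (hB x)
  rw [etaA3, ext_of_notMem _ (Set.disjoint_left.1 hD.disjoint x.2), zero_add,
    integral_bind_kernel hΛ, ← (hasSum_integral_limitMeasure (fun k => HP.eta_nonneg k x)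
      (integrable_integral_of_bind hΛ)).tsum_eq]
  congr 2
  funext k
  rw [ext_coe, integral_lawFrom_one hX hD₂ (νP k) hm, integral_bind_kernel (hν k)]

end ExplicitEta

end TwoSets

theorem theorem3p1 {D Ω : Type*} [MeasurableSpace D] [MeasurableSpace Ω]
    (κ : Kernel (D ⊕ Unit) (D ⊕ Unit)) (Pr : Kernel D Ω) (X : ℕ → Ω → D ⊕ Unit)
    (hX : IsAbsorbedMarkovChain κ Pr X)
    (D₁ D₂ : Set D) (hD₁ : MeasurableSet D₁) (hD₂ : MeasurableSet D₂) (hD : IsCompl D₁ D₂)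
    (hno : ∀ x ∈ D₂, ∀ᵐ ω ∂(Pr x), hitTime X D₁ ω = ⊤)
    (S : ℕ → Kernel D D) (hS : S = semigroup Pr X)
    (P : ℕ → Kernel D₁ D₁) (hP : P = fun n => restrictTo D₁ hD₁ (S n))
    (R : ℕ → Kernel D₂ D₂) (hR : R = fun n => restrictTo D₂ hD₂ (S n))
    (Q : Kernel D₁ D₂) (hQ : Q = restrictTo D₁ hD₂ (S 1)) :
    -- case (i)
    (∀ {I : Type*} (WP : D₁ → ℝ) (ηP : I → D₁ → ℝ) (νP : I → Measure D₁) (αP : ℕ → ℝ)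
        (WR : D₂ → ℝ) (γ c : ℝ), αP 0 = 1 →
        AssumptionA1 P Q R WP ηP νP αP WR γ c →
        expParam₀ S = expParam₀ P ∧
        (∀ x, jAt S x = ext (jAt P) x) ∧
        ∃ (C : ℝ) (p : I → ℝ), 0 < C ∧ (∀ i, 0 < p i) ∧
          AssumptionA S (fun x => ext WP x + ext WR x)
            (fun i x => p i * ext (ηP i) x)
            (fun i => ENNReal.ofReal (p i)⁻¹ • measA1 Pr X D₂ (theta₀ S) (νP i))
            (rateA1 C γ (theta₀ P) (j₀ P) αP)) ∧
    -- case (ii)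
    (∀ {I : Type*} (WR : D₂ → ℝ) (ηR : I → D₂ → ℝ) (νR : I → Measure D₂) (αR : ℕ → ℝ)
        (WP : D₁ → ℝ) (γ c : ℝ), αR 0 = 1 →
        AssumptionA2 P Q R WR ηR νR αR WP γ c →
        expParam₀ S = expParam₀ R ∧
        (∀ x : D₁, IsGreatest
          (Set.range fun n : ℕ => polyParam R ((P n x).bind Q)) (jAt S x)) ∧
        (∀ x : D₂, jAt S x = jAt R x) ∧
        ∃ C : ℝ, 0 < C ∧
          AssumptionA S (fun x => ext WP x + ext WR x)
            (fun i x => etaA2 Pr X (theta₀ R) (jAt R) (ηR i)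
              (jAt S x) x)
            (fun i => (νR i).map Subtype.val)
            (rateA2 C γ (theta₀ R) (j₀ R) αR)) ∧
    -- case (iii)
    (∀ {I J : Type*} (WP : D₁ → ℝ) (ηP : I → D₁ → ℝ) (νP : I → Measure D₁) (αP : ℕ → ℝ)
        (WR : D₂ → ℝ) (ηR : J → D₂ → ℝ) (νR : J → Measure D₂) (αR : ℕ → ℝ) (ℓ : ℕ),
        αP 0 = 1 → αR 0 = 1 →
        AssumptionA3 Pr X P Q R WP ηP νP αP WR ηR νR αR ℓ →
        expParam₀ S = expParam₀ R ∧
        expParam₀ S = expParam₀ P ∧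
        (∀ x : D₁, jAt S x = 1 + ℓ) ∧
        (∀ x : D₂, jAt S x = jAt R x) ∧
        ∃ C : ℝ, 0 < C ∧
          AssumptionA S (fun x => ext WP x + ext WR x)
            (fun i => etaA3 Pr X (theta₀ P) ℓ ηP νP (jAt R) (ηR i))
            (fun i => (νR i).map Subtype.val)
            (fun n => max (rateA3 C ℓ αP αR n) (αR n)) ∧
          (∀ x ∈ D₁, ConvergesAt S (fun x => ext WP x + ext WR x)
            (fun i => etaA3 Pr X (theta₀ P) ℓ ηP νP (jAt R) (ηR i))
            (fun i => (νR i).map Subtype.val)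
            (rateA3 C ℓ αP αR) x) ∧
          (∀ x ∈ D₂, ConvergesAt S (fun x => ext WP x + ext WR x)
            (fun i => etaA3 Pr X (theta₀ P) ℓ ηP νP (jAt R) (ηR i))
            (fun i => (νR i).map Subtype.val) αR x)) := by
  subst hS hP hR hQ
  have h := hX.isTriangular hD₁ hD₂ hD hno
  refine ⟨fun WP ηP νP αP WR γ c hα H => ?_, fun WR ηR νR αR WP γ c hα H => ?_,
    fun WP ηP νP αP WR ηR νR αR ℓ hαP hαR H => ?_⟩
  · obtain ⟨h1, h2, C, p, hC, hp, hA⟩ := first_case h hD₁ hD₂ hD hα H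
    refine ⟨h1, h2, C, p, hC, hp, ?_⟩
    simp_rw [measA1_eq hX hD₁ hD₂ hD hno]
    exact hA
  · obtain ⟨h1, h2, h3, C, hC, hA⟩ := second_case h hD₁ hD₂ hD hα H
    have hj := H.assumptionA.measurable_jAt hα h.finite_R
    refine ⟨h1, h2, h3, C, hC, hA _ (fun i y => ?_) fun i x => ?_⟩
    · rw [etaA2, integral_entrance_right hX hD₂ (measurable_level hj (H.assumptionA.mem_eta i).1 _),
        if_pos (h3 y).symm]
    · exact hX.etaA2_left hD₁ hD₂ hD hno H.c_pos H.gamma_pos H.gamma_lt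
        H.assumptionA.measurable_W H.assumptionA.one_le_W H.one_le_WP H.jump H.geom hj
        (H.assumptionA.mem_eta i) (H.assumptionA.eta_nonneg i) _ x
  · have hj := H.assumptionA_R.measurable_jAt hαR h.finite_R
    have := H.assumptionA_R.countable
    obtain ⟨h1, h2, h3, h4, C, hC, hA⟩ := third_case h hD₁ hD₂ hD hαP hαR H.j_P H.finite_j
      H.theta_eq H.assumptionA_P (fun x => exists_pos_of_tsum_pos (H.eta_P_pos x))
      H.assumptionA_R H.jump (fun x k => ae_entrance_le hX hD₁ hD₂ hD hno hj x (H.entry_le x) k)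
      (fun k => hX.exists_entrance_level hD₁ hD₂ hD hno hj
        (fun i => (H.assumptionA_R.mem_eta i).1) (H.entry_eq k))
    refine ⟨h1, h2, h3, h4, C, hC, hA _ (fun i y => ?_) fun i x => ?_⟩
    · exact etaA3_right hD _ _ _ _ _ _ y
    · exact hX.etaA3_left hD₂ hD H.assumptionA_P H.assumptionA_R.measurable_W
        H.assumptionA_R.one_le_W H.jump hj (H.assumptionA_R.mem_eta i) _ _ x
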